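/- **Setting.** Let $(\mathcal E,\otimes,e)$ be a cocomplete symmetric monoidal category, i.e. $\mathcal E$ has all small colimits and $A\otimes-$ and $-\otimes A$ preserve small colimits for every object $A$. A *polynomial* $J\xleftarrow{s}E\xrightarrow{p}B\xrightarrow{t}I$ is a diagram of sets all of whose fibres $p^{-1}(b)$ are finite. A 2-cell $(s,p,t)\Rightarrow(s',p',t')$ between polynomials from $J$ to $I$ is a pair of maps $E\to E'$, $B\to B'$ compatible with $s,p,t$ such that the square formed with $p,p'$ is a pullback. A *polynomial monad* on $\mathbf{Set}/I$ is a monad in the resulting 2-category, that is, a polynomial $I\leftarrow E\to B\to I$ with a unit and a multiplication that are such 2-cells and satisfy the monad laws. The elements $b\in B$ are its operations, $t(b)$ is the target of $b$, the elements of the fibre $p^{-1}(b)$ are the inputs of $b$, and $s$ gives their sources; there are unit operations $1_i$ ($i\in I$) and composite operations $b(f)$, for $f=(f_e)_{e\in p^{-1}(b)}$ with $t(f_e)=s(e)$, and the inputs of $b(f)$ are the pairs of an input $e$ of $b$ and an input of $f_e$. Let $S$ be a polynomial monad on $\mathbf{Set}/J$ and $T$ a polynomial monad on $\mathbf{Set}/I$.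 A *cartesian morphism* $\Phi:S\to T$ consists of maps $\delta:J\to I$, $\psi:E_S\to E_T$, $\phi:B_S\to B_T$ compatible with $s,p,t$, such that the square formed with $p_S,p_T$ is a pullback, and which respect units and multiplications. A *$T$-algebra* in $\mathcal E$ is a family $(A_i)_{i\in I}$ of objects with morphisms $m_{(b,\sigma)}:A_{s(e_1)}\otimes\dots\otimes A_{s(e_k)}\to A_{t(b)}$ for each operation $b$ and each linear ordering $\sigma=(e_1,\dots,e_k)$ of $p^{-1}(b)$, satisfying equivariance, unit and associativity conditions; morphisms are families of morphisms of $\mathcal E$ commuting with all $m_{(b,\sigma)}$. Restriction along $\Phi$ sends a $T$-algebra $A$ to the $S$-algebra $(A_{\delta(j)})_{j\in J}$ on which $d\in B_S$ acts as $\phi(d)$; this gives a functor $\delta^\Phi_{\mathcal E}:\mathrm{Alg}_T(\mathcal E)\to \mathrm{Alg}_S(\mathcal E)$. For $i\in I$ let $\mathbf T^{S}_i$ be the category whose objects are the $J$-coloured operations $c=(b,\mathrm{col})$: $b\in B_T$ with $t(b)=i$ and $\mathrm{col}:p^{-1}(b)\to J$ with $\delta(\mathrm{col}(e))=s(e)$.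 A morphism $c'\to c$ is a family $(d_e)_{e\in p^{-1}(b)}$ of operations of $S$, with $t(d_e)=\mathrm{col}(e)$, such that $c'=\theta(c;d)$, where $\theta(c;d)$ is the operation $b(\phi(d_e))_e$ coloured by the sources of the inputs of the $d_e$; identities and composition come from the unit and multiplication of $S$. Let $\mathbf T^T_i$ be the same category formed with $\Phi=\mathrm{id}_T$, $1_i\in\mathbf T^T_i$ the object given by the unit operation, and $\mathbf T^\Phi:\mathbf T^S_i\to\mathbf T^T_i$ the functor that forgets the $J$-colouring and sends $(d_e)$ to $(\phi(d_e))$. An $S$-algebra $X$ defines a functor $\tilde X:\mathbf T^S_i\to\mathcal E$ by $\tilde X(c)=X_{j_1}\otimes\dots\otimes X_{j_k}$, where $j_1,\dots,j_k$ are the colours of $c$ listed in a chosen linear ordering of the inputs; on a morphism $(d_e)$ it is given by permuting the factors into blocks and letting the $d_e$ act. In the same way a $T$-algebra $Y$ defines $\tilde Y:\mathbf T^T_i\to\mathcal E$. **Theorem.** The restriction functor $\delta^\Phi_{\mathcal E}:\mathrm{Alg}_T(\mathcal E)\to\mathrm{Alg}_S(\mathcal E)$ has a left adjoint $\gamma^\Phi_{\mathcal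 E}$. For every left adjoint $\gamma$ of it, every $S$-algebra $X$ in $\mathcal E$ and every $i\in I$, $$\gamma(X)_i\;\cong\;(\mathbf T^\Phi)_!(\tilde X)(1_i)\;\cong\;\operatorname*{colim}_{c\in\mathbf T^S_i}\tilde X(c),$$ where $(\mathbf T^\Phi)_!$ denotes left Kan extension along $\mathbf T^\Phi:\mathbf T^S_i\to\mathbf T^T_i$. More precisely, let $\eta:X\to\delta^\Phi_{\mathcal E}\gamma(X)$ be the unit of the adjunction. The morphisms $$\tilde X(c)=X_{j_1}\otimes\dots\otimes X_{j_k}\xrightarrow{\ \eta_{j_1}\otimes\dots\otimes\eta_{j_k}\ }\gamma(X)_{s(e_1)}\otimes\dots\otimes\gamma(X)_{s(e_k)}\xrightarrow{\ b\ }\gamma(X)_i ,\qquad c=(b,\mathrm{col})\in\mathbf T^S_i,$$ form a colimit cocone on $\tilde X$, and the composite $(\mathbf T^\Phi)_!(\tilde X)(1_i)\to\widetilde{\gamma(X)}(1_i)\to\gamma(X)_i$, of the map induced by the tensor products of components of $\eta$ with the action of $1_i$, is an isomorphism. -/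

import Mathlib

universe w v u

open CategoryTheory MonoidalCategory Limits

namespace PolyMonads

section Lists

/-- Concatenation of lists, equal to `l ++ m`. -/
@[reducible] def append {F : Type*} : List F → List F → List F
  | [], m => m
  | x :: l, m => x :: append l m

/-- Concatenation of the lists `L g`, for `g` in `l`, equal to `l.flatMap L`. -/
@[reducible] def flat {F G : Type*} (L : G → List F) : List G → List F
  | [] => []
  | g :: l => append (L g) (flat L l)

/-- The list of the `f g`, for `g` in `l`, equal to `l.map f`. -/
@[reducible] def image {F G : Type*} (f : G → F) : List G → List F
  | [] => []
  | g :: l => f g :: image f l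

theorem append_eq {F : Type*} (l m : List F) : append l m = l ++ m := by
  induction l with
  | nil => rfl
  | cons x l ih => exact congrArg (x :: ·) ih

theorem flat_eq {F G : Type*} (L : G → List F) (l : List G) : flat L l = l.flatMap L := by
  induction l with
  | nil => rfl
  | cons x l ih => rw [List.flatMap_cons, ← ih, ← append_eq]

theorem image_eq {F G : Type*} (f : G → F) (l : List G) : image f l = l.map f := by
  induction l with
  | nil => rfl
  | cons x l ih => rw [List.map_cons, ← ih]

end Lists

section Tensor

variable {C : Type u} [Category.{v} C] [MonoidalCategory C]

/-- The ordered tensor product `X x₁ ⊗ (X x₂ ⊗ (⋯ ⊗ 𝟙))` over a list `[x₁, x₂, …]`. -/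
@[reducible] def tensorOver {F : Type*} (X : F → C) : List F → C
  | [] => 𝟙_ C
  | x :: l => X x ⊗ tensorOver X l

/-- Functoriality of the ordered tensor product in the family. -/
def tensorMap {F : Type*} {X Y : F → C} (h : ∀ x, X x ⟶ Y x) :
    ∀ l : List F, tensorOver X l ⟶ tensorOver Y l
  | [] => 𝟙 _
  | x :: l => h x ⊗ₘ tensorMap h l

/-- Tensor product of morphisms `X (f g) ⟶ Y g` over `g` in `l`. -/
def tensorPull {F G : Type*} {X : F → C} {Y : G → C} (f : G → F) (h : ∀ g, X (f g) ⟶ Y g) :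
    ∀ l : List G, tensorOver X (image f l) ⟶ tensorOver Y l
  | [] => 𝟙 _
  | x :: l => h x ⊗ₘ tensorPull f h l

/-- Concatenation of lists gives the tensor product (by associativity constraints). -/
def tensorAppend {F : Type*} (X : F → C) :
    ∀ l m : List F, tensorOver X (append l m) ≅ tensorOver X l ⊗ tensorOver X m
  | [], m => (λ_ (tensorOver X m)).symm
  | x :: l, m => whiskerLeftIso (X x) (tensorAppend X l m) ≪≫ (α_ _ _ _).symm

/-- Given morphisms `⨂_{x ∈ L g} X x ⟶ Y g`, tensor them together. -/
def tensorFlat {F G : Type*} {X : F → C} {Y : G → C} (L : G → List F)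
    (h : ∀ g, tensorOver X (L g) ⟶ Y g) :
    ∀ l : List G, tensorOver X (flat L l) ⟶ tensorOver Y l
  | [] => 𝟙 _
  | g :: l => (tensorAppend X (L g) (flat L l)).hom ≫ (h g ⊗ₘ tensorFlat L h l)

variable [SymmetricCategory C]

/-- The symmetry exchanging the first two factors. -/
def tensorSwap (A B D : C) : A ⊗ (B ⊗ D) ≅ B ⊗ (A ⊗ D) :=
  (α_ A B D).symm ≪≫ whiskerRightIso (β_ A B) D ≪≫ α_ B A D

/-- An auxiliary linear order on an arbitrary type. -/
def auxLE {F : Type*} (a b : F) : Prop := ¬ WellOrderingRel b a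

instance {F : Type*} : Std.Total (auxLE (F := F)) where
  total a b := by
    unfold auxLE
    by_contra h
    push Not at h
    exact asymm h.1 h.2

instance {F : Type*} : IsTrans F auxLE where
  trans a b c h1 h2 h3 := by
    rcases trichotomous_of WellOrderingRel a b with h | h | h
    · exact h2 (_root_.trans h3 h)
    · subst h; exact h2 h3
    · exact h1 h

instance {F : Type*} : Std.Antisymm (auxLE (F := F)) where
  antisymm a b h1 h2 := by
    rcases trichotomous_of WellOrderingRel a b with h | h | h
    · exact (h2 h).elim
    · exact h
    · exact (h1 h).elim

noncomputable section
open scoped Classical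

/-- The sorted list, equal to `l.insertionSort auxLE`. -/
@[reducible] def sortList {F : Type*} : List F → List F
  | [] => []
  | a :: l => (sortList l).orderedInsert auxLE a

theorem sortList_eq {F : Type*} (l : List F) : sortList l = l.insertionSort auxLE := by
  induction l with
  | nil => rfl
  | cons a l ih => rw [List.insertionSort_cons, ← ih]

/-- Move the first factor to its place in a sorted list by successive symmetries. -/
def tensorInsert {F : Type*} (X : F → C) (a : F) :
    ∀ l : List F, X a ⊗ tensorOver X l ≅ tensorOver X (l.orderedInsert auxLE a)
  | [] => Iso.refl _
  | b :: l =>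
    if h : auxLE a b then
      eqToIso (by rw [List.orderedInsert_cons_of_le _ _ h])
    else
      tensorSwap _ _ _ ≪≫ whiskerLeftIso (X b) (tensorInsert X a l) ≪≫
        eqToIso (by rw [List.orderedInsert_of_not_le _ _ h])

/-- Sort the tensor factors by successive symmetries. -/
def tensorSort {F : Type*} (X : F → C) :
    ∀ l : List F, tensorOver X l ≅ tensorOver X (sortList l)
  | [] => Iso.refl _
  | a :: l => whiskerLeftIso (X a) (tensorSort X l) ≪≫ tensorInsert X a _

theorem sortList_eq_of_perm {F : Type*} {l l' : List F} (h : l.Perm l') :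
    sortList l = sortList l' := by
  rw [sortList_eq, sortList_eq]
  exact List.Perm.eq_of_pairwise' (List.pairwise_insertionSort _ _) (List.pairwise_insertionSort _ _)
    ((List.perm_insertionSort _ _).trans (h.trans (List.perm_insertionSort _ _).symm))

/-- The canonical symmetry isomorphism between the tensor products over two orderings `l`, `l'` of the
same factors: sort the factors of `l` by successive symmetries, and compare with `l'`. By coherence, it
does not depend on the auxiliary order if `l` has no repetitions. In fact `tensorPerm_refl`,
`tensorPerm_trans`, `tensorPerm_cons` and `tensorPerm_swap` below characterize it: it is functorial,
it is `X a ◁ -` on permutations that fix the first factor `X a`, and it is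
the symmetry of `C` on the transposition of the first two factors. -/
def tensorPerm {F : Type*} (X : F → C) {l l' : List F} (h : l.Perm l') :
    tensorOver X l ≅ tensorOver X l' :=
  tensorSort X l ≪≫ eqToIso (by rw [sortList_eq_of_perm h]) ≪≫ (tensorSort X l').symm

theorem tensorPerm_refl {F : Type*} (X : F → C) {l : List F} (h : l.Perm l) :
    (tensorPerm X h).hom = 𝟙 _ := by
  simp [tensorPerm]

theorem tensorPerm_eq {F : Type*} (X : F → C) {l l' : List F} (h : l.Perm l') (e : l = l') :
    (tensorPerm X h).hom = eqToHom (by rw [e]) := by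
  subst e; exact tensorPerm_refl X h

theorem tensorPerm_trans {F : Type*} (X : F → C) {l l' l'' : List F} (h : l.Perm l')
    (h' : l'.Perm l'') :
    (tensorPerm X h).hom ≫ (tensorPerm X h').hom = (tensorPerm X (h.trans h')).hom := by
  simp [tensorPerm]

theorem tensorPerm_trans_assoc {F : Type*} (X : F → C) {l l' l'' : List F} (h : l.Perm l')
    (h' : l'.Perm l'') {W : C} (k : tensorOver X l'' ⟶ W) :
    (tensorPerm X h).hom ≫ (tensorPerm X h').hom ≫ k = (tensorPerm X (h.trans h')).hom ≫ k := by
  rw [← Category.assoc, tensorPerm_trans]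

theorem tensorInsert_congr {F : Type*} (X : F → C) (a : F) {l l' : List F} (e : l = l') :
   (tensorInsert X a l).hom = X a ◁ eqToHom (by rw [e]) ≫ (tensorInsert X a l').hom ≫
      eqToHom (by rw [e]) := by
  subst e; simp

theorem tensorPerm_cons {F : Type*} (X : F → C) (a : F) {l l' : List F} (h : l.Perm l') :
    (tensorPerm X (h.cons a)).hom = X a ◁ (tensorPerm X h).hom := by
  have e := sortList_eq_of_perm h
  simp only [tensorPerm, tensorSort, Iso.trans_hom, Iso.symm_hom, whiskerLeftIso_hom, eqToIso.hom,
    Iso.trans_inv, whiskerLeftIso_inv, Category.assoc, MonoidalCategory.whiskerLeft_comp]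
  rw [tensorInsert_congr X a e]
  simp

theorem tensorInsert_of_le {F : Type*} (X : F → C) {a b : F} (l : List F) (h : auxLE a b) :
    (tensorInsert X a (b :: l)).hom = 
      eqToHom (by rw [List.orderedInsert_cons_of_le _ _ h]) := by
  simp [tensorInsert, h]

theorem tensorInsert_of_not_le {F : Type*} (X : F → C) {a b : F} (l : List F) (h : ¬ auxLE a b) :
    (tensorInsert X a (b :: l)).hom = (tensorSwap _ _ _).hom ≫ X b ◁ (tensorInsert X a l).hom ≫
      eqToHom (by rw [List.orderedInsert_of_not_le _ _ h]) := by
  simp [tensorInsert, h]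

@[simp]
theorem tensorSwap_swap (A B D : C) : (tensorSwap A B D).hom ≫ (tensorSwap B A D).hom = 𝟙 _ := by
  simp [tensorSwap, ← comp_whiskerRight_assoc]

@[simp]
theorem tensorSwap_swap_assoc (A B D : C) {W : C} (k : A ⊗ (B ⊗ D) ⟶ W) :
    (tensorSwap A B D).hom ≫ (tensorSwap B A D).hom ≫ k = k := by
  rw [← Category.assoc, tensorSwap_swap, Category.id_comp]

theorem tensorSwap_natural (A B : C) {D D' : C} (f : D ⟶ D') :
    (tensorSwap A B D).hom ≫ B ◁ A ◁ f = A ◁ B ◁ f ≫ (tensorSwap A B D').hom := by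
  simp only [tensorSwap, Iso.trans_hom, Iso.symm_hom, whiskerRightIso_hom, Category.assoc]
  rw [← associator_naturality_right, ← whisker_exchange_assoc,
    associator_inv_naturality_right_assoc]

theorem tensorSwap_natural_assoc (A B : C) {D D' : C} (f : D ⟶ D') {W : C}
    (k : B ⊗ (A ⊗ D') ⟶ W) :
    (tensorSwap A B D).hom ≫ B ◁ A ◁ f ≫ k = A ◁ B ◁ f ≫ (tensorSwap A B D').hom ≫ k := by
  rw [← Category.assoc, tensorSwap_natural, Category.assoc]

theorem tensorSwap_naturality {A A' B B' D D' : C} (f : A ⟶ A') (g : B ⟶ B') (h : D ⟶ D') :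
    (f ⊗ₘ (g ⊗ₘ h)) ≫ (tensorSwap A' B' D').hom = (tensorSwap A B D).hom ≫ (g ⊗ₘ (f ⊗ₘ h)) := by
  simp only [tensorSwap, Iso.trans_hom, Iso.symm_hom, whiskerRightIso_hom, Category.assoc]
  rw [associator_inv_naturality_assoc, ← associator_naturality, tensorHom_comp_whiskerRight_assoc,
    BraidedCategory.braiding_naturality, whiskerRight_comp_tensorHom_assoc]

theorem tensorSwap_yb (A B D E : C) :
    (tensorSwap A B (D ⊗ E)).hom ≫ B ◁ (tensorSwap A D E).hom ≫ (tensorSwap B D (A ⊗ E)).hom =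
    A ◁ (tensorSwap B D E).hom ≫ (tensorSwap A D (B ⊗ E)).hom ≫ D ◁ (tensorSwap A B E).hom := by
  simp only [tensorSwap, Iso.trans_hom, Iso.symm_hom, whiskerRightIso_hom]
  calc _ = 𝟙 _ ⊗≫ ((β_ A B).hom ▷ D ⊗≫ B ◁ (β_ A D).hom ⊗≫ (β_ B D).hom ▷ A) ▷ E ⊗≫ 𝟙 _ := by
        monoidal
    _ = _ := by
        rw [BraidedCategory.yang_baxter']
        monoidal

theorem tensorSwap_yb_assoc (A B D E : C) {W : C} (k : D ⊗ (B ⊗ (A ⊗ E)) ⟶ W) :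
    (tensorSwap A B (D ⊗ E)).hom ≫ B ◁ (tensorSwap A D E).hom ≫
      (tensorSwap B D (A ⊗ E)).hom ≫ k =
    A ◁ (tensorSwap B D E).hom ≫ (tensorSwap A D (B ⊗ E)).hom ≫
      D ◁ (tensorSwap A B E).hom ≫ k := by
  have h := tensorSwap_yb A B D E
  rw [reassoc_of% h]

theorem orderedInsert_comm {F : Type*} (a b : F) (l : List F) :
    (l.orderedInsert auxLE a).orderedInsert auxLE b =
      (l.orderedInsert auxLE b).orderedInsert auxLE a := by
  have t := fun x y : F => total_of auxLE x y
  have tr := fun x y z : F => @trans_of F auxLE x y z _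
  have an := fun x y : F => @antisymm_of F auxLE _ x y
  induction l with
  | nil => simp only [List.orderedInsert]; grind
  | cons c l ih =>
    simp only [List.orderedInsert]
    grind [List.orderedInsert]

theorem tensorInsert_head {F : Type*} (X : F → C) {a : F} {m : List F}
    (h : ∀ x ∈ m.head?, auxLE a x) :
    ∃ e : a :: m = m.orderedInsert auxLE a,
      (tensorInsert X a m).hom = eqToHom (congrArg (tensorOver X) e) := by
  cases m with
  | nil => exact ⟨rfl, rfl⟩
  | cons b l =>
    have h : auxLE a b := h b rfl
    exact ⟨(List.orderedInsert_cons_of_le _ _ h).symm, tensorInsert_of_le X l h⟩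

theorem tensorInsert_insert_of_le {F : Type*} (X : F → C) {a b : F} (hab : a ≠ b)
    (hle : auxLE a b) (l : List F) (h : ∀ x ∈ l.head?, auxLE a x) :
    (tensorSwap (X a) (X b) _).hom ≫ X b ◁ (tensorInsert X a l).hom ≫ (tensorInsert X b _).hom =
    X a ◁ (tensorInsert X b l).hom ≫ (tensorInsert X a _).hom ≫
      eqToHom (by rw [orderedInsert_comm]) := by
  have hba : ¬ auxLE b a := fun h => hab (antisymm_of auxLE hle h)
  have h' : ∀ x ∈ (l.orderedInsert auxLE b).head?, auxLE a x := by
    cases l with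
    | nil => simpa using hle
    | cons c l =>
      intro x hx
      simp only [List.orderedInsert] at hx
      split_ifs at hx
      · simp only [List.head?_cons, Option.mem_def, Option.some.injEq] at hx; exact hx ▸ hle
      · simp only [List.head?_cons, Option.mem_def, Option.some.injEq] at hx; exact h x (by simp [hx])
  obtain ⟨e1, h1⟩ := tensorInsert_head X h
  obtain ⟨e2, h2⟩ := tensorInsert_head X h'
  rw [h1, h2, tensorInsert_congr X b e1.symm, tensorInsert_of_not_le _ _ hba]
  simp

theorem tensorInsert_insert {F : Type*} (X : F → C) {a b : F} (hab : a ≠ b) (l : List F) :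
    (tensorSwap (X a) (X b) _).hom ≫ X b ◁ (tensorInsert X a l).hom ≫ (tensorInsert X b _).hom =
    X a ◁ (tensorInsert X b l).hom ≫ (tensorInsert X a _).hom ≫
      eqToHom (by rw [orderedInsert_comm]) := by
  have key2 : ∀ l : List F, auxLE b a → (∀ x ∈ l.head?, auxLE b x) →
      (tensorSwap (X a) (X b) _).hom ≫ X b ◁ (tensorInsert X a l).hom ≫ (tensorInsert X b _).hom =
      X a ◁ (tensorInsert X b l).hom ≫ (tensorInsert X a _).hom ≫
        eqToHom (by rw [orderedInsert_comm]) := by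
    intro l hle h
    have := tensorInsert_insert_of_le X hab.symm hle l h
    rw [← cancel_epi (tensorSwap (X a) (X b) _).hom, tensorSwap_swap_assoc] at this
    rw [reassoc_of% this]
    simp
  induction l with
  | nil =>
    rcases total_of auxLE a b with hle | hle
    · exact tensorInsert_insert_of_le X hab hle [] (by simp)
    · exact key2 [] hle (by simp)
  | cons c l ih =>
    by_cases hac : auxLE a c
    · rcases total_of auxLE a b with hle | hle
      · exact tensorInsert_insert_of_le X hab hle _ (by simpa using hac)
      · exact key2 _ hle (by simpa using trans_of auxLE hle hac)
    · by_cases hbc : auxLE b c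
      · have hca := (total_of auxLE a c).resolve_left hac
        exact key2 _ (trans_of auxLE hbc hca) (by simpa using hbc)
      · rw [tensorInsert_congr X b (List.orderedInsert_of_not_le _ _ hac),
          tensorInsert_congr X a (List.orderedInsert_of_not_le _ _ hbc),
          tensorInsert_of_not_le _ _ hac, tensorInsert_of_not_le _ _ hbc,
          tensorInsert_of_not_le _ _ hac, tensorInsert_of_not_le _ _ hbc]
        simp only [MonoidalCategory.whiskerLeft_comp, Category.assoc, whiskerLeft_eqToHom,
          eqToHom_trans_assoc, eqToHom_refl, Category.id_comp, eqToHom_trans]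
        rw [← tensorSwap_natural_assoc, ← tensorSwap_natural_assoc, tensorSwap_yb_assoc,
          ← MonoidalCategory.whiskerLeft_comp_assoc, ← MonoidalCategory.whiskerLeft_comp_assoc,
          Category.assoc, ih]
        simp

theorem tensorPerm_swap {F : Type*} (X : F → C) {a b : F} (hab : a ≠ b) (l : List F) :
    (tensorPerm X (List.Perm.swap b a l)).hom = (tensorSwap (X a) (X b) _).hom := by
  have := tensorInsert_insert X hab (sortList l)
  rw [tensorPerm, Iso.trans_hom, Iso.trans_hom, Iso.symm_hom, ← Category.assoc, Iso.comp_inv_eq]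
  simp only [tensorSort, Iso.trans_hom, whiskerLeftIso_hom, MonoidalCategory.whiskerLeft_comp,
    Category.assoc, eqToIso.hom]
  rw [tensorSwap_natural_assoc, this]

/-- Induction principle: symmetries of lists without repetitions are generated by adjacent
transpositions. -/
theorem perm_induction {F : Type*} {Q : ∀ l l' : List F, l.Perm l' → Prop}
    (refl : ∀ l, Q l l (List.Perm.refl l))
    (cons : ∀ a (l l' : List F) (h : l.Perm l'), a ∉ l → l.Nodup → Q l l' h → Q _ _ (h.cons a))
    (swap : ∀ a b (l : List F), a ≠ b → (a :: b :: l).Nodup → Q (a :: b :: l) (b :: a :: l) (List.Perm.swap b a l))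
    (trans : ∀ (l l' l'' : List F) (h : l.Perm l') (h' : l'.Perm l''), l.Nodup → Q _ _ h → Q _ _ h' → Q _ _ (h.trans h'))
    {l l' : List F} (h : l.Perm l') (hl : l.Nodup) : Q l l' h := by
  induction h with
  | nil => exact refl _
  | cons a h ih => exact cons _ _ _ h (List.nodup_cons.1 hl).1 (List.nodup_cons.1 hl).2 (ih (List.nodup_cons.1 hl).2)
  | swap b a l => exact swap a b l (by simp at hl; tauto) hl
  | trans h h' ih ih' => exact trans _ _ _ h h' hl (ih hl) (ih' (h.nodup_iff.1 hl))

theorem append_assoc {F : Type*} (a b c : List F) :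
    append (append a b) c = append a (append b c) := by
  simp [append_eq]

theorem append_nil {F : Type*} (a : List F) : append a [] = a := by
  simp [append_eq]

theorem append_perm {F : Type*} {a a' b b' : List F} (h : a.Perm a') (h' : b.Perm b') :
    (append a b).Perm (append a' b') := by
  rw [append_eq, append_eq]; exact h.append h'

theorem flat_append {F G : Type*} (L : G → List F) (a b : List G) :
    flat L (append a b) = append (flat L a) (flat L b) := by
  simp [append_eq, flat_eq]

theorem flat_flat {F G H : Type*} (L : G → List F) (M : H → List G) (n : List H) :
    flat L (flat M n) = flat (fun x => flat L (M x)) n := by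
  simp [flat_eq, List.flatMap_assoc]

theorem flat_perm {F G : Type*} {L L' : G → List F} (hL : ∀ g, (L g).Perm (L' g)) {l l' : List G}
    (h : l.Perm l') : (flat L l).Perm (flat L' l') := by
  rw [flat_eq, flat_eq]; exact List.Perm.flatMap h fun a _ => hL a

theorem tensorPerm_append_left {F : Type*} (X : F → C) (a : List F) {m m' : List F}
    (h : m.Perm m') (h' : (append a m).Perm (append a m')) :
    (tensorPerm X h').hom ≫ (tensorAppend X a m').hom =
      (tensorAppend X a m).hom ≫ _ ◁ (tensorPerm X h).hom := by
  induction a with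
  | nil => simp [tensorAppend]
  | cons x a ih =>
    have e : append a m |>.Perm (append a m') := append_perm (List.Perm.refl _) h
    rw [tensorPerm_cons X x e]
    simp only [tensorAppend, Iso.trans_hom, whiskerLeftIso_hom, Iso.symm_hom, Category.assoc]
    rw [← MonoidalCategory.whiskerLeft_comp_assoc, ih e, MonoidalCategory.whiskerLeft_comp,
      Category.assoc, associator_inv_naturality_right]

theorem tensorPerm_append_right {F : Type*} (X : F → C) {l l' : List F} (m : List F)
    (h : l.Perm l') (hl : l.Nodup) (h' : (append l m).Perm (append l' m)) :
    (tensorPerm X h').hom ≫ (tensorAppend X l' m).hom =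
      (tensorAppend X l m).hom ≫ (tensorPerm X h).hom ▷ _ := by
  revert h'
  refine perm_induction (Q := fun l l' h => ∀ h' : (append l m).Perm (append l' m),
    (tensorPerm X h').hom ≫ (tensorAppend X l' m).hom =
      (tensorAppend X l m).hom ≫ (tensorPerm X h).hom ▷ _) ?_ ?_ ?_ ?_ h hl
  · intro l h'
    rw [tensorPerm_refl, tensorPerm_refl]; simp
  · intro a l l' h _ _ ih h'
    have e := append_perm h (List.Perm.refl m)
    rw [tensorPerm_cons X a e, tensorPerm_cons]
    simp only [tensorAppend, Iso.trans_hom, whiskerLeftIso_hom, Iso.symm_hom, Category.assoc]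
    rw [← MonoidalCategory.whiskerLeft_comp_assoc, ih e, MonoidalCategory.whiskerLeft_comp,
      Category.assoc, associator_inv_naturality_middle]
  · intro a b l hab _ h'
    rw [tensorPerm_swap X hab, tensorPerm_swap X hab]
    simp only [tensorAppend, Iso.trans_hom, whiskerLeftIso_hom, Iso.symm_hom, Category.assoc,
      MonoidalCategory.whiskerLeft_comp]
    rw [tensorSwap_natural_assoc]
    simp only [tensorSwap, Iso.trans_hom, Iso.symm_hom, whiskerRightIso_hom]
    monoidal
  · intro l l' l'' h h' _ ih ih' h''
    rw [← tensorPerm_trans X (append_perm h (List.Perm.refl m)) (append_perm h' (List.Perm.refl m)),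
      Category.assoc, ih', ← Category.assoc, ih, ← tensorPerm_trans X h h', comp_whiskerRight,
      Category.assoc]

theorem tensorAppend_assoc {F : Type*} (X : F → C) (a b c : List F)
    (h : (append (append a b) c).Perm (append a (append b c))) :
    (tensorAppend X (append a b) c).hom ≫ (tensorAppend X a b).hom ▷ _ ≫ (α_ _ _ _).hom =
      (tensorPerm X h).hom ≫ (tensorAppend X a (append b c)).hom ≫
        _ ◁ (tensorAppend X b c).hom := by
  induction a with
  | nil =>
    rw [tensorPerm_refl]
    simp [tensorAppend]
  | cons x a ih =>
    have e : (append (append a b) c).Perm (append a (append b c)) := by rw [append_assoc]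
    rw [tensorPerm_cons X x e]
    simp only [tensorAppend, Iso.trans_hom, whiskerLeftIso_hom, Iso.symm_hom, Category.assoc]
    rw [← MonoidalCategory.whiskerLeft_comp_assoc, ← associator_inv_naturality_right,
      ← MonoidalCategory.whiskerLeft_comp_assoc, Category.assoc, ← ih e]
    monoidal

theorem tensorAppend_nil {F : Type*} (X : F → C) (a : List F) (h : a.Perm (append a [])) :
    (tensorPerm X h).hom ≫ (tensorAppend X a []).hom = (ρ_ _).inv := by
  induction a with
  | nil => rw [tensorPerm_refl]; simp [tensorAppend, unitors_inv_equal]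
  | cons x a ih =>
    have e : a.Perm (append a []) := by rw [append_nil]
    rw [tensorPerm_cons X x e]
    simp only [tensorAppend, Iso.trans_hom, whiskerLeftIso_hom, Iso.symm_hom, Category.assoc]
    rw [← MonoidalCategory.whiskerLeft_comp_assoc, ih e]
    simp

theorem tensorPerm_block_one {F : Type*} (X : F → C) (a : F) (m l : List F) (ham : a ∉ m)
    (h : (a :: append m l).Perm (append m (a :: l))) :
    (tensorPerm X h).hom ≫ (tensorAppend X m (a :: l)).hom =
      X a ◁ (tensorAppend X m l).hom ≫ (tensorSwap _ _ _).hom := by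
  induction m with
  | nil => 
    rw [tensorPerm_refl]
    simp [tensorAppend, tensorSwap]
  | cons b m ih =>
    have e : (a :: append m l).Perm (append m (a :: l)) := by
      rw [append_eq, append_eq]; exact List.perm_middle.symm
    have hab : a ≠ b := fun h => ham (by simp [h])
    rw [← tensorPerm_trans X (List.Perm.swap b a (append m l)) (e.cons b), tensorPerm_swap X hab,
      tensorPerm_cons X b e]
    simp only [tensorAppend, Iso.trans_hom, whiskerLeftIso_hom, Iso.symm_hom, Category.assoc]
    rw [← MonoidalCategory.whiskerLeft_comp_assoc, ih (fun h => ham (by simp [h])) e,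
      MonoidalCategory.whiskerLeft_comp, Category.assoc, tensorSwap_natural_assoc]
    simp only [tensorSwap, Iso.trans_hom, Iso.symm_hom, whiskerRightIso_hom,
      BraidedCategory.braiding_tensor_right_hom]
    monoidal

theorem tensorPerm_block {F : Type*} (X : F → C) (l m : List F) (hlm : (append l m).Nodup)
    (h : (append l m).Perm (append m l)) :
    (tensorPerm X h).hom ≫ (tensorAppend X m l).hom = (tensorAppend X l m).hom ≫ (β_ _ _).hom := by
  induction l with
  | nil =>
    rw [tensorAppend_nil]
    simp [tensorAppend]
  | cons a l ih =>
    have e : (append l m).Perm (append m l) := by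
      rw [append_eq, append_eq]; exact List.perm_append_comm
    have e' : (a :: append m l).Perm (append m (a :: l)) := by
      rw [append_eq, append_eq]; exact List.perm_middle.symm
    obtain ⟨h1, h2⟩ := List.nodup_cons.1 hlm
    have hm : a ∉ m := by rw [append_eq] at h1; simp at h1; exact h1.2
    rw [← tensorPerm_trans X (e.cons a) e', Category.assoc, tensorPerm_block_one X a m l hm,
      tensorPerm_cons X a e, ← MonoidalCategory.whiskerLeft_comp_assoc, ih h2 e]
    simp only [tensorAppend, Iso.trans_hom, whiskerLeftIso_hom, Iso.symm_hom, Category.assoc,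
      tensorSwap, whiskerRightIso_hom, BraidedCategory.braiding_tensor_left_hom]
    monoidal

theorem tensorPerm_block_mid {F : Type*} (X : F → C) (a b r : List F)
    (hab : (append a (append b r)).Nodup)
    (h : (append a (append b r)).Perm (append b (append a r))) :
    (tensorPerm X h).hom ≫ (tensorAppend X b (append a r)).hom ≫ _ ◁ (tensorAppend X a r).hom =
      (tensorAppend X a (append b r)).hom ≫ _ ◁ (tensorAppend X b r).hom ≫
        (tensorSwap _ _ _).hom := by
  have n : (append a b).Nodup := by
    rw [← append_assoc, append_eq (append a b)] at hab; exact (List.nodup_append.1 hab).1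
  have e1 : (append (append a b) r).Perm (append a (append b r)) := by rw [append_assoc]
  have e2 : (append (append b a) r).Perm (append b (append a r)) := by rw [append_assoc]
  have e3 : (append a b).Perm (append b a) := by
    rw [append_eq, append_eq]; exact List.perm_append_comm
  have e4 := append_perm e3 (List.Perm.refl r)
  have h1 := tensorAppend_assoc X a b r e1
  have h2 := tensorAppend_assoc X b a r e2
  rw [← cancel_epi (tensorPerm X e1).hom, tensorPerm_trans_assoc,
    ← tensorPerm_trans_assoc X e4 e2, ← h2, ← Category.assoc, tensorPerm_append_right X r e3 n,
    Category.assoc, ← comp_whiskerRight_assoc, tensorPerm_block X a b n e3, ← reassoc_of% h1]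
  simp [tensorSwap]

theorem tensorFlat_perm_inner {F G : Type*} {X : F → C} {Y : G → C} {L L' : G → List F}
    (hL : ∀ g, (L g).Perm (L' g)) (hn : ∀ g, (L g).Nodup)
    {k : ∀ g, tensorOver X (L g) ⟶ Y g}
    {k' : ∀ g, tensorOver X (L' g) ⟶ Y g} (hk : ∀ g, k g = (tensorPerm X (hL g)).hom ≫ k' g)
    (l : List G) (h : (flat L l).Perm (flat L' l)) :
    tensorFlat L k l = (tensorPerm X h).hom ≫ tensorFlat L' k' l := by
  induction l with
  | nil => rw [tensorPerm_refl]; simp [tensorFlat]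
  | cons g l ih =>
    have e := flat_perm hL (List.Perm.refl l)
    simp only [tensorFlat]
    rw [← tensorPerm_trans X (append_perm (hL g) (List.Perm.refl _))
      (append_perm (List.Perm.refl _) e), Category.assoc, ← Category.assoc (tensorPerm X _).hom
      (tensorAppend X _ _).hom, tensorPerm_append_left X _ e, ← Category.assoc, ← Category.assoc,
      tensorPerm_append_right X _ (hL g) (hn g), hk g, ih e]
    simp only [Category.assoc, MonoidalCategory.whiskerLeft_comp_tensorHom]
    rw [MonoidalCategory.whiskerRight_comp_tensorHom]

theorem tensorFlat_append {F G : Type*} {X : F → C} {Y : G → C} (L : G → List F)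
    (k : ∀ g, tensorOver X (L g) ⟶ Y g) (a b : List G)
    (h : (flat L (append a b)).Perm (append (flat L a) (flat L b))) :
    tensorFlat L k (append a b) ≫ (tensorAppend Y a b).hom =
      (tensorPerm X h).hom ≫ (tensorAppend X _ _).hom ≫ (tensorFlat L k a ⊗ₘ tensorFlat L k b) := by
  induction a with
  | nil => rw [tensorPerm_refl]; simp [tensorFlat, tensorAppend]
  | cons g a ih =>
    have e : (flat L (append a b)).Perm (append (flat L a) (flat L b)) := by rw [flat_append]
    have e1 : (append (append (L g) (flat L a)) (flat L b)).Perm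
      (append (L g) (append (flat L a) (flat L b))) := by rw [append_assoc]
    have h1 := tensorAppend_assoc X (L g) (flat L a) (flat L b) e1
    have h2 := tensorPerm_append_left X (L g) e (append_perm (List.Perm.refl _) e)
    simp only [tensorFlat, tensorAppend, Iso.trans_hom, whiskerLeftIso_hom, Iso.symm_hom,
      Category.assoc]
    rw [← tensorPerm_trans X (append_perm (List.Perm.refl _) e) e1.symm]
    have h3 : (tensorAppend X (append (L g) (flat L a)) (flat L b)).hom ≫
        (tensorAppend X (L g) (flat L a)).hom ▷ _ = (tensorPerm X e1).hom ≫
        (tensorAppend X (L g) (append (flat L a) (flat L b))).hom ≫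
          _ ◁ (tensorAppend X (flat L a) (flat L b)).hom ≫ (α_ _ _ _).inv := by
      rw [← reassoc_of% h1]; simp
    have h2' : (tensorPerm X e1.symm).hom ≫ (tensorPerm X e1).hom = 𝟙 _ := by
      rw [tensorPerm_trans, tensorPerm_refl]
    rw [← Category.id_comp (tensorFlat L k b), ← tensorHom_comp_tensorHom, tensorHom_id,
      reassoc_of% h3, Category.assoc, reassoc_of% h2', reassoc_of% h2, tensorHom_comp_whiskerLeft_assoc, ih e,
      ← associator_inv_naturality]
    simp only [whiskerLeft_comp_tensorHom_assoc]

theorem tensorFlat_perm {F G : Type*} {X : F → C} {Y : G → C} {L : G → List F}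
    (k : ∀ g, tensorOver X (L g) ⟶ Y g) {l l' : List G} (h : l.Perm l') (hl : l.Nodup)
    (hn : (flat L l).Nodup) (h' : (flat L l).Perm (flat L l')) :
    (tensorPerm X h').hom ≫ tensorFlat L k l' = tensorFlat L k l ≫ (tensorPerm Y h).hom := by
  revert hn h'
  refine perm_induction (Q := fun l l' h => (flat L l).Nodup → 
    ∀ h' : (flat L l).Perm (flat L l'),
    (tensorPerm X h').hom ≫ tensorFlat L k l' = tensorFlat L k l ≫ (tensorPerm Y h).hom)
    ?_ ?_ ?_ ?_ h hl
  · intro l _ h'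
    rw [tensorPerm_refl, tensorPerm_refl]; simp
  · intro a l l' h _ _ ih hn h'
    have e := flat_perm (fun g => List.Perm.refl (L g)) h
    have n : (flat L l).Nodup := by
      simp only [append_eq] at hn; exact (List.nodup_append.1 hn).2.1
    simp only [tensorFlat]
    rw [← Category.assoc, tensorPerm_append_left X _ e, tensorPerm_cons Y a h]
    simp only [Category.assoc, whiskerLeft_comp_tensorHom, ih n e, tensorHom_comp_whiskerLeft]
  · intro a b l hab _ hn h'
    have h1 := tensorPerm_block_mid X (L a) (L b) (flat L l) hn h'
    simp only [tensorFlat]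
    rw [tensorPerm_swap Y hab, Category.assoc]
    have h2 : ∀ (c d : G), k c ⊗ₘ (tensorAppend X (L d) (flat L l)).hom ≫ (k d ⊗ₘ tensorFlat L k l)
        = _ ◁ (tensorAppend X (L d) (flat L l)).hom ≫ (k c ⊗ₘ (k d ⊗ₘ tensorFlat L k l)) := by
      intro c d; rw [whiskerLeft_comp_tensorHom]
    rw [h2, h2, reassoc_of% h1, Category.assoc, tensorSwap_naturality]
  · intro l l' l'' h h' _ ih ih' hn h''
    have e := flat_perm (fun g => List.Perm.refl (L g)) h
    have e' := flat_perm (fun g => List.Perm.refl (L g)) h'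
    rw [← tensorPerm_trans X e e', Category.assoc, ih' (e.nodup_iff.1 hn) , ← Category.assoc,
      ih hn, ← tensorPerm_trans Y h h', Category.assoc]

theorem tensorFlat_flat {F G H : Type*} {X : F → C} {Y : G → C} {Z : H → C} (L : G → List F)
    (k : ∀ g, tensorOver X (L g) ⟶ Y g) (M : H → List G) (j : ∀ x, tensorOver Y (M x) ⟶ Z x)
    (n : List H) (h : (flat L (flat M n)).Perm (flat (fun x => flat L (M x)) n)) :
    tensorFlat L k (flat M n) ≫ tensorFlat M j n =
      (tensorPerm X h).hom ≫ tensorFlat (fun x => flat L (M x))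
        (fun x => tensorFlat L k (M x) ≫ j x) n := by
  induction n with
  | nil => rw [tensorPerm_refl]; simp [tensorFlat]
  | cons x n ih =>
    have e : (flat L (flat M n)).Perm (flat (fun x => flat L (M x)) n) := by rw [flat_flat]
    have e1 : (flat L (append (M x) (flat M n))).Perm (append (flat L (M x)) (flat L (flat M n))) := by
      rw [flat_append]
    have h1 := tensorFlat_append L k (M x) (flat M n) e1
    have h2 := tensorPerm_append_left X (flat L (M x)) e (append_perm (List.Perm.refl _) e)
    simp only [tensorFlat]
    rw [reassoc_of% h1, ← tensorPerm_trans X e1 (append_perm (List.Perm.refl _) e), Category.assoc,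
      reassoc_of% h2, tensorHom_comp_tensorHom, ih e,
      whiskerLeft_comp_tensorHom]

/-- Rearrange the factors `X x`, `x ∈ l`, into blocks `L g`, `g ∈ m`, and apply `k g` to the
block `L g`. -/
def tensorOp {F G : Type*} {X : F → C} {Y : G → C} (L : G → List F)
    (k : ∀ g, tensorOver X (L g) ⟶ Y g) {l : List F} {m : List G} (h : l.Perm (flat L m)) :
    tensorOver X l ⟶ tensorOver Y m :=
  (tensorPerm X h).hom ≫ tensorFlat L k m

theorem tensorOp_comp {F G H : Type*} {X : F → C} {Y : G → C} {Z : H → C} {L : G → List F}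
    {k : ∀ g, tensorOver X (L g) ⟶ Y g} {M : H → List G} {j : ∀ x, tensorOver Y (M x) ⟶ Z x}
    {l : List F} {m : List G} {n : List H} (h : l.Perm (flat L m)) (h' : m.Perm (flat M n))
    (hl : l.Nodup) (hm : m.Nodup) (h'' : l.Perm (flat (fun x => flat L (M x)) n)) :
    tensorOp L k h ≫ tensorOp M j h' =
      tensorOp (fun x => flat L (M x)) (fun x => tensorFlat L k (M x) ≫ j x) h'' := by
  have e := flat_perm (fun g => List.Perm.refl (L g)) h'
  have e' : (flat L (flat M n)).Perm (flat (fun x => flat L (M x)) n) := by rw [flat_flat]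
  have h1 := tensorFlat_perm k h' hm (h.nodup_iff.1 hl) e
  simp only [tensorOp, Category.assoc]
  rw [← reassoc_of% h1, tensorFlat_flat L k M j n e', tensorPerm_trans_assoc,
    tensorPerm_trans_assoc]

theorem tensorOp_congr {F G : Type*} {X : F → C} {Y : G → C} {L L' : G → List F}
    {k : ∀ g, tensorOver X (L g) ⟶ Y g} {k' : ∀ g, tensorOver X (L' g) ⟶ Y g}
    (hL : ∀ g, (L g).Perm (L' g)) (hn : ∀ g, (L g).Nodup)
    (hk : ∀ g, k g = (tensorPerm X (hL g)).hom ≫ k' g)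
    {l : List F} {m : List G} (h : l.Perm (flat L m)) (h' : l.Perm (flat L' m)) :
    tensorOp L k h = tensorOp L' k' h' := by
  have e := flat_perm hL (List.Perm.refl m)
  simp only [tensorOp]
  rw [tensorFlat_perm_inner hL hn hk m e, tensorPerm_trans_assoc]

theorem flat_single {F G : Type*} (f : G → F) (l : List G) : flat (fun x => [f x]) l = image f l := by
  induction l with
  | nil => rfl
  | cons x l ih => rw [image, ← ih]

theorem tensorFlat_eq_op {F G : Type*} {X : F → C} {Y : G → C} (L : G → List F)
    (k : ∀ g, tensorOver X (L g) ⟶ Y g) (l : List G) :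
    tensorFlat L k l = tensorOp L k (List.Perm.refl _) := by
  simp [tensorOp, tensorPerm_refl]

theorem unit_block {A B D D' : C} (f : A ⟶ B) (r : D ⟶ D') :
    (A ◁ (λ_ D).inv ≫ (α_ A (𝟙_ C) D).inv) ≫ ((ρ_ A).hom ≫ f ⊗ₘ r) = f ⊗ₘ r := by
  rw [← whiskerRight_comp_tensorHom]
  simp

theorem tensorMap_eq_op {F : Type*} {X Y : F → C} (h : ∀ g, X g ⟶ Y g) (l : List F)
    (hp : l.Perm (flat (fun x => [x]) l)) :
    tensorMap h l = tensorOp (fun x => [x]) (fun x => (ρ_ (X x)).hom ≫ h x) hp := by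
  unfold tensorOp
  induction l with
  | nil => rw [tensorPerm_refl]; simp [tensorFlat, tensorMap]
  | cons x l ih =>
    have e : l.Perm (flat (fun x => [x]) l) := by rw [flat_single, image_eq]; simp
    rw [tensorPerm_cons X x e]
    simp only [tensorMap, tensorFlat, tensorAppend, Iso.trans_hom, whiskerLeftIso_hom,
      Iso.symm_hom]
    rw [unit_block, ih e, whiskerLeft_comp_tensorHom]

end
end Tensor
section TensorMore

variable {C : Type u} [Category.{v} C] [MonoidalCategory C]

theorem tensorMap_id {F : Type*} (X : F → C) (l : List F) :
    tensorMap (fun x => 𝟙 (X x)) l = 𝟙 _ := by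
  induction l with
  | nil => rfl
  | cons x l ih => simp only [tensorMap]; rw [ih]; simp

theorem tensorMap_comp {F : Type*} {X Y Z : F → C} (h : ∀ x, X x ⟶ Y x) (h' : ∀ x, Y x ⟶ Z x)
    (l : List F) : tensorMap h l ≫ tensorMap h' l = tensorMap (fun x => h x ≫ h' x) l := by
  induction l with
  | nil => simp [tensorMap]
  | cons x l ih => simp only [tensorMap]; rw [tensorHom_comp_tensorHom, ih]

theorem tensorFlat_map {F G : Type*} {X : F → C} {Y Z : G → C} (L : G → List F)
    (k : ∀ g, tensorOver X (L g) ⟶ Y g) (h : ∀ g, Y g ⟶ Z g) (l : List G) :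
    tensorFlat L k l ≫ tensorMap h l = tensorFlat L (fun g => k g ≫ h g) l := by
  induction l with
  | nil => simp [tensorMap, tensorFlat]
  | cons x l ih =>
    simp only [tensorMap, tensorFlat]; rw [Category.assoc, tensorHom_comp_tensorHom, ih]

theorem tensorMap_append {F : Type*} {X Y : F → C} (h : ∀ x, X x ⟶ Y x) (a b : List F) :
    tensorMap h (append a b) ≫ (tensorAppend Y a b).hom =
      (tensorAppend X a b).hom ≫ (tensorMap h a ⊗ₘ tensorMap h b) := by
  induction a with
  | nil => simp [tensorMap, tensorAppend]
  | cons x a ih =>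
    simp only [tensorMap, tensorAppend, Iso.trans_hom, whiskerLeftIso_hom, Iso.symm_hom,
      Category.assoc]
    rw [tensorHom_comp_whiskerLeft_assoc, ih, ← associator_inv_naturality,
      whiskerLeft_comp_tensorHom_assoc]

theorem tensorMap_flat {F G : Type*} {X Y : F → C} {Z : G → C} (L : G → List F)
    (h : ∀ x, X x ⟶ Y x) (k : ∀ g, tensorOver Y (L g) ⟶ Z g) (l : List G) :
    tensorMap h (flat L l) ≫ tensorFlat L k l = tensorFlat L (fun g => tensorMap h (L g) ≫ k g) l := by
  induction l with
  | nil => simp [tensorMap, tensorFlat]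
  | cons x l ih =>
    simp only [tensorFlat]
    rw [← Category.assoc, tensorMap_append, Category.assoc, tensorHom_comp_tensorHom, ih]

theorem tensorPull_map {F G : Type*} {X : F → C} {Y Z : G → C} (f : G → F)
    (h : ∀ g, X (f g) ⟶ Y g) (h' : ∀ g, Y g ⟶ Z g) (l : List G) :
    tensorPull f h l ≫ tensorMap h' l = tensorPull f (fun g => h g ≫ h' g) l := by
  induction l with
  | nil => simp [tensorMap, tensorPull]
  | cons x l ih => simp only [tensorMap, tensorPull]; rw [tensorHom_comp_tensorHom, ih]

theorem tensorMap_pull {F G : Type*} {X Y : F → C} {Z : G → C} (f : G → F)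
    (h : ∀ g, X g ⟶ Y g) (h' : ∀ g, Y (f g) ⟶ Z g) (l : List G) :
    tensorMap h (image f l) ≫ tensorPull f h' l = tensorPull f (fun g => h (f g) ≫ h' g) l := by
  induction l with
  | nil => simp [tensorMap, tensorPull]
  | cons x l ih => simp only [tensorMap, tensorPull]; rw [tensorHom_comp_tensorHom, ih]

theorem image_perm {F G : Type*} (f : G → F) {l l' : List G} (h : l.Perm l') :
    (image f l).Perm (image f l') := by
  rw [image_eq, image_eq]; exact h.map f

variable [SymmetricCategory C]

theorem tensorPull_perm {F G : Type*} {X : F → C} {Y : G → C} {f : G → F}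
    (hf : Function.Injective f) (h : ∀ g, X (f g) ⟶ Y g) {l l' : List G} (hl : l.Nodup)
    (hp : l.Perm l') (hp' : (image f l).Perm (image f l')) :
    (tensorPerm X hp').hom ≫ tensorPull f h l' = tensorPull f h l ≫ (tensorPerm Y hp).hom := by
  revert hp'
  refine perm_induction (Q := fun l l' hp => ∀ hp' : (image f l).Perm (image f l'),
    (tensorPerm X hp').hom ≫ tensorPull f h l' = tensorPull f h l ≫ (tensorPerm Y hp).hom)
    ?_ ?_ ?_ ?_ hp hl
  · intro l hp'
    rw [tensorPerm_refl, tensorPerm_refl]; simp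
  · intro a l l' hp _ _ ih hp'
    have e := image_perm f hp
    rw [tensorPerm_cons X (f a) e, tensorPerm_cons]
    simp only [tensorPull]
    rw [whiskerLeft_comp_tensorHom, ih e, tensorHom_comp_whiskerLeft]
  · intro a b l hab _ hp'
    rw [tensorPerm_swap X (hf.ne hab), tensorPerm_swap Y hab]
    simp only [tensorPull]
    rw [tensorSwap_naturality]
  · intro l l' l'' hp hp' _ ih ih' hp''
    rw [← tensorPerm_trans X (image_perm f hp) (image_perm f hp'), Category.assoc, ih',
      ← Category.assoc, ih, ← tensorPerm_trans Y hp hp', Category.assoc]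

theorem tensorPull_pull {F G H : Type*} {X : F → C} {Y : G → C} {Z : H → C} (f : G → F)
    (f' : H → G) (h : ∀ g, X (f g) ⟶ Y g) (h' : ∀ x, Y (f' x) ⟶ Z x) (l : List H)
    (hp : (image f (image f' l)).Perm (image (fun x => f (f' x)) l)) :
    tensorPull f h (image f' l) ≫ tensorPull f' h' l =
      (tensorPerm X hp).hom ≫ tensorPull (fun x => f (f' x)) (fun x => h (f' x) ≫ h' x) l := by
  induction l with
  | nil => rw [tensorPerm_refl]; simp [tensorPull]
  | cons x l ih =>
    have e : (image f (image f' l)).Perm (image (fun x => f (f' x)) l) := by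
      simp [image_eq]; exact List.Perm.refl _
    rw [tensorPerm_cons X (f (f' x)) e]
    simp only [tensorPull]
    rw [tensorHom_comp_tensorHom, ih e, whiskerLeft_comp_tensorHom]

theorem tensorFlat_pull {F G H : Type*} {X : F → C} {Y : G → C} {Z : H → C} (L : G → List F)
    (k : ∀ g, tensorOver X (L g) ⟶ Y g) (f : H → G) (h : ∀ x, Y (f x) ⟶ Z x) (l : List H)
    (hp : (flat L (image f l)).Perm (flat (fun x => L (f x)) l)) :
    tensorFlat L k (image f l) ≫ tensorPull f h l =
      (tensorPerm X hp).hom ≫ tensorFlat (fun x => L (f x)) (fun x => k (f x) ≫ h x) l := by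
  induction l with
  | nil => rw [tensorPerm_refl]; simp [tensorPull, tensorFlat]
  | cons x l ih =>
    have e : (flat L (image f l)).Perm (flat (fun x => L (f x)) l) := by
      rw [flat_eq, flat_eq, image_eq]; simp [List.flatMap_map]
    simp only [tensorPull, tensorFlat]
    rw [← Category.assoc, tensorPerm_append_left X _ e]
    simp only [Category.assoc]
    rw [tensorHom_comp_tensorHom, ih e, whiskerLeft_comp_tensorHom]

theorem tensorPull_flat {F G H : Type*} {X : F → C} {Y : G → C} {Z : H → C} (f : G → F)
    (h : ∀ g, X (f g) ⟶ Y g) (L : H → List G) (k : ∀ x, tensorOver Y (L x) ⟶ Z x) (l : List H)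
    (hp : (image f (flat L l)).Perm (flat (fun x => image f (L x)) l)) :
    tensorPull f h (flat L l) ≫ tensorFlat L k l =
      (tensorPerm X hp).hom ≫
        tensorFlat (fun x => image f (L x)) (fun x => tensorPull f h (L x) ≫ k x) l := by
  have key : ∀ (a b : List G) (hp : (image f (append a b)).Perm (append (image f a) (image f b))),
      tensorPull f h (append a b) ≫ (tensorAppend Y a b).hom = (tensorPerm X hp).hom ≫
        (tensorAppend X _ _).hom ≫ (tensorPull f h a ⊗ₘ tensorPull f h b) := by
    intro a b hp
    induction a with
    | nil => rw [tensorPerm_refl]; simp [tensorPull, tensorAppend]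
    | cons x a ih =>
      have e : (image f (append a b)).Perm (append (image f a) (image f b)) := by
        simp [image_eq, append_eq]
      rw [tensorPerm_cons X (f x) e]
      simp only [tensorPull, tensorAppend, Iso.trans_hom, whiskerLeftIso_hom, Iso.symm_hom,
        Category.assoc]
      rw [tensorHom_comp_whiskerLeft_assoc, ih e, ← associator_inv_naturality,
        whiskerLeft_comp_tensorHom_assoc, whiskerLeft_comp_tensorHom_assoc]
  induction l with
  | nil => rw [tensorPerm_refl]; simp [tensorPull, tensorFlat]
  | cons x l ih =>
    have e : (image f (flat L l)).Perm (flat (fun x => image f (L x)) l) := by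
      simp [image_eq, flat_eq, List.map_flatMap]
    have e1 : (image f (append (L x) (flat L l))).Perm (append (image f (L x)) (image f (flat L l))) := by
        simp [image_eq, append_eq]
    have e2 := append_perm (List.Perm.refl (image f (L x))) e
    have h2 := tensorPerm_append_left X (image f (L x)) e e2
    simp only [tensorFlat]
    rw [← Category.assoc, key _ _ e1, ← tensorPerm_trans X e1 e2]
    simp only [Category.assoc]
    rw [reassoc_of% h2, tensorHom_comp_tensorHom, ih e, whiskerLeft_comp_tensorHom]

theorem tensorMap_perm {F : Type*} {X Y : F → C} (h : ∀ x, X x ⟶ Y x) {l l' : List F}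
    (hl : l.Nodup) (hp : l.Perm l') :
    (tensorPerm X hp).hom ≫ tensorMap h l' = tensorMap h l ≫ (tensorPerm Y hp).hom := by
  refine perm_induction (Q := fun l l' hp => 
    (tensorPerm X hp).hom ≫ tensorMap h l' = tensorMap h l ≫ (tensorPerm Y hp).hom)
    ?_ ?_ ?_ ?_ hp hl
  · intro l
    rw [tensorPerm_refl, tensorPerm_refl]; simp
  · intro a l l' hp _ _ ih
    rw [tensorPerm_cons X a hp, tensorPerm_cons Y a hp]
    simp only [tensorMap]
    rw [whiskerLeft_comp_tensorHom, ih, tensorHom_comp_whiskerLeft]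
  · intro a b l hab _
    rw [tensorPerm_swap X hab, tensorPerm_swap Y hab]
    simp only [tensorMap]
    rw [tensorSwap_naturality]
  · intro l l' l'' hp hp' _ ih ih'
    rw [← tensorPerm_trans X hp hp', Category.assoc, ih',
      ← Category.assoc, ih, ← tensorPerm_trans Y hp hp', Category.assoc]

end TensorMore

section Polynomials

/-- A polynomial `J ← E → B → I` in sets, of finite type. -/
structure Poly (J I : Type w) where
  E : Type w
  B : Type w
  s : E → J
  p : E → B
  t : B → I
  finite_fiber : ∀ b, Finite {e : E // p e = b}

/-- The fibre `p ⁻¹ b`. -/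
abbrev Poly.Fiber {J I : Type w} (P : Poly J I) (b : P.B) : Type w := {e : P.E // P.p e = b}

/-- The identity polynomial. -/
def Poly.id (I : Type w) : Poly I I where
  E := I
  B := I
  s := _root_.id
  p := _root_.id
  t := _root_.id
  finite_fiber _ := inferInstanceAs (Finite {e // e = _})

/-- The composite polynomial, representing the composite of polynomial functors `P ∘ Q`. -/
def Poly.comp {K J I : Type w} (P : Poly J I) (Q : Poly K J) : Poly K I where
  E := Σ x : (Σ b : P.B, {f : P.Fiber b → Q.B // ∀ e, Q.t (f e) = P.s e.1}),
    Σ e : P.Fiber x.1, Q.Fiber (x.2.1 e)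
  B := Σ b : P.B, {f : P.Fiber b → Q.B // ∀ e, Q.t (f e) = P.s e.1}
  s z := Q.s z.2.2.1
  p z := z.1
  t x := P.t x.1
  finite_fiber x := by
    have := P.finite_fiber x.1
    have := fun e => Q.finite_fiber (x.2.1 e)
    refine Finite.of_surjective
      (fun z : (Σ e : P.Fiber x.1, Q.Fiber (x.2.1 e)) => ⟨⟨x, z⟩, rfl⟩) ?_
    rintro ⟨⟨y, z⟩, rfl⟩
    exact ⟨z, rfl⟩

/-- A cartesian morphism of polynomials over `δ` and `ε`: a commutative diagram whose middle
square is a pullback. -/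
structure Poly.Cart {J I J' I' : Type w} (P : Poly J I) (Q : Poly J' I') (δ : J → J')
    (ε : I → I') where
  onE : P.E → Q.E
  onB : P.B → Q.B
  s_onE : ∀ e, Q.s (onE e) = δ (P.s e)
  p_onE : ∀ e, Q.p (onE e) = onB (P.p e)
  t_onB : ∀ b, Q.t (onB b) = ε (P.t b)
  pullback : ∀ (b : P.B) (e : Q.E), Q.p e = onB b → ∃! e' : P.E, P.p e' = b ∧ onE e' = e

/-- The map induced on fibres by a cartesian morphism. -/
def Poly.Cart.fib {J I J' I' : Type w} {P : Poly J I} {Q : Poly J' I'} {δ : J → J'} {ε : I → I'}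
    (Φ : P.Cart Q δ ε) {b : P.B} (e : P.Fiber b) : Q.Fiber (Φ.onB b) :=
  ⟨Φ.onE e.1, (Φ.p_onE e.1).trans (congrArg Φ.onB e.2)⟩

theorem Poly.Cart.fib_bijective {J I J' I' : Type w} {P : Poly J I} {Q : Poly J' I'} {δ : J → J'}
    {ε : I → I'} (Φ : P.Cart Q δ ε) (b : P.B) : Function.Bijective (Φ.fib (b := b)) := by
  constructor
  · intro e e' h
    have h : Φ.onE e.1 = Φ.onE e'.1 := congrArg Subtype.val h
    exact Subtype.ext ((Φ.pullback b _ (Φ.fib e).2).unique ⟨e.2, rfl⟩ ⟨e'.2, h.symm⟩)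
  · intro y
    obtain ⟨e, he, -⟩ := Φ.pullback b y.1 y.2
    exact ⟨⟨e, he.1⟩, Subtype.ext he.2⟩

/-- A polynomial endofunctor with 2-cells `1 ⟶ T` and `T ∘ T ⟶ T` in the 2-category of
polynomials and cartesian transformations. -/
structure PolyMonadData (I : Type w) where
  poly : Poly I I
  unit : (Poly.id I).Cart poly id id
  mul : (poly.comp poly).Cart poly id id

namespace PolyMonadData

variable {I : Type w} (T : PolyMonadData I)

abbrev B := T.poly.B
abbrev E := T.poly.E
abbrev Fiber (b : T.B) := T.poly.Fiber b
abbrev s (e : T.E) : I := T.poly.s e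
abbrev t (b : T.B) : I := T.poly.t b

/-- The unit operations. -/
def one (i : I) : T.B := T.unit.onB i

/-- The only element of the fibre of a unit operation. -/
def oneE (i : I) : T.Fiber (T.one i) := T.unit.fib (b := i) ⟨i, rfl⟩

/-- The composite operation `b(f)`, for operations `f e` with target `s e`. -/
def subst (b : T.B) (f : T.Fiber b → T.B) (hf : ∀ e, T.t (f e) = T.s e.1) : T.B :=
  T.mul.onB ⟨b, f, hf⟩

/-- The fibre of `b(f)` consists of the pairs of `e` in the fibre of `b` and `x` in the fibre of
`f e`. -/
def substE (b : T.B) (f : T.Fiber b → T.B) (hf : ∀ e, T.t (f e) = T.s e.1) (e : T.Fiber b)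
    (x : T.Fiber (f e)) : T.Fiber (T.subst b f hf) :=
  T.mul.fib (b := ⟨b, f, hf⟩) ⟨⟨⟨b, f, hf⟩, e, x⟩, rfl⟩

theorem t_one (i : I) : T.t (T.one i) = i := T.unit.t_onB i

theorem s_oneE (i : I) : T.s (T.oneE i).1 = i := T.unit.s_onE i

theorem t_subst (b : T.B) (f : T.Fiber b → T.B) (hf : ∀ e, T.t (f e) = T.s e.1) :
    T.t (T.subst b f hf) = T.t b := T.mul.t_onB ⟨b, f, hf⟩

theorem s_substE (b : T.B) (f : T.Fiber b → T.B) (hf : ∀ e, T.t (f e) = T.s e.1)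
    (e : T.Fiber b) (x : T.Fiber (f e)) : T.s (T.substE b f hf e x).1 = T.s x.1 :=
  T.mul.s_onE ⟨⟨b, f, hf⟩, e, x⟩

theorem eq_oneE {i : I} (e : T.Fiber (T.one i)) : e = T.oneE i := by
  obtain ⟨⟨j, hj⟩, rfl⟩ := (T.unit.fib_bijective i).2 e
  have hj : j = i := hj
  subst hj; rfl

theorem exists_substE {b : T.B} {f : T.Fiber b → T.B} {hf : ∀ e, T.t (f e) = T.s e.1}
    (y : T.Fiber (T.subst b f hf)) : ∃ e x, T.substE b f hf e x = y := by
  obtain ⟨⟨⟨z, e, x⟩, h⟩, rfl⟩ := (T.mul.fib_bijective ⟨b, f, hf⟩).2 y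
  have h : z = _ := h
  subst h
  exact ⟨e, x, rfl⟩

theorem substE_inj {b : T.B} {f : T.Fiber b → T.B} {hf : ∀ e, T.t (f e) = T.s e.1}
    {e e' : T.Fiber b} {x : T.Fiber (f e)} {x' : T.Fiber (f e')}
    (h : (T.substE b f hf e x).1 = (T.substE b f hf e' x').1) :
    (⟨e, x⟩ : Σ e, T.Fiber (f e)) = ⟨e', x'⟩ := by
  have := (T.mul.fib_bijective ⟨b, f, hf⟩).1 (Subtype.ext h)
  exact eq_of_heq (Sigma.mk.inj (congrArg Subtype.val this)).2

theorem subst_congr {b b' : T.B} (hb : b = b') {f : T.Fiber b → T.B} {f' : T.Fiber b' → T.B}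
    (hf : ∀ e, T.t (f e) = T.s e.1) (hf' : ∀ e, T.t (f' e) = T.s e.1)
    (hff : ∀ e : T.Fiber b, f e = f' ⟨e.1, e.2.trans hb⟩) :
    T.subst b f hf = T.subst b' f' hf' := by
  subst hb
  obtain rfl : f = f' := funext hff
  rfl

theorem substE_congr {b b' : T.B} (hb : b = b') {f : T.Fiber b → T.B} {f' : T.Fiber b' → T.B}
    (hf : ∀ e, T.t (f e) = T.s e.1) (hf' : ∀ e, T.t (f' e) = T.s e.1)
    (hff : ∀ e : T.Fiber b, f e = f' ⟨e.1, e.2.trans hb⟩)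
    {e : T.Fiber b} {e' : T.Fiber b'} (he : e.1 = e'.1)
    {x : T.Fiber (f e)} {x' : T.Fiber (f' e')} (hx : x.1 = x'.1) :
    (T.substE b f hf e x).1 = (T.substE b' f' hf' e' x').1 := by
  subst hb
  obtain rfl : f = f' := funext hff
  obtain rfl : e = e' := Subtype.ext he
  obtain rfl : x = x' := Subtype.ext hx
  rfl

end PolyMonadData

/-- A (finitary) polynomial monad: a monad in the 2-category of polynomials. Two-cells out of
a composite polynomial are compared on `B` and on `E`. -/
structure PolynomialMonad (I : Type w) extends PolyMonadData I where
  one_subst : ∀ b, toPolyMonadData.subst (toPolyMonadData.one (toPolyMonadData.t b)) (fun _ => b)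
    (fun e => by rw [toPolyMonadData.eq_oneE e, toPolyMonadData.s_oneE]) = b
  one_substE : ∀ b (e : toPolyMonadData.Fiber b),
    (toPolyMonadData.substE (toPolyMonadData.one (toPolyMonadData.t b)) (fun _ => b)
      (fun e => by rw [toPolyMonadData.eq_oneE e, toPolyMonadData.s_oneE])
      (toPolyMonadData.oneE _) e).1 = e.1
  subst_one : ∀ b, toPolyMonadData.subst b (fun e => toPolyMonadData.one (toPolyMonadData.s e.1))
    (fun _ => toPolyMonadData.t_one _) = b
  subst_oneE : ∀ b (e : toPolyMonadData.Fiber b),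
    (toPolyMonadData.substE b (fun e => toPolyMonadData.one (toPolyMonadData.s e.1))
      (fun _ => toPolyMonadData.t_one _) e (toPolyMonadData.oneE _)).1 = e.1
  subst_subst : ∀ b f hf h hh,
    toPolyMonadData.subst (toPolyMonadData.subst b f hf) h hh =
      toPolyMonadData.subst b (fun e => toPolyMonadData.subst (f e)
        (fun x => h (toPolyMonadData.substE b f hf e x))
        (fun x => by rw [hh, toPolyMonadData.s_substE]))
        (fun e => by rw [toPolyMonadData.t_subst, hf])
  subst_substE : ∀ b f hf h hh e x z,
    (toPolyMonadData.substE (toPolyMonadData.subst b f hf) h hh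
        (toPolyMonadData.substE b f hf e x) z).1 =
      (toPolyMonadData.substE b (fun e => toPolyMonadData.subst (f e)
        (fun x => h (toPolyMonadData.substE b f hf e x))
        (fun x => by rw [hh, toPolyMonadData.s_substE]))
        (fun e => by rw [toPolyMonadData.t_subst, hf]) e
        (toPolyMonadData.substE (f e) (fun x => h (toPolyMonadData.substE b f hf e x)) 
          (fun x => by rw [hh, toPolyMonadData.s_substE]) x z)).1

/-- A cartesian morphism of polynomial monads over a map of colours `δ`, compatible with units and
multiplications. In `map_subst`, the family `g` on the fibre of `onB d` corresponds to the family
`onB (f e)` under the bijection `fib` of fibres. -/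
structure CartesianMorphism {J I : Type w} (S : PolynomialMonad J) (T : PolynomialMonad I) where
  δ : J → I
  cart : S.poly.Cart T.poly δ δ
  map_one : ∀ j, cart.onB (S.one j) = T.one (δ j)
  map_oneE : ∀ j, cart.onE (S.oneE j).1 = (T.oneE (δ j)).1
  map_subst : ∀ (d : S.B) (f : S.Fiber d → S.B) (hf : ∀ e, S.t (f e) = S.s e.1)
    (g : T.Fiber (cart.onB d) → T.B) (hg : ∀ e, T.t (g e) = T.s e.1),
    (∀ e, g (cart.fib e) = cart.onB (f e)) → cart.onB (S.subst d f hf) = T.subst (cart.onB d) g hg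
  map_substE : ∀ (d : S.B) (f : S.Fiber d → S.B) (hf : ∀ e, S.t (f e) = S.s e.1)
    (g : T.Fiber (cart.onB d) → T.B) (hg : ∀ e, T.t (g e) = T.s e.1)
    (hfg : ∀ e, g (cart.fib e) = cart.onB (f e)) (e : S.Fiber d) (x : S.Fiber (f e)),
    cart.onE (S.substE d f hf e x).1 =
      (T.substE (cart.onB d) g hg (cart.fib e) ⟨(cart.fib x).1, (cart.fib x).2.trans (hfg e).symm⟩).1

/-- The identity morphism. -/
def CartesianMorphism.id {I : Type w} (T : PolynomialMonad I) : CartesianMorphism T T where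
  δ := _root_.id
  cart :=
    { onE := _root_.id
      onB := _root_.id
      s_onE _ := rfl
      p_onE _ := rfl
      t_onB _ := rfl
      pullback b e he := ⟨e, ⟨he, rfl⟩, fun _ h => h.2⟩ }
  map_one _ := rfl
  map_oneE _ := rfl
  map_subst d f hf g hg h := by
    obtain rfl : g = f := funext h
    rfl
  map_substE d f hf g hg h e x := by
    obtain rfl : g = f := funext h
    rfl

end Polynomials

section Classifier

variable {J I : Type w} {S : PolynomialMonad J} {T : PolynomialMonad I}

namespace CartesianMorphism

variable (Φ : CartesianMorphism S T)

/-- The operation on `B`. -/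
abbrev onB (d : S.B) : T.B := Φ.cart.onB d

/-- The map on fibres. -/
abbrev fib {d : S.B} (e : S.Fiber d) : T.Fiber (Φ.onB d) := Φ.cart.fib e

theorem t_onB (d : S.B) : T.t (Φ.onB d) = Φ.δ (S.t d) := Φ.cart.t_onB d

theorem onB_one (j : J) : Φ.onB (S.one j) = T.one (Φ.δ j) := Φ.map_one j

theorem s_fib {d : S.B} (e : S.Fiber d) : T.s (Φ.fib e).1 = Φ.δ (S.s e.1) := Φ.cart.s_onE e.1

end CartesianMorphism

/-- The objects of the component over `i` of the internal `S`-algebra classifier of `T`: the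
`J`-coloured `T`-operations with target `i`. -/
structure Classifier (Φ : CartesianMorphism S T) (i : I) where
  b : T.B
  t_b : T.t b = i
  col : T.Fiber b → J
  δ_col : ∀ e, Φ.δ (col e) = T.s e.1

namespace Classifier

variable {Φ : CartesianMorphism S T} {i : I}

/-- A morphism `c' ⟶ c` is a family of `S`-operations `d e` whose targets are the colours of `c`,
such that `c'` is the `J`-coloured operation `θ(c; d)`: its underlying operation is
the composite of `c` with the operations `Φ (d e)`, and its colours are the sources of the `d e`. -/
@[ext]
structure Hom (c' c : Classifier Φ i) where
  d : T.Fiber c.b → S.B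
  t_d : ∀ e, S.t (d e) = c.col e
  b_eq : T.subst c.b (fun e => Φ.onB (d e))
    (fun e => by rw [Φ.t_onB, t_d, c.δ_col]) = c'.b
  col_eq : ∀ (e : T.Fiber c.b) (x : S.Fiber (d e)),
    c'.col ⟨_, (T.substE c.b (fun e => Φ.onB (d e)) (fun e => by rw [Φ.t_onB, t_d, c.δ_col]) e
      (Φ.fib x)).2.trans b_eq⟩ = S.s x.1

theorem Hom.t_onB_d {c' c : Classifier Φ i} (f : Hom c' c) (e : T.Fiber c.b) :
    T.t (Φ.onB (f.d e)) = T.s e.1 := by rw [Φ.t_onB, f.t_d, c.δ_col]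

/-- The inclusion of the fibre of `d e` into the fibre of the source of a morphism. -/
def Hom.emb {c' c : Classifier Φ i} (f : Hom c' c) (e : T.Fiber c.b) (x : S.Fiber (f.d e)) :
    T.Fiber c'.b :=
  ⟨_, (T.substE c.b (fun e => Φ.onB (f.d e)) f.t_onB_d e (Φ.fib x)).2.trans f.b_eq⟩

theorem Hom.col_emb {c' c : Classifier Φ i} (f : Hom c' c) (e : T.Fiber c.b)
    (x : S.Fiber (f.d e)) : c'.col (f.emb e x) = S.s x.1 := f.col_eq e x

theorem Hom.exists_emb {c' c : Classifier Φ i} (f : Hom c' c) (y : T.Fiber c'.b) :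
    ∃ e x, f.emb e x = y := by
  obtain ⟨e, x', h⟩ := T.exists_substE (b := c.b) (f := fun e => Φ.onB (f.d e))
    (hf := f.t_onB_d) ⟨y.1, y.2.trans f.b_eq.symm⟩
  obtain ⟨x, rfl⟩ := (Φ.cart.fib_bijective _).2 x'
  have h' := Subtype.ext_iff.1 h
  exact ⟨e, x, Subtype.ext h'⟩

theorem Hom.emb_inj {c' c : Classifier Φ i} (f : Hom c' c) {e e' : T.Fiber c.b}
    {x : S.Fiber (f.d e)} {x' : S.Fiber (f.d e')} (h : f.emb e x = f.emb e' x') :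
    (⟨e, x⟩ : Σ e, S.Fiber (f.d e)) = ⟨e', x'⟩ := by
  have h' := Subtype.ext_iff.1 h
  have h := T.substE_inj (f := fun e => Φ.onB (f.d e)) (hf := f.t_onB_d) h'
  obtain rfl : e = e' := congrArg Sigma.fst h
  have h := eq_of_heq (Sigma.mk.inj h).2
  rw [(Φ.cart.fib_bijective _).1 h]

/-- The identity morphism, given by the units of `S`. -/
def idHom (c : Classifier Φ i) : Hom c c where
  d e := S.one (c.col e)
  t_d e := S.t_one _
  b_eq := by
    have h : ∀ e, Φ.onB (S.one (c.col e)) = T.one (T.s e.1) := fun e => by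
      rw [Φ.onB_one, c.δ_col]
    rw [T.subst_congr rfl _ (fun _ => T.t_one _) h]
    exact T.subst_one c.b
  col_eq e x := by
    have h : ∀ e, Φ.onB (S.one (c.col e)) = T.one (T.s e.1) := fun e => by
      rw [Φ.onB_one, c.δ_col]
    obtain rfl := S.eq_oneE x
    rw [S.s_oneE]
    congr 1
    apply Subtype.ext
    rw [← T.subst_oneE c.b e]
    refine T.substE_congr rfl _ _ h rfl ?_
    exact (Φ.map_oneE _).trans (by rw [c.δ_col])

theorem idHom_emb (c : Classifier Φ i) (e : T.Fiber c.b) (x : S.Fiber (S.one (c.col e))) :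
    c.idHom.emb e x = e := by
  have h : ∀ e, Φ.onB (S.one (c.col e)) = T.one (T.s e.1) := fun e => by
    rw [Φ.onB_one, c.δ_col]
  obtain rfl := S.eq_oneE x
  apply Subtype.ext
  refine (T.substE_congr rfl _ (fun _ => T.t_one _) h rfl ?_).trans (T.subst_oneE c.b e)
  exact (Φ.map_oneE _).trans (by rw [c.δ_col])

section comp
variable {c'' c' c : Classifier Φ i} (f : Hom c'' c') (g : Hom c' c)

theorem comp_t (e : T.Fiber c.b) (x : S.Fiber (g.d e)) :
    S.t (f.d (g.emb e x)) = S.s x.1 := by rw [f.t_d, g.col_emb]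

/-- The operations of the composite of two morphisms. -/
def compD (e : T.Fiber c.b) : S.B :=
  S.subst (g.d e) (fun x => f.d (g.emb e x)) (comp_t f g e)

/-- An auxiliary family of operations of `T`, in the computation of a composite. -/
def compAux (y : T.Fiber (T.subst c.b (fun e => Φ.onB (g.d e)) g.t_onB_d)) : T.B :=
  Φ.onB (f.d ⟨y.1, y.2.trans g.b_eq⟩)

theorem t_compAux (y : T.Fiber (T.subst c.b (fun e => Φ.onB (g.d e)) g.t_onB_d)) :
    T.t (compAux f g y) = T.s y.1 := f.t_onB_d _

theorem onB_compD (e : T.Fiber c.b) : Φ.onB (compD f g e) =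
    T.subst (Φ.onB (g.d e)) (fun x => compAux f g (T.substE c.b _ g.t_onB_d e x))
      (fun x => by rw [t_compAux, T.s_substE]) :=
  Φ.map_subst _ _ _ _ _ fun _ => rfl

theorem t_subst_compAux (e : T.Fiber c.b) :
    T.t (T.subst (Φ.onB (g.d e)) (fun x => compAux f g (T.substE c.b _ g.t_onB_d e x))
      (fun x => by rw [t_compAux, T.s_substE])) = T.s e.1 := by rw [T.t_subst, g.t_onB_d]

theorem t_compD (e : T.Fiber c.b) : S.t (compD f g e) = c.col e := by
  rw [compD, S.t_subst, g.t_d]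

theorem t_onB_compD (e : T.Fiber c.b) : T.t (Φ.onB (compD f g e)) = T.s e.1 := by
  rw [Φ.t_onB, t_compD, c.δ_col]

theorem compD_b_eq : T.subst c.b (fun e => Φ.onB (compD f g e)) (t_onB_compD f g) = c''.b := by
  rw [← f.b_eq]
  refine (T.subst_congr rfl _ (t_subst_compAux f g) (onB_compD f g)).trans ?_
  refine (T.subst_subst c.b _ g.t_onB_d (compAux f g) (t_compAux f g)).symm.trans ?_
  exact T.subst_congr (f' := fun e => Φ.onB (f.d e)) g.b_eq _ f.t_onB_d fun _ => rfl

theorem compD_substE (e : T.Fiber c.b) (x : S.Fiber (g.d e)) (z : S.Fiber (f.d (g.emb e x))) :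
    (T.substE c.b (fun e => Φ.onB (compD f g e)) (t_onB_compD f g) e
      (Φ.fib (S.substE (g.d e) (fun x => f.d (g.emb e x)) (comp_t f g e) x z))).1 =
    (f.emb (g.emb e x) z).1 := by
  have h1 := T.subst_substE c.b _ g.t_onB_d (compAux f g) (t_compAux f g) e (Φ.fib x) (Φ.fib z)
  refine (T.substE_congr rfl _ (t_subst_compAux f g) (onB_compD f g) rfl ?_).trans
    (h1.symm.trans (T.substE_congr (f' := fun e => Φ.onB (f.d e)) g.b_eq _ f.t_onB_d
      (fun _ => rfl) rfl rfl))
  exact Φ.map_substE (g.d e) (fun x => f.d (g.emb e x)) (comp_t f g e) _ _ (fun _ => rfl) x z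

/-- Composition of morphisms, induced by the multiplication of `S`. -/
def compHom : Hom c'' c where
  d := compD f g
  t_d := t_compD f g
  b_eq := compD_b_eq f g
  col_eq e y := by
    obtain ⟨x, z, rfl⟩ := S.exists_substE y
    rw [S.s_substE, ← f.col_emb (g.emb e x) z]
    congr 1
    exact Subtype.ext (compD_substE f g e x z)

theorem compHom_emb (e : T.Fiber c.b) (x : S.Fiber (g.d e)) (z : S.Fiber (f.d (g.emb e x))) :
    (compHom f g).emb e (S.substE (g.d e) (fun x => f.d (g.emb e x)) (comp_t f g e) x z) =
      f.emb (g.emb e x) z :=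
  Subtype.ext (compD_substE f g e x z)

end comp

instance : Category.{w} (Classifier Φ i) where
  Hom := Hom
  id := idHom
  comp := compHom
  id_comp {c' c} f := by
    apply Hom.ext
    funext e
    change compD (idHom c') f e = f.d e
    refine (S.subst_congr rfl _ (fun _ => S.t_one _) fun x => ?_).trans (S.subst_one (f.d e))
    exact congrArg S.one (f.col_emb e x)
  comp_id {c' c} f := by
    apply Hom.ext
    funext e
    refine Eq.trans ?_ (S.one_subst (f.d e))
    refine S.subst_congr (congrArg S.one (f.t_d e).symm) _ _ fun x => ?_
    exact congrArg f.d (idHom_emb c e x)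
  assoc {c₁ c₂ c₃ c₄} f g h := by
    apply Hom.ext
    funext e
    change S.subst _ _ _ = S.subst _ _ _
    refine Eq.symm ((S.subst_subst (h.d e) (fun x => g.d (h.emb e x)) (comp_t g h e)
      (fun y => f.d ((compHom g h).emb e y)) (comp_t f (compHom g h) e)).trans ?_)
    refine S.subst_congr rfl _ _ fun x => ?_
    refine S.subst_congr rfl _ _ fun z => ?_
    exact congrArg f.d (compHom_emb g h e x z)

end Classifier
end Classifier

section Orderings

variable {J I : Type w} {S : PolynomialMonad J} {T : PolynomialMonad I}

/-- The list `l` enumerates the fibre of `b` without repetition, that is to say, it is a linear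
ordering of this finite set. -/
def IsOrdering (T : PolynomialMonad I) {b : T.B} (l : List (T.Fiber b)) : Prop :=
  l.Nodup ∧ ∀ e, e ∈ l

/-- A chosen linear ordering of the fibre of `b`. -/
noncomputable def ordering (T : PolynomialMonad I) (b : T.B) : List (T.Fiber b) :=
  haveI := T.poly.finite_fiber b
  (@Finset.univ _ (Fintype.ofFinite (T.Fiber b))).toList

theorem isOrdering_ordering (T : PolynomialMonad I) (b : T.B) : IsOrdering T (ordering T b) := by
  refine ⟨Finset.nodup_toList _, fun e => ?_⟩
  simp [ordering]

theorem IsOrdering.perm {b : T.B} {l l' : List (T.Fiber b)} (h : IsOrdering T l)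
    (h' : IsOrdering T l') : l.Perm l' :=
  (List.perm_ext_iff_of_nodup h.1 h'.1).2 fun e => ⟨fun _ => h'.2 e, fun _ => h.2 e⟩

theorem isOrdering_one (T : PolynomialMonad I) (i : I) : IsOrdering T [T.oneE i] :=
  ⟨List.nodup_singleton _, fun e => by simp [T.eq_oneE e]⟩

theorem mem_image {F G : Type*} {f : G → F} {l : List G} {y : F} :
    y ∈ image f l ↔ ∃ x ∈ l, f x = y := by
  rw [image_eq]; simp

theorem nodup_image {F G : Type*} {f : G → F} (hf : Function.Injective f) {l : List G}
    (hl : l.Nodup) : (image f l).Nodup := by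
  rw [image_eq]; exact hl.map hf

theorem nodup_flat_image {F G : Type*} {H : G → Type*} (k : ∀ g, H g → F) (hk : ∀ g g' x x',
    k g x = k g' x' → (⟨g, x⟩ : Σ g, H g) = ⟨g', x'⟩) {l : List G} (hl : l.Nodup)
    {m : ∀ g, List (H g)} (hm : ∀ g, (m g).Nodup) : (flat (fun g => image (k g) (m g)) l).Nodup := by
  rw [flat_eq, List.nodup_flatMap]
  refine ⟨fun g _ => nodup_image (fun x x' h => ?_) (hm g), ?_⟩
  · have := hk _ _ _ _ h
    simpa using this
  · refine hl.imp fun {g g'} hg => ?_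
    intro y hy hy'
    obtain ⟨x, -, rfl⟩ := mem_image.1 hy
    obtain ⟨x', -, h⟩ := mem_image.1 hy'
    exact hg (congrArg Sigma.fst (hk _ _ _ _ h)).symm

theorem mem_flat_image {F G : Type*} {H : G → Type*} {k : ∀ g, H g → F} {l : List G}
    {m : ∀ g, List (H g)} {g : G} (hg : g ∈ l) {x : H g} (hx : x ∈ m g) :
    k g x ∈ flat (fun g => image (k g) (m g)) l := by
  rw [flat_eq, List.mem_flatMap]
  exact ⟨g, hg, mem_image.2 ⟨x, hx, rfl⟩⟩

theorem IsOrdering.subst {b : T.B} {f : T.Fiber b → T.B} {hf : ∀ e, T.t (f e) = T.s e.1}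
    {l : List (T.Fiber b)} (hl : IsOrdering T l) {m : ∀ e, List (T.Fiber (f e))}
    (hm : ∀ e, IsOrdering T (m e)) :
    IsOrdering T (flat (fun e => image (T.substE b f hf e) (m e)) l) := by
  refine ⟨nodup_flat_image _ (fun e e' x x' h => ?_) hl.1 fun e => (hm e).1, fun y => ?_⟩
  · exact T.substE_inj (congrArg Subtype.val h)
  · obtain ⟨e, x, rfl⟩ := T.exists_substE y
    exact mem_flat_image (hl.2 e) ((hm e).2 x)

theorem Classifier.Hom.isOrdering {Φ : CartesianMorphism S T} {i : I} {c' c : Classifier Φ i}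
    (f : Classifier.Hom c' c) {l : List (T.Fiber c.b)} (hl : IsOrdering T l)
    {m : ∀ e, List (S.Fiber (f.d e))} (hm : ∀ e, IsOrdering S (m e)) :
    IsOrdering T (flat (fun e => image (f.emb e) (m e)) l) := by
  refine ⟨nodup_flat_image _ (fun e e' x x' h => f.emb_inj h) hl.1 fun e => (hm e).1, fun y => ?_⟩
  obtain ⟨e, x, rfl⟩ := f.exists_emb y
  exact mem_flat_image (hl.2 e) ((hm e).2 x)

/-- The bijection of fibres given by a cartesian morphism. -/
noncomputable def CartesianMorphism.fibEquiv (Φ : CartesianMorphism S T) (d : S.B) :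
    S.Fiber d ≃ T.Fiber (Φ.onB d) :=
  Equiv.ofBijective _ (Φ.cart.fib_bijective d)

theorem IsOrdering.of_bijective {U : PolynomialMonad J} {b : T.B} {d : U.B}
    {f : T.Fiber b → U.Fiber d} (hf : Function.Bijective f) {l : List (T.Fiber b)}
    (hl : IsOrdering T l) : IsOrdering U (image f l) :=
  ⟨nodup_image hf.1 hl.1, fun y => by
    obtain ⟨x, rfl⟩ := hf.2 y
    exact mem_image.2 ⟨x, hl.2 x, rfl⟩⟩

end Orderings

section Algebras

variable {J I : Type w} {S : PolynomialMonad J} {T : PolynomialMonad I}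
variable {C : Type u} [Category.{v} C] [MonoidalCategory C] [SymmetricCategory C]

/-- An algebra over a polynomial monad `T` in a symmetric monoidal category: a family of
objects indexed by the colours, with an action of each operation `b` for each linear ordering
of its fibre, which is equivariant, unital and associative. -/
structure Algebra (T : PolynomialMonad I) (C : Type u) [Category.{v} C] [MonoidalCategory C]
    [SymmetricCategory C] where
  obj : I → C
  act : ∀ (b : T.B) (l : List (T.Fiber b)), IsOrdering T l →
    (tensorOver (fun e => obj (T.s e.1)) l ⟶ obj (T.t b))
  equivariant : ∀ (b : T.B) (l l' : List (T.Fiber b)) (hl : IsOrdering T l)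
    (hl' : IsOrdering T l'),
    (tensorPerm (fun e => obj (T.s e.1)) (hl.perm hl')).hom ≫ act b l' hl' = act b l hl
  unit : ∀ i, act (T.one i) [T.oneE i] (isOrdering_one T i) =
    (ρ_ (obj (T.s (T.oneE i).1))).hom ≫ eqToHom (by rw [T.s_oneE, T.t_one])
  assoc : ∀ (b : T.B) (f : T.Fiber b → T.B) (hf : ∀ e, T.t (f e) = T.s e.1)
    (l : List (T.Fiber b)) (hl : IsOrdering T l) (m : ∀ e, List (T.Fiber (f e)))
    (hm : ∀ e, IsOrdering T (m e)),
    tensorFlat (X := fun y => obj (T.s y.1)) (Y := fun e => obj (T.s e.1))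
        (fun e => image (T.substE b f hf e) (m e))
        (fun e => tensorPull (T.substE b f hf e)
          (fun x => eqToHom (congrArg obj (T.s_substE b f hf e x))) (m e) ≫
            act (f e) (m e) (hm e) ≫ eqToHom (congrArg obj (hf e))) l ≫ act b l hl =
      act (T.subst b f hf) (flat (fun e => image (T.substE b f hf e) (m e)) l) (hl.subst hm) ≫
        eqToHom (congrArg obj (T.t_subst b f hf))

namespace Algebra

/-- A morphism of algebras. -/
@[ext]
structure Hom (A A' : Algebra T C) where
  app : ∀ i, A.obj i ⟶ A'.obj i
  comm : ∀ (b : T.B) (l : List (T.Fiber b)) (hl : IsOrdering T l),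
    A.act b l hl ≫ app (T.t b) = tensorMap (fun e => app (T.s e.1)) l ≫ A'.act b l hl

instance : Category (Algebra T C) where
  Hom := Hom
  id A := { app := fun _ => 𝟙 _, comm := fun b l hl => by simp [tensorMap_id] }
  comp f g :=
    { app := fun i => f.app i ≫ g.app i
      comm := fun b l hl => by
        rw [← Category.assoc, f.comm, Category.assoc, g.comm, ← Category.assoc, tensorMap_comp] }
  id_comp f := Hom.ext (funext fun _ => Category.id_comp _)
  comp_id f := Hom.ext (funext fun _ => Category.comp_id _)
  assoc f g h := Hom.ext (funext fun _ => Category.assoc _ _ _)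

theorem Hom.app_eqToHom {A A' : Algebra T C} (f : A ⟶ A') {i j : I} (h : i = j)
    (h1 : A'.obj i = A'.obj j) (h2 : A.obj i = A.obj j) :
    Hom.app f i ≫ eqToHom h1 = eqToHom h2 ≫ Hom.app f j := by
  subst h; simp

/-- The action of `b` on a tensor product over a list `l` of elements of a set `F`, with which the
fibre of `b` is identified by means of `κ`. -/
noncomputable def actOn (A : Algebra T C) {F : Type*} {X : F → C} {Z : C} (b : T.B)
    (κ : T.Fiber b → F) (hX : ∀ e, X (κ e) = A.obj (T.s e.1)) (hZ : A.obj (T.t b) = Z)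
    (l : List F) (hl : l.Perm (image κ (ordering T b))) : tensorOver X l ⟶ Z :=
  (tensorPerm X hl).hom ≫ tensorPull κ (fun e => eqToHom (hX e)) (ordering T b) ≫
    A.act b (ordering T b) (isOrdering_ordering T b) ≫ eqToHom hZ

variable (A : Algebra T C)

theorem perm_actOn {F : Type*} {X : F → C} {Z : C} (b : T.B)
    (κ : T.Fiber b → F) (hX : ∀ e, X (κ e) = A.obj (T.s e.1)) (hZ : A.obj (T.t b) = Z)
    {l l' : List F} (h : l.Perm l') (hl : l'.Perm (image κ (ordering T b))) :
    (tensorPerm X h).hom ≫ A.actOn b κ hX hZ l' hl = A.actOn b κ hX hZ l (h.trans hl) := by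
  rw [actOn, tensorPerm_trans_assoc]; rfl

theorem actOn_congr {F : Type*} {X : F → C} {Z : C} {b b' : T.B} (hb : b = b')
    {κ : T.Fiber b → F} {κ' : T.Fiber b' → F} (hκ : ∀ e, κ e = κ' ⟨e.1, e.2.trans hb⟩)
    {hX : ∀ e, X (κ e) = A.obj (T.s e.1)} {hX' : ∀ e, X (κ' e) = A.obj (T.s e.1)}
    {hZ : A.obj (T.t b) = Z} {hZ' : A.obj (T.t b') = Z}
    {l : List F} {hl : l.Perm (image κ (ordering T b))}
    {hl' : l.Perm (image κ' (ordering T b'))} :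
    A.actOn b κ hX hZ l hl = A.actOn b' κ' hX' hZ' l hl' := by
  subst hb
  obtain rfl : κ = κ' := funext hκ
  rfl

theorem actOn_comp_eqToHom {F : Type*} {X : F → C} {Z Z' : C} (b : T.B)
    (κ : T.Fiber b → F) (hX : ∀ e, X (κ e) = A.obj (T.s e.1)) (hZ : A.obj (T.t b) = Z)
    (l : List F) (hl : l.Perm (image κ (ordering T b))) (h : Z = Z') :
    A.actOn b κ hX hZ l hl ≫ eqToHom h = A.actOn b κ hX (hZ.trans h) l hl := by
  subst h; simp

/-- The action can be computed with any linear ordering. -/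
theorem actOn_eq {F : Type*} {X : F → C} {Z : C} (b : T.B)
    {κ : T.Fiber b → F} (hκ : Function.Injective κ) (hX : ∀ e, X (κ e) = A.obj (T.s e.1))
    (hZ : A.obj (T.t b) = Z) {l : List F} (hl : l.Perm (image κ (ordering T b)))
    {m : List (T.Fiber b)} (hm : IsOrdering T m) (h : l.Perm (image κ m)) :
    A.actOn b κ hX hZ l hl = (tensorPerm X h).hom ≫ tensorPull κ (fun e => eqToHom (hX e)) m ≫
      A.act b m hm ≫ eqToHom hZ := by
  have hp := hm.perm (isOrdering_ordering T b)
  have e := tensorPull_perm hκ (fun e => eqToHom (hX e)) hm.1 hp (image_perm κ hp)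
  rw [← A.equivariant b m _ hm (isOrdering_ordering T b), Category.assoc,
    ← reassoc_of% e, tensorPerm_trans_assoc]
  rfl

theorem actOn_one {F : Type*} {X : F → C} {Z : C} (i : I)
    {κ : T.Fiber (T.one i) → F} (hX : ∀ e, X (κ e) = A.obj (T.s e.1))
    (hZ : A.obj (T.t (T.one i)) = Z) {l : List F}
    (hl : l.Perm (image κ (ordering T (T.one i)))) (h : l.Perm [κ (T.oneE i)]) :
    A.actOn (T.one i) κ hX hZ l hl = (tensorPerm X h).hom ≫ (ρ_ _).hom ≫
      eqToHom (by rw [hX, T.s_oneE, ← hZ, T.t_one]) := by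
  have hκ : Function.Injective κ := fun e e' _ => by rw [T.eq_oneE e, T.eq_oneE e']
  rw [A.actOn_eq _ hκ hX hZ hl (isOrdering_one T i) h, A.unit]
  simp [tensorPull]

/-- The action of a composite operation. -/
theorem actOn_subst {F G : Type*} {X : F → C} {Y : G → C} {Z : C} {b : T.B}
    {f : T.Fiber b → T.B} {hf : ∀ e, T.t (f e) = T.s e.1} (L : G → List F)
    (k : ∀ g, tensorOver X (L g) ⟶ Y g) {l : List F} {m : List G} (h : l.Perm (flat L m))
    (hl : l.Nodup) (hm : m.Nodup) {κ : T.Fiber b → G}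
    {hY : ∀ e, Y (κ e) = A.obj (T.s e.1)} {hZ : A.obj (T.t b) = Z}
    {hm' : m.Perm (image κ (ordering T b))} {κ' : T.Fiber (T.subst b f hf) → F}
    (hκ' : Function.Injective κ') {hX : ∀ e, X (κ' e) = A.obj (T.s e.1)}
    {hZ' : A.obj (T.t (T.subst b f hf)) = Z}
    {hl' : l.Perm (image κ' (ordering T (T.subst b f hf)))}
    (hp : ∀ e, (L (κ e)).Perm (image (fun x => κ' (T.substE b f hf e x)) (ordering T (f e))))
    (hk : ∀ e, k (κ e) ≫ eqToHom (hY e) =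
      A.actOn (f e) (fun x => κ' (T.substE b f hf e x)) (fun x => by rw [hX, T.s_substE])
        (congrArg A.obj (hf e)) (L (κ e)) (hp e)) :
    tensorOp L k h ≫ A.actOn b κ hY hZ m hm' = A.actOn (T.subst b f hf) κ' hX hZ' l hl' := by
  have hb := isOrdering_ordering T b
  have hN := hb.subst (hf := hf) (fun e => isOrdering_ordering T (f e))
  have hlN := hl'.trans (image_perm κ' ((isOrdering_ordering T _).perm hN))
  have hL : ∀ e, (image (fun x => κ' (T.substE b f hf e x)) (ordering T (f e))).Perm
      (image κ' (image (T.substE b f hf e) (ordering T (f e)))) := fun e => by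
    simp [image_eq]; exact List.Perm.refl _
  have q1 : (flat L (image κ (ordering T b))).Perm (flat (fun e => L (κ e)) (ordering T b)) := by
    rw [flat_eq, flat_eq, image_eq]; simp [List.flatMap_map]
  have q2 : (image κ' (flat (fun e => image (T.substE b f hf e) (ordering T (f e)))
      (ordering T b))).Perm (flat (fun e => image κ' (image (T.substE b f hf e)
        (ordering T (f e)))) (ordering T b)) := by
    simp [image_eq, flat_eq, List.map_flatMap]
  have q3 := flat_perm (fun g => List.Perm.refl (L g)) hm'
  have e1 := tensorFlat_perm k hm' hm (h.nodup_iff.1 hl) q3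
  have e2 := tensorFlat_pull L k κ (fun e => eqToHom (hY e)) (ordering T b) q1
  have e3 := A.assoc b f hf (ordering T b) hb _ (fun e => isOrdering_ordering T (f e))
  have e4 := tensorPull_flat (X := X) (Y := fun y => A.obj (T.s y.1))
    (Z := fun e => A.obj (T.s e.1)) κ' (fun y => eqToHom (hX y))
    (fun e => image (T.substE b f hf e) (ordering T (f e)))
    (fun e => tensorPull (T.substE b f hf e)
          (fun x => eqToHom (congrArg A.obj (T.s_substE b f hf e x))) (ordering T (f e)) ≫
            A.act (f e) (ordering T (f e)) (isOrdering_ordering T (f e)) ≫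
              eqToHom (congrArg A.obj (hf e))) (ordering T b) q2
  have e5 := tensorFlat_perm_inner (X := X) (Y := fun e => A.obj (T.s e.1))
    (L := fun e => L (κ e)) (L' := fun e => image κ' (image (T.substE b f hf e) (ordering T (f e))))
    (fun e => (hp e).trans (hL e)) (fun e => ?_)
    (k := fun e => k (κ e) ≫ eqToHom (hY e))
    (k' := fun e => tensorPull κ' (fun y => eqToHom (hX y)) _ ≫ tensorPull (T.substE b f hf e)
          (fun x => eqToHom (congrArg A.obj (T.s_substE b f hf e x))) (ordering T (f e)) ≫
            A.act (f e) (ordering T (f e)) (isOrdering_ordering T (f e)) ≫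
              eqToHom (congrArg A.obj (hf e))) (fun e => ?_) (ordering T b)
    (flat_perm (fun e => (hp e).trans (hL e)) (List.Perm.refl _))
  · have hz : A.obj (T.t b) = A.obj (T.t (T.subst b f hf)) := by rw [T.t_subst]
    have e3' : A.act (T.subst b f hf) _ hN = tensorFlat (X := fun y => A.obj (T.s y.1))
        (Y := fun e => A.obj (T.s e.1))
        (fun e => image (T.substE b f hf e) (ordering T (f e)))
        (fun e => tensorPull (T.substE b f hf e)
          (fun x => eqToHom (congrArg A.obj (T.s_substE b f hf e x))) (ordering T (f e)) ≫
            A.act (f e) (ordering T (f e)) (isOrdering_ordering T (f e)) ≫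
              eqToHom (congrArg A.obj (hf e))) (ordering T b) ≫ A.act b _ hb ≫ eqToHom hz := by
      rw [reassoc_of% e3]; simp
    rw [A.actOn_eq _ hκ' hX hZ' hl' hN hlN, e3', Category.assoc, Category.assoc,
      reassoc_of% e4]
    simp only [tensorOp, actOn, Category.assoc]
    rw [← reassoc_of% e1, reassoc_of% e2, e5]
    simp [tensorPerm_trans_assoc]
  · have := (image_perm κ' ((isOrdering_ordering T _).perm hN))
    refine (hp e).nodup_iff.2 (nodup_image (fun x x' hx => ?_) (isOrdering_ordering T (f e)).1)
    have := T.substE_inj (congrArg Subtype.val (hκ' hx))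
    simpa using this
  · have e6 := tensorPull_pull (X := X) (Y := fun y => A.obj (T.s y.1))
      (Z := fun x => A.obj (T.s x.1)) κ' (T.substE b f hf e) (fun y => eqToHom (hX y))
      (fun x => eqToHom (congrArg A.obj (T.s_substE b f hf e x))) (ordering T (f e)) (hL e).symm
    rw [hk, reassoc_of% e6, tensorPerm_trans_assoc]
    simp [actOn]

theorem actOn_natural {A A' : Algebra T C} (f : A ⟶ A') {F : Type*} {X X' : F → C} {Z Z' : C}
    {b : T.B} {κ : T.Fiber b → F} {hX : ∀ e, X (κ e) = A.obj (T.s e.1)}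
    {hX' : ∀ e, X' (κ e) = A'.obj (T.s e.1)} {hZ : A.obj (T.t b) = Z} {hZ' : A'.obj (T.t b) = Z'}
    {l : List F} (hn : l.Nodup) {hl : l.Perm (image κ (ordering T b))} (k : ∀ x, X x ⟶ X' x)
    (hk : ∀ e, k (κ e) ≫ eqToHom (hX' e) = eqToHom (hX e) ≫ f.app _) (h : Z ⟶ Z')
    (hh : eqToHom hZ ≫ h = f.app _ ≫ eqToHom hZ') :
    A.actOn b κ hX hZ l hl ≫ h = tensorMap k l ≫ A'.actOn b κ hX' hZ' l hl := by
  have e1 := tensorMap_perm k hn hl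
  have e2 := tensorMap_pull (Z := fun e => A'.obj (T.s e.1)) κ k (fun e => eqToHom (hX' e))
    (ordering T b)
  have e3 := tensorPull_map (Y := fun e => A.obj (T.s e.1)) (Z := fun e => A'.obj (T.s e.1)) κ
    (fun e => eqToHom (hX e)) (fun e => f.app _) (ordering T b)
  have e4 := f.comm b _ (isOrdering_ordering T b)
  simp only [actOn, Category.assoc]
  rw [hh, reassoc_of% e4, reassoc_of% e3, ← reassoc_of% e1, reassoc_of% e2]
  simp only [hk]

end Algebra

end Algebras

section Restriction

variable {J I : Type w} {S : PolynomialMonad J} {T : PolynomialMonad I}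
variable {C : Type u} [Category.{v} C] [MonoidalCategory C] [SymmetricCategory C]

namespace CartesianMorphism

variable (Φ : CartesianMorphism S T)

@[simp]
theorem fibEquiv_apply {d : S.B} (e : S.Fiber d) : Φ.fibEquiv d e = Φ.fib e := rfl

@[simp]
theorem fibEquiv_symm_fib {d : S.B} (e : S.Fiber d) : (Φ.fibEquiv d).symm (Φ.fib e) = e :=
  (Φ.fibEquiv d).symm_apply_apply e

@[simp]
theorem fib_fibEquiv_symm {d : S.B} (e : T.Fiber (Φ.onB d)) : Φ.fib ((Φ.fibEquiv d).symm e) = e :=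
  (Φ.fibEquiv d).apply_symm_apply e

theorem δ_s_symm {d : S.B} (e : T.Fiber (Φ.onB d)) :
    Φ.δ (S.s ((Φ.fibEquiv d).symm e).1) = T.s e.1 := by
  rw [← Φ.s_fib, fib_fibEquiv_symm]

theorem ordering_perm (d : S.B) {l : List (S.Fiber d)} (hl : IsOrdering S l) :
    l.Perm (image (Φ.fibEquiv d).symm (ordering T (Φ.onB d))) :=
  hl.perm ((isOrdering_ordering T _).of_bijective (Φ.fibEquiv d).symm.bijective)

end CartesianMorphism

/-- The action of an operation `d` of `S` on the restriction of a `T`-algebra: the operation `Φ d` of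
`T` acts, the fibres of `d` and `Φ d` being identified by `Φ`. -/
noncomputable def restrictAct (Φ : CartesianMorphism S T) (A : Algebra T C) (d : S.B)
    (l : List (S.Fiber d)) (hl : IsOrdering S l) :
    tensorOver (fun e => A.obj (Φ.δ (S.s e.1))) l ⟶ A.obj (Φ.δ (S.t d)) :=
  A.actOn (Φ.onB d) (Φ.fibEquiv d).symm (fun e => congrArg A.obj (Φ.δ_s_symm e))
    (congrArg A.obj (Φ.t_onB d)) l (Φ.ordering_perm d hl)

theorem restrictAct_equivariant (Φ : CartesianMorphism S T) (A : Algebra T C) (d : S.B)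
    (l l' : List (S.Fiber d)) (hl : IsOrdering S l) (hl' : IsOrdering S l') :
    (tensorPerm _ (hl.perm hl')).hom ≫ restrictAct Φ A d l' hl' = restrictAct Φ A d l hl :=
  A.perm_actOn _ _ _ _ _ _

theorem restrictAct_unit (Φ : CartesianMorphism S T) (A : Algebra T C) (j : J) :
    restrictAct Φ A (S.one j) [S.oneE j] (isOrdering_one S j) =
      (ρ_ (A.obj (Φ.δ (S.s (S.oneE j).1)))).hom ≫ eqToHom (by rw [S.s_oneE, S.t_one]) := by
  have hb := Φ.onB_one j
  have h : [S.oneE j].Perm [S.oneE j] := List.Perm.refl _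
  have hk : ∀ e : T.Fiber (T.one (Φ.δ j)), S.oneE j =
      (Φ.fibEquiv (S.one j)).symm ⟨e.1, e.2.trans hb.symm⟩ := fun e => (S.eq_oneE _).symm
  have hX : ∀ e : T.Fiber (T.one (Φ.δ j)), A.obj (Φ.δ (S.s (S.oneE j).1)) =
      A.obj (T.s e.1) := fun e => by rw [T.eq_oneE e, T.s_oneE, S.s_oneE]
  have hZ : A.obj (T.t (T.one (Φ.δ j))) = A.obj (Φ.δ (S.t (S.one j))) := by
    rw [T.t_one, S.t_one]
  have hl : [S.oneE j].Perm (image (fun e => S.oneE j) (ordering T (T.one (Φ.δ j)))) := by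
    have := image_perm (fun e : T.Fiber (T.one (Φ.δ j)) => S.oneE j)
      ((isOrdering_one T (Φ.δ j)).perm (isOrdering_ordering T _))
    exact this
  have e1 := A.actOn_one (X := fun e : S.Fiber (S.one j) => A.obj (Φ.δ (S.s e.1)))
    (Z := A.obj (Φ.δ (S.t (S.one j)))) (Φ.δ j) (κ := fun _ => S.oneE j) hX hZ hl h
  rw [tensorPerm_refl, Category.id_comp] at e1
  rw [← e1, restrictAct]
  exact A.actOn_congr hb fun e => S.eq_oneE _

theorem tensorPull_actOn (A : Algebra T C) {F G : Type*} {X : F → C} {Y : G → C} {Z : C} {b : T.B}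
    {κ : T.Fiber b → G} {hY : ∀ e, Y (κ e) = A.obj (T.s e.1)} {hZ : A.obj (T.t b) = Z}
    {l : List G} (hn : l.Nodup) {hl : l.Perm (image κ (ordering T b))} {f : G → F}
    (hf : Function.Injective f) (hX : ∀ g, X (f g) = Y g)
    (hl' : (image f l).Perm (image (fun e => f (κ e)) (ordering T b))) :
    tensorPull f (fun g => eqToHom (hX g)) l ≫ A.actOn b κ hY hZ l hl =
      A.actOn b (fun e => f (κ e)) (fun e => (hX _).trans (hY e)) hZ (image f l) hl' := by
  have q := image_perm f hl
  have e1 := tensorPull_perm hf (fun g => eqToHom (hX g)) hn hl q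
  have q2 : (image f (image κ (ordering T b))).Perm (image (fun e => f (κ e)) (ordering T b)) := by
    simp [image_eq]; exact List.Perm.refl _
  have e2 := tensorPull_pull (X := X) (Y := Y) (Z := fun e => A.obj (T.s e.1)) f κ
    (fun g => eqToHom (hX g)) (fun e => eqToHom (hY e)) (ordering T b) q2
  simp only [Algebra.actOn]
  rw [← reassoc_of% e1, reassoc_of% e2, tensorPerm_trans_assoc]
  simp

theorem restrict_actOn' (Φ : CartesianMorphism S T) (A : Algebra T C) {F : Type*} {X : F → C}
    {Z : C} {d : S.B} {κ : S.Fiber d → F} (hκ : Function.Injective κ)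
    (hX : ∀ e, X (κ e) = A.obj (Φ.δ (S.s e.1)))
    (hZ : A.obj (Φ.δ (S.t d)) = Z) {l : List F} {m : List (S.Fiber d)} (hm : IsOrdering S m)
    (h : l.Perm (image κ m))
    (hl : l.Perm (image (fun e => κ ((Φ.fibEquiv d).symm e)) (ordering T (Φ.onB d)))) :
    (tensorPerm X h).hom ≫ tensorPull κ (fun e => eqToHom (hX e)) m ≫
      restrictAct Φ A d m hm ≫ eqToHom hZ =
    A.actOn (Φ.onB d) (fun e => κ ((Φ.fibEquiv d).symm e))
      (fun e => (hX _).trans (congrArg A.obj (Φ.δ_s_symm e)))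
      ((congrArg A.obj (Φ.t_onB d)).trans hZ) l hl := by
  have q : (image κ m).Perm (image (fun e => κ ((Φ.fibEquiv d).symm e)) (ordering T (Φ.onB d))) :=
    h.symm.trans hl
  have := tensorPull_actOn A (X := X) (Y := fun e => A.obj (Φ.δ (S.s e.1))) (Z := Z)
    (κ := (Φ.fibEquiv d).symm) (hY := fun e => congrArg A.obj (Φ.δ_s_symm e))
    (hZ := (congrArg A.obj (Φ.t_onB d)).trans hZ) (f := κ) hm.1
    (hl := Φ.ordering_perm d hm) hκ hX q
  rw [restrictAct, A.actOn_comp_eqToHom, this, A.perm_actOn]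

theorem restrictAct_assoc (Φ : CartesianMorphism S T) (A : Algebra T C) (b : S.B)
    (f : S.Fiber b → S.B) (hf : ∀ e, S.t (f e) = S.s e.1)
    (l : List (S.Fiber b)) (hl : IsOrdering S l) (m : ∀ e, List (S.Fiber (f e)))
    (hm : ∀ e, IsOrdering S (m e)) :
    tensorFlat (X := fun y => A.obj (Φ.δ (S.s y.1))) (Y := fun e => A.obj (Φ.δ (S.s e.1)))
        (fun e => image (S.substE b f hf e) (m e))
        (fun e => tensorPull (S.substE b f hf e)
          (fun x => eqToHom (congrArg (fun j => A.obj (Φ.δ j)) (S.s_substE b f hf e x))) (m e) ≫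
            restrictAct Φ A (f e) (m e) (hm e) ≫
              eqToHom (congrArg (fun j => A.obj (Φ.δ j)) (hf e))) l ≫ restrictAct Φ A b l hl =
      restrictAct Φ A (S.subst b f hf) (flat (fun e => image (S.substE b f hf e) (m e)) l)
          (hl.subst hm) ≫
        eqToHom (congrArg (fun j => A.obj (Φ.δ j)) (S.t_subst b f hf)) := by
  have hg : ∀ e : T.Fiber (Φ.onB b), T.t (Φ.onB (f ((Φ.fibEquiv b).symm e))) = T.s e.1 :=
    fun e => by rw [Φ.t_onB, hf, Φ.δ_s_symm]
  have hfg : ∀ e : S.Fiber b, Φ.onB (f ((Φ.fibEquiv b).symm (Φ.fib e))) = Φ.onB (f e) :=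
    fun e => by rw [Φ.fibEquiv_symm_fib]
  have hB : T.subst (Φ.onB b) (fun e => Φ.onB (f ((Φ.fibEquiv b).symm e))) hg =
      Φ.onB (S.subst b f hf) := (Φ.map_subst b f hf _ hg hfg).symm
  have hBE : ∀ (e : T.Fiber (Φ.onB b)) (x : T.Fiber (Φ.onB (f ((Φ.fibEquiv b).symm e)))),
      Φ.fib (S.substE b f hf ((Φ.fibEquiv b).symm e) ((Φ.fibEquiv _).symm x)) =
      ⟨(T.substE (Φ.onB b) (fun e => Φ.onB (f ((Φ.fibEquiv b).symm e))) hg e x).1, 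
        (T.substE (Φ.onB b) (fun e => Φ.onB (f ((Φ.fibEquiv b).symm e))) hg e x).2.trans hB⟩ := by
    intro e x
    obtain ⟨e, rfl⟩ := (Φ.fibEquiv b).surjective e
    apply Subtype.ext
    refine (Φ.map_substE b f hf _ hg hfg _ _).trans ?_
    refine T.substE_congr rfl _ _ (fun _ => rfl) ?_ ?_
    · simp
    · exact congrArg Subtype.val (Φ.fib_fibEquiv_symm x)
  have hN := hl.subst (hf := hf) hm
  have hl1 := Φ.ordering_perm _ hN
  have hZ2 : A.obj (T.t (T.subst (Φ.onB b) (fun e => Φ.onB (f ((Φ.fibEquiv b).symm e))) hg)) =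
      A.obj (Φ.δ (S.t b)) := by rw [T.t_subst, Φ.t_onB]
  have hX2 : ∀ y : T.Fiber (T.subst (Φ.onB b) (fun e => Φ.onB (f ((Φ.fibEquiv b).symm e))) hg),
      A.obj (Φ.δ (S.s ((Φ.fibEquiv (S.subst b f hf)).symm ⟨y.1, y.2.trans hB⟩).1)) =
        A.obj (T.s y.1) := fun y => by rw [Φ.δ_s_symm]
  have hl2 : (flat (fun e => image (S.substE b f hf e) (m e)) l).Perm
      (image (fun y => (Φ.fibEquiv (S.subst b f hf)).symm ⟨y.1, y.2.trans hB⟩)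
      (ordering T (T.subst (Φ.onB b) (fun e => Φ.onB (f ((Φ.fibEquiv b).symm e))) hg))) := by
    refine hN.perm ((isOrdering_ordering T _).of_bijective ⟨fun y y' h => ?_, fun z => ?_⟩)
    · have h := congrArg Subtype.val ((Φ.fibEquiv (S.subst b f hf)).symm.injective h)
      exact Subtype.ext h
    · refine ⟨⟨(Φ.fib z).1, (Φ.fib z).2.trans hB.symm⟩, Φ.fibEquiv_symm_fib z⟩
  have hκ : ∀ (e : T.Fiber (Φ.onB b)) (x : T.Fiber (Φ.onB (f ((Φ.fibEquiv b).symm e)))),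
      S.substE b f hf ((Φ.fibEquiv b).symm e) ((Φ.fibEquiv _).symm x) =
      (Φ.fibEquiv (S.subst b f hf)).symm
        ⟨(T.substE (Φ.onB b) (fun e => Φ.onB (f ((Φ.fibEquiv b).symm e))) hg e x).1, 
        (T.substE (Φ.onB b) (fun e => Φ.onB (f ((Φ.fibEquiv b).symm e))) hg e x).2.trans hB⟩ := by
    intro e x
    rw [← hBE, Φ.fibEquiv_symm_fib]
  have hinj : ∀ e, Function.Injective (S.substE b f hf e) := fun e x x' h => by
    have := S.substE_inj (congrArg Subtype.val h)
    simpa using this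
  have q0 : ∀ e, (image (S.substE b f hf e) (m e)).Perm (image (fun x => S.substE b f hf e
      ((Φ.fibEquiv _).symm x)) (ordering T (Φ.onB (f e)))) := fun e => by
    have h1 := image_perm (S.substE b f hf e) (Φ.ordering_perm (f e) (hm e))
    refine h1.trans ?_
    simp [image_eq]; exact List.Perm.refl _
  have hinj' : Function.Injective
      fun y : T.Fiber (T.subst (Φ.onB b) (fun e => Φ.onB (f ((Φ.fibEquiv b).symm e))) hg) =>
        (Φ.fibEquiv (S.subst b f hf)).symm ⟨y.1, y.2.trans hB⟩ := fun y y' h => by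
    have h := congrArg Subtype.val ((Φ.fibEquiv (S.subst b f hf)).symm.injective h)
    exact Subtype.ext h
  rw [restrictAct, restrictAct, A.actOn_comp_eqToHom, tensorFlat_eq_op]
  have key := A.actOn_subst (X := fun y => A.obj (Φ.δ (S.s y.1)))
    (Y := fun e => A.obj (Φ.δ (S.s e.1))) (Z := A.obj (Φ.δ (S.t b)))
    (hf := hg) (fun e => image (S.substE b f hf e) (m e))
    (fun e => tensorPull (S.substE b f hf e)
          (fun x => eqToHom (congrArg (fun j => A.obj (Φ.δ j)) (S.s_substE b f hf e x))) (m e) ≫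
            restrictAct Φ A (f e) (m e) (hm e) ≫
              eqToHom (congrArg (fun j => A.obj (Φ.δ j)) (hf e))) (l := flat _ l) (m := l)
    (List.Perm.refl _) hN.1 hl.1 (κ := (Φ.fibEquiv b).symm)
    (hY := fun e => congrArg A.obj (Φ.δ_s_symm e)) (hZ := congrArg A.obj (Φ.t_onB b))
    (hm' := Φ.ordering_perm _ hl)
    (κ' := fun y => (Φ.fibEquiv (S.subst b f hf)).symm ⟨y.1, y.2.trans hB⟩)
    hinj'
    (hX := hX2) (hZ' := hZ2) (hl' := hl2) (fun e => ?_) (fun e => ?_)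
  · rw [key]
    exact A.actOn_congr hB fun e => rfl
  · refine (q0 ((Φ.fibEquiv b).symm e)).trans ?_
    simp only [hκ]
    exact List.Perm.refl _
  · have h1 := restrict_actOn' Φ A (X := fun y : S.Fiber (S.subst b f hf) => A.obj (Φ.δ (S.s y.1)))
      (hinj ((Φ.fibEquiv b).symm e)) (fun x => congrArg (fun j => A.obj (Φ.δ j)) (S.s_substE b f hf _ x))
      (congrArg (fun j => A.obj (Φ.δ j)) (hf _)) (hm ((Φ.fibEquiv b).symm e)) (List.Perm.refl _)
      (q0 ((Φ.fibEquiv b).symm e))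
    rw [tensorPerm_refl, Category.id_comp] at h1
    rw [h1, A.actOn_comp_eqToHom]
    exact A.actOn_congr rfl fun x => hκ e x

/-- The restriction of a `T`-algebra along a cartesian morphism `Φ : S ⟶ T`. -/
noncomputable def restrict (Φ : CartesianMorphism S T) (A : Algebra T C) : Algebra S C where
  obj j := A.obj (Φ.δ j)
  act := restrictAct Φ A
  equivariant := restrictAct_equivariant Φ A
  unit := restrictAct_unit Φ A
  assoc := restrictAct_assoc Φ A

theorem restrict_actOn (Φ : CartesianMorphism S T) (A : Algebra T C) {F : Type*} {X : F → C}
    {Z : C} {d : S.B} {κ : S.Fiber d → F} (hκ : Function.Injective κ)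
    {hX : ∀ e, X (κ e) = (restrict Φ A).obj (S.s e.1)}
    {hZ : (restrict Φ A).obj (S.t d) = Z} {l : List F} {h : l.Perm (image κ (ordering S d))}
    (hl : l.Perm (image (fun e => κ ((Φ.fibEquiv d).symm e)) (ordering T (Φ.onB d)))) :
    (restrict Φ A).actOn d κ hX hZ l h = A.actOn (Φ.onB d) (fun e => κ ((Φ.fibEquiv d).symm e))
      (fun e => (hX _).trans (congrArg A.obj (Φ.δ_s_symm e)))
      ((congrArg A.obj (Φ.t_onB d)).trans hZ) l hl :=
  restrict_actOn' Φ A hκ hX hZ (isOrdering_ordering S d) h hl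

/-- The restriction functor from `T`-algebras to `S`-algebras. -/
noncomputable def restriction (Φ : CartesianMorphism S T) : Algebra T C ⥤ Algebra S C where
  obj A := restrict Φ A
  map {A A'} f :=
    { app := fun j => f.app (Φ.δ j)
      comm := fun d l hl => by
        refine Algebra.actOn_natural f (X := fun e : S.Fiber d => A.obj (Φ.δ (S.s e.1)))
          (X' := fun e : S.Fiber d => A'.obj (Φ.δ (S.s e.1)))
          hl.1 (fun e => f.app (Φ.δ (S.s e.1))) (fun e => ?_)
          (f.app (Φ.δ (S.t d))) ?_
        · exact Algebra.Hom.app_eqToHom f (Φ.δ_s_symm e) _ _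
        · exact (Algebra.Hom.app_eqToHom f (Φ.t_onB d) _ _).symm }
  map_id _ := rfl
  map_comp _ _ := rfl

end Restriction

section Colimit

variable {J I : Type w} {S : PolynomialMonad J} {T : PolynomialMonad I}
variable {C : Type u} [Category.{v} C] [MonoidalCategory C] [SymmetricCategory C]

namespace Classifier

/-- The functor from the classifier of `Φ` to the classifier of the identity of `T`, which forgets
the `J`-colouring and applies `Φ` to the operations of `S`. -/
def forget (Φ : CartesianMorphism S T) (i : I) :
    Classifier Φ i ⥤ Classifier (CartesianMorphism.id T) i where
  obj c := { b := c.b, t_b := c.t_b, col := fun e => T.s e.1, δ_col := fun _ => rfl }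
  map {c' c} f :=
    { d := fun e => Φ.onB (f.d e)
      t_d := Hom.t_onB_d f
      b_eq := f.b_eq
      col_eq := fun e x => T.s_substE c.b _ (Hom.t_onB_d f) e x }
  map_id c := Hom.ext (funext fun e => (Φ.onB_one _).trans (congrArg T.one (c.δ_col e)))
  map_comp f g := Hom.ext (funext fun e => onB_compD f g e)

/-- The object `1_i` of the classifier of the identity of `T`. -/
def one (T : PolynomialMonad I) (i : I) : Classifier (CartesianMorphism.id T) i where
  b := T.one i
  t_b := T.t_one i
  col e := T.s e.1
  δ_col _ := rfl

theorem Hom.ordering_perm {Φ : CartesianMorphism S T} {i : I} {c' c : Classifier Φ i}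
    (f : Hom c' c) : (ordering T c'.b).Perm
      (flat (fun e => image (f.emb e) (ordering S (f.d e))) (ordering T c.b)) :=
  (isOrdering_ordering T _).perm
    (f.isOrdering (isOrdering_ordering T _) fun _ => isOrdering_ordering S _)

theorem Hom.emb_injective {Φ : CartesianMorphism S T} {i : I} {c' c : Classifier Φ i}
    (f : Hom c' c) (e : T.Fiber c.b) : Function.Injective (f.emb e) := fun x x' h => by
  have := f.emb_inj h
  simpa using this

end Classifier

/-- The action of a morphism of the classifier on tensor products of components of an
`S`-algebra: its operations `d e` act on the corresponding blocks of factors. -/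
noncomputable def tildeMap {Φ : CartesianMorphism S T} {i : I} (A : Algebra S C)
    {c' c : Classifier Φ i} (f : Classifier.Hom c' c) :
    tensorOver (fun e => A.obj (c'.col e)) (ordering T c'.b) ⟶
      tensorOver (fun e => A.obj (c.col e)) (ordering T c.b) :=
  tensorOp (fun e => image (f.emb e) (ordering S (f.d e)))
    (fun e => A.actOn (f.d e) (f.emb e) (fun x => congrArg A.obj (f.col_emb e x))
      (congrArg A.obj (f.t_d e)) _ (List.Perm.refl _)) f.ordering_perm

theorem tildeMap_id {Φ : CartesianMorphism S T} {i : I} (A : Algebra S C) (c : Classifier Φ i) :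
    tildeMap A c.idHom = 𝟙 _ := by
  have q : (ordering T c.b).Perm (flat (fun e => [e]) (ordering T c.b)) := by
    rw [flat_single, image_eq]; simp
  have q1 : ∀ e, (image (c.idHom.emb e) (ordering S (S.one (c.col e)))).Perm [e] := fun e => by
    have := image_perm (c.idHom.emb e) ((isOrdering_ordering S _).perm (isOrdering_one S (c.col e)))
    refine this.trans ?_
    simp only [image, c.idHom_emb]
    exact List.Perm.refl _
  rw [← tensorMap_id, tensorMap_eq_op _ _ q, tildeMap]
  refine tensorOp_congr q1 (fun e => (q1 e).nodup_iff.2 (List.nodup_singleton e)) (fun e => ?_) _ _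
  have h : (image (c.idHom.emb e) (ordering S (S.one (c.col e)))).Perm
      [c.idHom.emb e (S.oneE (c.col e))] := by
    rw [c.idHom_emb]; exact q1 e
  refine (A.actOn_one (c.col e) _ _ _ h).trans ?_
  have h2 := c.idHom_emb e (S.oneE (c.col e))
  revert h
  generalize_proofs p1
  revert p1
  rw [h2]
  intros
  simp

theorem image_flat {F G H : Type*} {K : H → Type*} {κ' : G → F} {φ : ∀ x, K x → G}
    {m : ∀ x, List (K x)} {P : Type*} {L : P → List F} {κ : H → P} (l : List H)
    (h : ∀ x, image (fun z => κ' (φ x z)) (m x) = L (κ x)) :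
    image κ' (flat (fun x => image (φ x) (m x)) l) = flat L (image κ l) := by
  simp only [image_eq, flat_eq, List.map_flatMap, List.flatMap_map, List.map_map,
    Function.comp_def] at h ⊢
  simp only [h]

theorem tildeMap_comp {Φ : CartesianMorphism S T} {i : I} (A : Algebra S C)
    {c'' c' c : Classifier Φ i} (f : Classifier.Hom c'' c') (g : Classifier.Hom c' c) :
    tildeMap A (Classifier.compHom f g) = tildeMap A f ≫ tildeMap A g := by
  have hf := isOrdering_ordering T c''.b
  have hc := isOrdering_ordering T c'.b
  let κ' (e : T.Fiber c.b) : S.Fiber (S.subst (g.d e) (fun x => f.d (g.emb e x))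
    (Classifier.comp_t f g e)) → T.Fiber c''.b := (Classifier.compHom f g).emb e
  have hκ' : ∀ e x z, κ' e (S.substE (g.d e) (fun x => f.d (g.emb e x))
    (Classifier.comp_t f g e) x z) = f.emb (g.emb e x) z := Classifier.compHom_emb f g
  have hq : ∀ e x, image (fun z => κ' e (S.substE (g.d e) (fun x => f.d (g.emb e x))
        (Classifier.comp_t f g e) x z)) (ordering S (f.d (g.emb e x))) =
      (image (f.emb (g.emb e x)) (ordering S (f.d (g.emb e x)))) := fun e x => by
    simp only [hκ']
  have q : ∀ e, (image (κ' e) (ordering S (S.subst (g.d e) (fun x => f.d (g.emb e x))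
      (Classifier.comp_t f g e)))).Perm
      (flat (fun y => image (f.emb y) (ordering S (f.d y)))
        (image (g.emb e) (ordering S (g.d e)))) := fun e => by
    refine (image_perm (κ' e) ((isOrdering_ordering S _).perm ((isOrdering_ordering S (g.d e)).subst
      (hf := Classifier.comp_t f g e) (fun x => isOrdering_ordering S _)))).trans ?_
    rw [image_flat (κ := g.emb e) (L := fun y => image (f.emb y) (ordering S (f.d y))) _ (hq e)]
  have q' := (Classifier.compHom f g).ordering_perm.trans
    (flat_perm q (List.Perm.refl (ordering T c.b)))
  have hn : ∀ e, (image (κ' e) (ordering S (S.subst (g.d e) (fun x => f.d (g.emb e x))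
      (Classifier.comp_t f g e)))).Nodup := fun e =>
    nodup_image ((Classifier.compHom f g).emb_injective e) (isOrdering_ordering S _).1
  rw [tildeMap, tildeMap, tildeMap, tensorOp_comp _ _ hf.1 hc.1 q']
  refine tensorOp_congr q hn (fun e => ?_) _ _
  rw [tensorFlat_eq_op]
  have hX : ∀ x, A.obj (c''.col (κ' e x)) = A.obj (S.s x.1) :=
    fun x => congrArg A.obj ((Classifier.compHom f g).col_emb e x)
  have key := A.actOn_subst (X := fun y => A.obj (c''.col y)) (Y := fun y => A.obj (c'.col y))
    (Z := A.obj (c.col e)) (hf := Classifier.comp_t f g e)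
    (fun y => image (f.emb y) (ordering S (f.d y)))
    (fun y => A.actOn (f.d y) (f.emb y) (fun x => congrArg A.obj (f.col_emb y x))
      (congrArg A.obj (f.t_d y)) _ (List.Perm.refl _))
    (List.Perm.refl _) ((q e).nodup_iff.1 (hn e))
    (nodup_image (g.emb_injective e) (isOrdering_ordering S _).1)
    (κ := g.emb e) (hY := fun x => congrArg A.obj (g.col_emb e x))
    (hZ := congrArg A.obj (g.t_d e)) (hm' := List.Perm.refl _)
    (κ' := κ' e) ((Classifier.compHom f g).emb_injective e)
    (hX := hX) (hZ' := congrArg A.obj ((Classifier.compHom f g).t_d e)) (hl' := (q e).symm)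
    (fun x => by rw [hq]) (fun x => ?_)
  · rw [key]
    exact (A.perm_actOn (X := fun y => A.obj (c''.col y)) (S.subst (g.d e)
      (fun x => f.d (g.emb e x)) (Classifier.comp_t f g e)) (κ' e) hX
      (congrArg A.obj ((Classifier.compHom f g).t_d e)) (q e) (q e).symm).symm
  · rw [A.actOn_comp_eqToHom]
    exact A.actOn_congr rfl fun z => (hκ' e x z).symm

/-- The functor represented by an `S`-algebra `A` on the classifier: its value at a `J`-coloured
operation is the tensor product of the components of `A` at the colours. -/
noncomputable def tilde (A : Algebra S C) (Φ : CartesianMorphism S T) (i : I) :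
    Classifier Φ i ⥤ C where
  obj c := tensorOver (fun e => A.obj (c.col e)) (ordering T c.b)
  map f := tildeMap A f
  map_id c := tildeMap_id A c
  map_comp f g := tildeMap_comp A f g

/-- The action of a `T`-algebra on a tensor product of its components. -/
noncomputable def actionMap (Y : Algebra T C) {i : I}
    (c : Classifier (CartesianMorphism.id T) i) :
    tensorOver (fun e => Y.obj (c.col e)) (ordering T c.b) ⟶ Y.obj i :=
  Y.actOn c.b id (fun e => congrArg Y.obj (c.δ_col e))
    (congrArg Y.obj c.t_b) (ordering T c.b) (by rw [image_eq, List.map_id])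

theorem tildeMap_actionMap (Y : Algebra T C) {i : I}
    {c' c : Classifier (CartesianMorphism.id T) i} (f : Classifier.Hom c' c) :
    tildeMap Y f ≫ actionMap Y c = actionMap Y c' := by
  have ht : ∀ e, T.t (f.d e) = T.s e.1 := Classifier.Hom.t_onB_d f
  let κ' : T.Fiber (T.subst c.b f.d ht) → T.Fiber c'.b := fun y => ⟨y.1, y.2.trans f.b_eq⟩
  have hκ' : ∀ e x, κ' (T.substE c.b f.d ht e x) = f.emb e x := fun _ _ => rfl
  have hX : ∀ y, Y.obj (c'.col (κ' y)) = Y.obj (T.s y.1) :=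
    fun y => congrArg Y.obj (c'.δ_col (κ' y))
  have hi : Function.Injective κ' := fun y y' h => by
    have h := congrArg Subtype.val h
    exact Subtype.ext h
  have hl : (ordering T c'.b).Perm (image κ' (ordering T (T.subst c.b f.d ht))) :=
    (isOrdering_ordering T _).perm ((isOrdering_ordering T _).of_bijective
      ⟨hi, fun y => ⟨⟨y.1, y.2.trans f.b_eq.symm⟩, rfl⟩⟩)
  have key := Y.actOn_subst (X := fun y => Y.obj (c'.col y)) (Y := fun y => Y.obj (c.col y))
    (Z := Y.obj i) (b := c.b) (hf := ht)
    (fun e => image (f.emb e) (ordering T (f.d e)))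
    (fun e => Y.actOn (f.d e) (f.emb e) (fun x => congrArg Y.obj (f.col_emb e x))
      (congrArg Y.obj (f.t_d e)) _ (List.Perm.refl _)) f.ordering_perm
    (isOrdering_ordering T c'.b).1 (isOrdering_ordering T c.b).1 (κ := id)
    (hY := fun e => congrArg Y.obj (c.δ_col e)) (hZ := congrArg Y.obj c.t_b)
    (hm' := by rw [image_eq, List.map_id]) (κ' := κ') hi (hX := hX)
    (hZ' := congrArg Y.obj (f.b_eq ▸ c'.t_b)) (hl' := hl) (fun e => List.Perm.refl _)
    (fun e => Y.actOn_comp_eqToHom _ _ _ _ _ _ _)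
  refine key.trans ?_
  exact Y.actOn_congr (X := fun y => Y.obj (c'.col y)) (κ := κ') (κ' := id)
    (hX' := fun e => congrArg Y.obj (c'.δ_col e)) (hZ' := congrArg Y.obj c'.t_b) f.b_eq
    fun y => rfl

/-- The action of a `T`-algebra `Y` on the tensor products of its components, as a cocone on the
functor represented by `Y` on the classifier of the identity of `T`. -/
noncomputable def actionCocone (Y : Algebra T C) (i : I) :
    Cocone (tilde Y (CartesianMorphism.id T) i) where
  pt := Y.obj i
  ι :=
    { app := fun c => actionMap Y c
      naturality := fun c' c f => (tildeMap_actionMap Y f).trans (Category.comp_id _).symm }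

theorem tildeTrans_naturality {Φ : CartesianMorphism S T} {X : Algebra S C} {Y : Algebra T C}
    (f : X ⟶ (restriction Φ).obj Y) {i : I} {c' c : Classifier Φ i} (g : Classifier.Hom c' c) :
    tildeMap X g ≫ tensorMap (fun e => Algebra.Hom.app f (c.col e) ≫
        eqToHom (congrArg Y.obj (c.δ_col e))) (ordering T c.b) =
      tensorMap (fun e => Algebra.Hom.app f (c'.col e) ≫
        eqToHom (congrArg Y.obj (c'.δ_col e))) (ordering T c'.b) ≫
        tildeMap Y ((Classifier.forget Φ i).map g) := by
  let g' : Classifier.Hom ((Classifier.forget Φ i).obj c') ((Classifier.forget Φ i).obj c) :=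
    (Classifier.forget Φ i).map g
  let k (c : Classifier Φ i) (e : T.Fiber c.b) : X.obj (c.col e) ⟶ Y.obj (T.s e.1) :=
    Algebra.Hom.app f (c.col e) ≫ eqToHom (congrArg Y.obj (c.δ_col e))
  let κ (e : T.Fiber c.b) : T.Fiber (Φ.onB (g.d e)) → T.Fiber c'.b := g'.emb e
  have hκ : ∀ e x, g.emb e ((Φ.fibEquiv (g.d e)).symm x) = κ e x := fun e x => by
    obtain ⟨x, rfl⟩ := (Φ.fibEquiv (g.d e)).surjective x
    rw [Equiv.symm_apply_apply]
    rfl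
  have hp : ∀ e, (image (g.emb e) (ordering S (g.d e))).Perm
      (image (κ e) (ordering T (Φ.onB (g.d e)))) := fun e => by
    refine (image_perm (g.emb e) (Φ.ordering_perm _ (isOrdering_ordering S (g.d e)))).trans ?_
    have h : κ e = fun x => g.emb e ((Φ.fibEquiv (g.d e)).symm x) := funext fun x => (hκ e x).symm
    rw [h]
    simp only [image_eq, List.map_map]
    exact List.Perm.refl _
  have hn : ∀ e, (image (g.emb e) (ordering S (g.d e))).Nodup := fun e =>
    nodup_image (g.emb_injective e) (isOrdering_ordering S _).1
  have p' : (ordering T c'.b).Perm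
      (flat (fun e => image (κ e) (ordering T (Φ.onB (g.d e)))) (ordering T c.b)) :=
    g'.ordering_perm
  have hX : ∀ e x, Y.obj (T.s (κ e x).1) = Y.obj (T.s x.1) := fun e x =>
    congrArg Y.obj (g'.col_emb e x)
  have hZ : ∀ e, Y.obj (T.t (Φ.onB (g.d e))) = Y.obj (T.s e.1) := fun e =>
    congrArg Y.obj (g'.t_d e)
  have e1 := tensorMap_perm (k c') (isOrdering_ordering T c'.b).1 p'
  change tildeMap X g ≫ tensorMap (k c) (ordering T c.b) =
    tensorMap (k c') (ordering T c'.b) ≫ tensorOp (X := fun y : T.Fiber c'.b => Y.obj (T.s y.1))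
    (Y := fun e : T.Fiber c.b => Y.obj (T.s e.1))
    (fun e => image (κ e) (ordering T (Φ.onB (g.d e))))
    (fun e => Y.actOn (Φ.onB (g.d e)) (κ e) (hX e) (hZ e) _ (List.Perm.refl _)) p'
  rw [tildeMap, tensorOp, tensorOp, Category.assoc, tensorFlat_map, ← reassoc_of% e1,
    tensorMap_flat]
  refine tensorOp_congr hp hn (fun e => ?_) g.ordering_perm p'
  have hX' : ∀ x, Y.obj (T.s (g.emb e x).1) = ((restriction Φ).obj Y).obj (S.s x.1) :=
    fun x => congrArg Y.obj ((c'.δ_col _).symm.trans (congrArg Φ.δ (g.col_emb e x)))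
  have hZ' : ((restriction Φ).obj Y).obj (S.t (g.d e)) = Y.obj (T.s e.1) :=
    congrArg Y.obj ((congrArg Φ.δ (g.t_d e)).trans (c.δ_col e))
  have hl : (image (g.emb e) (ordering S (g.d e))).Perm
      (image (fun x => g.emb e ((Φ.fibEquiv (g.d e)).symm x)) (ordering T (Φ.onB (g.d e)))) := by
    simp only [hκ]; exact hp e
  have e2 := Algebra.actOn_natural f (X := fun y => X.obj (c'.col y))
    (X' := fun y => Y.obj (T.s y.1)) (b := g.d e)
    (κ := g.emb e) (hX := fun x => congrArg X.obj (g.col_emb e x)) (hX' := hX')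
    (hZ := congrArg X.obj (g.t_d e)) (hZ' := hZ') (hn e) (hl := List.Perm.refl _) (k c')
    (fun x => ?_) (k c e) ?_
  · have e3 := tensorMap_perm (k c') (hn e) (hp e)
    have e4 := restrict_actOn Φ Y (X := fun y : T.Fiber c'.b => Y.obj (T.s y.1))
      (g.emb_injective e) (hX := hX') (hZ := hZ') (h := List.Perm.refl _) hl
    have e5 := Y.perm_actOn (X := fun y : T.Fiber c'.b => Y.obj (T.s y.1)) (Φ.onB (g.d e)) (κ e)
      (hX e) (hZ e) (hp e) (List.Perm.refl _)
    refine e2.trans ?_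
    rw [reassoc_of% e3, e5]
    refine congrArg (_ ≫ ·) (e4.trans ?_)
    exact Y.actOn_congr rfl fun x => hκ e x
  · have := Algebra.Hom.app_eqToHom f (g.col_emb e x)
      (congrArg Y.obj (congrArg Φ.δ (g.col_emb e x))) (congrArg X.obj (g.col_emb e x))
    rw [← this, Category.assoc]
    exact congrArg (_ ≫ ·) (eqToHom_trans _ _)
  · have := Algebra.Hom.app_eqToHom f (g.t_d e)
      (congrArg Y.obj (congrArg Φ.δ (g.t_d e))) (congrArg X.obj (g.t_d e))
    rw [← reassoc_of% this]
    exact congrArg (_ ≫ ·) (eqToHom_trans _ _)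

/-- The transformation induced by a morphism from an `S`-algebra `X` to the restriction of a
`T`-algebra `Y`; its components are tensor products of components of the morphism. -/
noncomputable def tildeTrans {Φ : CartesianMorphism S T} {X : Algebra S C} {Y : Algebra T C}
    (f : X ⟶ (restriction Φ).obj Y) (i : I) :
    tilde X Φ i ⟶ Classifier.forget Φ i ⋙ tilde Y (CartesianMorphism.id T) i where
  app c := tensorMap (fun e => Algebra.Hom.app f (c.col e) ≫
    eqToHom (congrArg Y.obj (c.δ_col e))) (ordering T c.b)
  naturality _ _ g := tildeTrans_naturality f g

/-- The cocone on the functor represented by `X` induced by a morphism from `X` to the restriction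
of a `T`-algebra `Y`. -/
noncomputable def colimitCocone {Φ : CartesianMorphism S T} {X : Algebra S C} {Y : Algebra T C}
    (f : X ⟶ (restriction Φ).obj Y) (i : I) : Cocone (tilde X Φ i) :=
  (Cocone.precompose (tildeTrans f i)).obj ((actionCocone Y i).whisker (Classifier.forget Φ i))

/-- The map induced by `colimitCocone` on the value at `1_i` of the left Kan extension, along the functor
`Classifier.forget Φ i`, of the functor represented by `X`. -/
noncomputable def kanComparison [HasColimitsOfSize.{w, w} C] {Φ : CartesianMorphism S T}
    {X : Algebra S C} {Y : Algebra T C} (f : X ⟶ (restriction Φ).obj Y) (i : I) :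
    ((Classifier.forget Φ i).lan.obj (tilde X Φ i)).obj (Classifier.one T i) ⟶ Y.obj i :=
  (((Classifier.forget Φ i).lan.obj (tilde X Φ i)).descOfIsLeftKanExtension
    ((Classifier.forget Φ i).lanUnit.app (tilde X Φ i))
    (tilde Y (CartesianMorphism.id T) i) (tildeTrans f i)).app (Classifier.one T i) ≫
      (actionCocone Y i).ι.app (Classifier.one T i)

end Colimit


end PolyMonads

/-!
The left adjoint is constructed by hand: for an `S`-algebra `A`, the objects
`freeObj A Φ i = colim_{c ∈ Classifier Φ i} tilde A Φ i c` carry a `T`-algebra structure `free A Φ`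
with the universal property of the value at `A` of a left adjoint.

* The action. Since the tensor product preserves colimits in each variable, a tensor product of
  colimits over the inputs of an operation `b` is the colimit, over the product of the classifiers
  of these inputs, of the tensor products (`nonempty_isColimit_tensorCocone`). It therefore suffices
  to let `b` act on families of `J`-coloured operations `k e`. Their composite with `b` is again a
  `J`-coloured operation `c`, and the tensor product over the inputs of `c` is the tensor product
  over `e` of those over the inputs of `k e` (`IsGraft.split`). The inverse of this isomorphism,
  followed by the component of the colimit cocone at `c`, is the action of `b` (`split_freeAct`).
  It is well defined because grafting is functorial in the `k e` (`IsGraft.tildeMap_split`), and it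
  is unital and associative because grafting is (`IsGraft.split_one`, `IsGraft.split_assoc`).

* The universal property. The unit `A ⟶ restriction (free A Φ)` is given by the unit operations of
  `T`, and it is a morphism of `S`-algebras because an operation `d` of `S` is a morphism of the
  classifier from the operation `Φ d`, coloured by the sources of `d`, to a unit operation. Each
  coloured operation `c` is the composite of its underlying operation with unit operations, so the
  component at `c` of the colimit cocone is the tensor product of components of the unit followed by
  the action of the operation (`evalAt_freeUnit`). In other words, `colimitCocone (freeUnit A Φ) i`
  is the colimit cocone. This determines a morphism of `T`-algebras out of `free A Φ` by its
  restriction to `A`, and a morphism `f : A ⟶ restriction Y` extends by descent of `colimitCocone f`;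
  this extension is compatible with the actions because the actions on `Y` are compatible with
  grafting (`IsGraft.split_evalAt`).

Two universal morphisms from `A` are isomorphic, so the unit of any left adjoint yields a colimit
cocone too. Finally, `1_i` is a terminal object of the classifier of the identity of `T`, so that
the value there of a left Kan extension of `tilde A Φ i` is the colimit of this extension, which is
the colimit of `tilde A Φ i`.
-/

namespace PolyMonads

/-! ### Ordered tensor products of colimits -/

section TensorColimit

variable {C : Type u} [Category.{v} C] [MonoidalCategory C]
variable {F : Type w} {K : F → Type w} [∀ f, Category.{w} (K f)]

/-- The product of the categories `K f` over a list of indices `f`, built factor by factor. -/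
def listProd (K : F → Type w) [∀ f, Category.{w} (K f)] : List F → Cat.{w, w}
  | [] => Cat.of (Discrete PUnit)
  | f :: l => Cat.of (K f × listProd K l)

/-- The functor `(k₁, k₂, …) ↦ D k₁ ⊗ (D k₂ ⊗ ⋯)` on `listProd K l`. -/
def listDiagram (D : ∀ f, K f ⥤ C) : ∀ l : List F, listProd K l ⥤ C
  | [] => (Functor.const _).obj (𝟙_ C)
  | f :: l => Functor.uncurry.obj
      ((((Functor.whiskeringLeft₂ C).obj (D f)).obj (listDiagram D l)).obj (curriedTensor C))

/-- The tensor product of cocones `s f`, as a cocone over `listProd K l`. -/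
def listCocone {D : ∀ f, K f ⥤ C} (s : ∀ f, Cocone (D f)) :
    ∀ l : List F, listDiagram D l ⟶ (Functor.const _).obj (tensorOver (fun f => (s f).pt) l)
  | [] => 𝟙 _
  | f :: l => ((curriedTensor C).mapCocone₂ (s f) ⟨_, listCocone s l⟩).ι

/-- A tensor product of colimits is a colimit over the product of the index categories: the tensor
product preserves colimits in each variable, and colimits over a product may be computed
successively. -/
theorem nonempty_isColimit_listCocone
    [∀ A : C, PreservesColimitsOfSize.{w, w} (tensorLeft A)]
    [∀ A : C, PreservesColimitsOfSize.{w, w} (tensorRight A)]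
    {D : ∀ f, K f ⥤ C} {s : ∀ f, Cocone (D f)} (hs : ∀ f, IsColimit (s f)) (l : List F) :
    Nonempty (IsColimit (⟨_, listCocone s l⟩ : Cocone (listDiagram D l))) := by
  induction l with
  | nil =>
    exact ⟨{ desc := fun c => c.ι.app ⟨⟨⟩⟩
             fac := fun c j => Category.id_comp _
             uniq := fun c m h => (Category.id_comp _).symm.trans (h ⟨⟨⟩⟩) }⟩
  | cons f l ih =>
    obtain ⟨ih⟩ := ih
    have : ∀ A : C, PreservesColimit (D f) ((curriedTensor C).flip.obj A) := fun A =>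
      inferInstanceAs (PreservesColimit (D f) (tensorRight A))
    have : ∀ A : C, PreservesColimit (listDiagram D l) ((curriedTensor C).obj A) := fun A =>
      inferInstanceAs (PreservesColimit (listDiagram D l) (tensorLeft A))
    have : PreservesColimit₂ (D f) (listDiagram D l) (curriedTensor C) :=
      PreservesColimit₂.of_preservesColimits_in_each_variable _
    exact ⟨isColimitOfPreserves₂ (curriedTensor C) (hs f) ih⟩

/-- Reading off the components of a family at the entries of a list. -/
def toListProd (K : F → Type w) [∀ f, Category.{w} (K f)] : ∀ l : List F, (∀ f, K f) ⥤ listProd K l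
  | [] => (Functor.const _).obj ⟨⟨⟩⟩
  | f :: l => (Pi.eval K f).prod' (toListProd K l)

/-- The functor sending a family `k` to the ordered tensor product of the `D (k f)`. -/
def tensorDiagram (D : ∀ f, K f ⥤ C) (l : List F) : (∀ f, K f) ⥤ C where
  obj k := tensorOver (fun f => (D f).obj (k f)) l
  map g := tensorMap (fun f => (D f).map (g f)) l
  map_id k := by
    simp only [Pi.id_apply, CategoryTheory.Functor.map_id]
    exact tensorMap_id _ l
  map_comp g g' := by
    rw [tensorMap_comp]
    simp only [Pi.comp_apply, Functor.map_comp]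

/-- The ordered tensor product of the cocones `s f`. -/
def tensorCocone {D : ∀ f, K f ⥤ C} (s : ∀ f, Cocone (D f)) (l : List F) :
    Cocone (tensorDiagram D l) where
  pt := tensorOver (fun f => (s f).pt) l
  ι :=
    { app := fun k => tensorMap (fun f => (s f).ι.app (k f)) l
      naturality := fun k k' g => by
        refine (tensorMap_comp _ _ l).trans (Eq.trans ?_ (Category.comp_id _).symm)
        congr 1
        funext f
        exact (s f).w (g f) }

theorem toListProd_obj_congr {l : List F} {k k' : ∀ f, K f} (h : ∀ f ∈ l, k f = k' f) :
    (toListProd K l).obj k = (toListProd K l).obj k' := by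
  induction l with
  | nil => rfl
  | cons f l ih =>
    exact Prod.ext (h f (by simp)) (ih fun f' hf' => h f' (by simp [hf']))

theorem toListProd_map_congr {l : List F} {k k' : ∀ f, K f} {g g' : k ⟶ k'}
    (h : ∀ f ∈ l, g f = g' f) : (toListProd K l).map g = (toListProd K l).map g' := by
  induction l with
  | nil => rfl
  | cons f l ih =>
    exact Prod.ext (h f (by simp)) (ih fun f' hf' => h f' (by simp [hf']))

theorem eq_of_toListProd_map_eq {l : List F} {k k' : ∀ f, K f} {g g' : k ⟶ k'}
    (h : (toListProd K l).map g = (toListProd K l).map g') : ∀ f ∈ l, g f = g' f := by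
  induction l with
  | nil => simp
  | cons f l ih =>
    intro f' hf'
    rcases List.mem_cons.1 hf' with rfl | hf'
    · exact congrArg Prod.fst h
    · exact ih (congrArg Prod.snd h) f' hf'

theorem nonempty_of_listProd {l : List F} (z : listProd K l) : ∀ f ∈ l, Nonempty (K f) := by
  induction l with
  | nil => simp
  | cons f l ih =>
    intro f' hf'
    rcases List.mem_cons.1 hf' with rfl | hf'
    · exact ⟨z.1⟩
    · exact ih z.2 f' hf'

theorem nonempty_of_listProd_hom {l : List F} {k k' : ∀ f, K f}
    (φ : (toListProd K l).obj k ⟶ (toListProd K l).obj k') : ∀ f ∈ l, Nonempty (k f ⟶ k' f) := by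
  induction l with
  | nil => simp
  | cons f l ih =>
    intro f' hf'
    rcases List.mem_cons.1 hf' with rfl | hf'
    · exact ⟨φ.1⟩
    · exact ih φ.2 f' hf'

open scoped Classical in
/-- Since `l` has no repetitions, the components of an object of `listProd K l` may be prescribed
independently; outside `l` the family takes the values of `k₀`. -/
theorem exists_toListProd_obj_eq {l : List F} (hl : l.Nodup) (k₀ : ∀ f, K f) (z : listProd K l) :
    ∃ k : ∀ f, K f, (toListProd K l).obj k = z := by
  induction l with
  | nil => exact ⟨k₀, rfl⟩
  | cons f l ih =>
    obtain ⟨k, hk⟩ := ih (List.nodup_cons.1 hl).2 z.2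
    refine ⟨Function.update k f z.1, Prod.ext (Function.update_self f z.1 k)
      (Eq.trans (toListProd_obj_congr fun f' hf' => ?_) hk)⟩
    exact Function.update_of_ne (ne_of_mem_of_not_mem hf' (List.nodup_cons.1 hl).1) _ _

open scoped Classical in
theorem exists_toListProd_map_eq {l : List F} (hl : l.Nodup) {k k' : ∀ f, K f} (g₀ : k ⟶ k')
    (φ : (toListProd K l).obj k ⟶ (toListProd K l).obj k') :
    ∃ g : k ⟶ k', (toListProd K l).map g = φ := by
  induction l with
  | nil => exact ⟨g₀, rfl⟩
  | cons f l ih =>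
    obtain ⟨g, hg⟩ := ih (List.nodup_cons.1 hl).2 φ.2
    refine ⟨Function.update g f φ.1, Prod.ext (Function.update_self (β := fun f => k f ⟶ k' f) f φ.1 g)
      (Eq.trans (toListProd_map_congr fun f' hf' => ?_) hg)⟩
    exact Function.update_of_ne (ne_of_mem_of_not_mem hf' (List.nodup_cons.1 hl).1) _ _

/-- If `l` enumerates `F` without repetitions, the product over `l` is the product over `F`. -/
theorem isEquivalence_toListProd {l : List F} (hl : l.Nodup) (h : ∀ f, f ∈ l) :
    (toListProd K l).IsEquivalence where
  faithful := ⟨fun e => funext fun f => eq_of_toListProd_map_eq e f (h f)⟩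
  full := ⟨fun φ =>
    exists_toListProd_map_eq hl (fun f => (nonempty_of_listProd_hom φ f (h f)).some) φ⟩
  essSurj := ⟨fun z => by
    obtain ⟨k, hk⟩ :=
      exists_toListProd_obj_eq hl (fun f => (nonempty_of_listProd z f (h f)).some) z
    exact ⟨k, ⟨eqToIso hk⟩⟩⟩

/-- The values of `listDiagram` are ordered tensor products. -/
def toListProdDiagramObj (D : ∀ f, K f ⥤ C) (k : ∀ f, K f) :
    ∀ l : List F, (listDiagram D l).obj ((toListProd K l).obj k) ≅
      tensorOver (fun f => (D f).obj (k f)) l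
  | [] => Iso.refl _
  | f :: l => whiskerLeftIso ((D f).obj (k f)) (toListProdDiagramObj D k l)

theorem tensorHom_eq_whisker_comp {A A' B B' E E' : C} (a : A ⟶ A') {b : B ⟶ B'} {i : B ⟶ E}
    {i' : B' ⟶ E'} {t : E ⟶ E'} (h : b ≫ i' = i ≫ t) :
    (a ▷ B ≫ A' ◁ b) ≫ A' ◁ i' = A ◁ i ≫ (a ⊗ₘ t) := by
  rw [Category.assoc, ← MonoidalCategory.whiskerLeft_comp, h, whiskerLeft_comp_tensorHom,
    MonoidalCategory.tensorHom_def]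

theorem toListProdDiagramObj_naturality (D : ∀ f, K f ⥤ C) {k k' : ∀ f, K f} (g : k ⟶ k')
    (l : List F) :
    (listDiagram D l).map ((toListProd K l).map g) ≫ (toListProdDiagramObj D k' l).hom =
      (toListProdDiagramObj D k l).hom ≫ tensorMap (fun f => (D f).map (g f)) l := by
  induction l with
  | nil => rfl
  | cons f l ih => exact tensorHom_eq_whisker_comp ((D f).map (g f)) ih

theorem toListProdDiagramObj_listCocone {D : ∀ f, K f ⥤ C} (s : ∀ f, Cocone (D f)) (k : ∀ f, K f)
    (l : List F) :
    (toListProdDiagramObj D k l).hom ≫ tensorMap (fun f => (s f).ι.app (k f)) l =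
      (listCocone s l).app ((toListProd K l).obj k) := by
  induction l with
  | nil => exact Category.id_comp _
  | cons f l ih =>
    refine (tensorHom_eq_whisker_comp ((s f).ι.app (k f)) (i' := 𝟙 _)
      ((Category.comp_id _).trans ih.symm)).symm.trans ?_
    rw [MonoidalCategory.whiskerLeft_id]
    exact Category.comp_id _

/-- If `l` enumerates `F` without repetitions, the ordered tensor product over `l` of colimit
cocones is a colimit cocone, because the tensor product preserves colimits in each variable. -/
theorem nonempty_isColimit_tensorCocone
    [∀ A : C, PreservesColimitsOfSize.{w, w} (tensorLeft A)]
    [∀ A : C, PreservesColimitsOfSize.{w, w} (tensorRight A)]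
    {D : ∀ f, K f ⥤ C} {s : ∀ f, Cocone (D f)} (hs : ∀ f, IsColimit (s f)) {l : List F}
    (hl : l.Nodup) (h : ∀ f, f ∈ l) : Nonempty (IsColimit (tensorCocone s l)) := by
  have := isEquivalence_toListProd (K := K) hl h
  obtain ⟨hc⟩ := nonempty_isColimit_listCocone hs l
  have hc' := (Functor.Final.isColimitWhiskerEquiv (toListProd K l) _).symm hc
  let α : toListProd K l ⋙ listDiagram D l ≅ tensorDiagram D l :=
    NatIso.ofComponents (fun k => toListProdDiagramObj D k l)
      fun g => toListProdDiagramObj_naturality D g l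
  refine ⟨(IsColimit.equivOfNatIsoOfIso α _ (tensorCocone s l)
    (Cocone.ext (Iso.refl _) fun k => ?_)) hc'⟩
  refine (Category.comp_id _).trans ((Iso.inv_comp_eq (toListProdDiagramObj D k l)).2 ?_)
  exact (toListProdDiagramObj_listCocone s k l).symm

end TensorColimit

/-! ### Relabelling and regrouping tensor factors -/

section Relabel

variable {C : Type u} [Category.{v} C] [MonoidalCategory C]

theorem isIso_tensorPull {F G : Type*} {X : F → C} {Y : G → C} (f : G → F)
    (h : ∀ g, X (f g) ⟶ Y g) [∀ g, IsIso (h g)] (l : List G) : IsIso (tensorPull f h l) := by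
  induction l with
  | nil => exact inferInstanceAs (IsIso (𝟙 _))
  | cons x l ih => exact inferInstanceAs (IsIso (h x ⊗ₘ tensorPull f h l))

theorem isIso_tensorFlat {F G : Type*} {X : F → C} {Y : G → C} (L : G → List F)
    (k : ∀ g, tensorOver X (L g) ⟶ Y g) [∀ g, IsIso (k g)] (l : List G) :
    IsIso (tensorFlat L k l) := by
  induction l with
  | nil => exact inferInstanceAs (IsIso (𝟙 _))
  | cons x l ih =>
    exact inferInstanceAs
      (IsIso ((tensorAppend X (L x) (flat L l)).hom ≫ (k x ⊗ₘ tensorFlat L k l)))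

variable [SymmetricCategory C]

theorem isIso_tensorOp {F G : Type*} {X : F → C} {Y : G → C} (L : G → List F)
    (k : ∀ g, tensorOver X (L g) ⟶ Y g) [∀ g, IsIso (k g)] {l : List F} {m : List G}
    (h : l.Perm (flat L m)) : IsIso (tensorOp L k h) := by
  have := isIso_tensorFlat L k m
  exact inferInstanceAs (IsIso ((tensorPerm X h).hom ≫ tensorFlat L k m))

theorem tensorPull_tensorOp {F G H : Type*} {X : F → C} {Y : G → C} {Z : H → C} {f : G → F}
    (hf : Function.Injective f) (h : ∀ g, X (f g) ⟶ Y g) {L : H → List G}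
    {k : ∀ x, tensorOver Y (L x) ⟶ Z x} {m : List G} {n : List H} (hm : m.Nodup)
    (p : m.Perm (flat L n)) (p' : (image f m).Perm (flat (fun x => image f (L x)) n)) :
    tensorPull f h m ≫ tensorOp L k p =
      tensorOp (fun x => image f (L x)) (fun x => tensorPull f h (L x) ≫ k x) p' := by
  have q := image_perm f p
  have q' : (image f (flat L n)).Perm (flat (fun x => image f (L x)) n) := q.symm.trans p'
  rw [tensorOp, tensorOp, ← reassoc_of% tensorPull_perm hf h hm p q,
    tensorPull_flat f h L k n q', tensorPerm_trans_assoc]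

theorem tensorOp_perm {F G : Type*} {X : F → C} {Y : G → C} {L : G → List F}
    {k : ∀ g, tensorOver X (L g) ⟶ Y g} {l : List F} {m n : List G} (hl : l.Nodup) (hm : m.Nodup)
    (p : l.Perm (flat L m)) (q : m.Perm n) (p' : l.Perm (flat L n)) :
    tensorOp L k p ≫ (tensorPerm Y q).hom = tensorOp L k p' := by
  have e := flat_perm (fun g => List.Perm.refl (L g)) q
  rw [tensorOp, tensorOp, Category.assoc, ← tensorFlat_perm k q hm (p.nodup_iff.1 hl) e,
    tensorPerm_trans_assoc]

theorem tensorOp_map {F G : Type*} {X : F → C} {Y Z : G → C} {L : G → List F}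
    {k : ∀ g, tensorOver X (L g) ⟶ Y g} (h : ∀ g, Y g ⟶ Z g) {l : List F} {m : List G}
    (p : l.Perm (flat L m)) :
    tensorOp L k p ≫ tensorMap h m = tensorOp L (fun g => k g ≫ h g) p := by
  rw [tensorOp, tensorOp, Category.assoc, tensorFlat_map]

theorem tensorOp_singleton {F G : Type*} {X : F → C} {Y : G → C} {L : G → List F}
    {k : ∀ g, tensorOver X (L g) ⟶ Y g} {l : List F} {g : G} (p : l.Perm (flat L [g]))
    (p' : l.Perm (L g)) :
    tensorOp L k p ≫ (ρ_ (Y g)).hom = (tensorPerm X p').hom ≫ k g := by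
  have q : (L g).Perm (append (L g) []) := by rw [append_nil]
  have e : tensorOp L k p = (tensorPerm X p').hom ≫ (tensorPerm X q).hom ≫
      (tensorAppend X (L g) []).hom ≫ (k g ⊗ₘ 𝟙 _) := by
    rw [tensorPerm_trans_assoc]; rfl
  rw [e, reassoc_of% tensorAppend_nil X _ q, tensorHom_id, Category.assoc, Category.assoc,
    rightUnitor_naturality, Iso.inv_hom_id_assoc]

end Relabel

/-! ### Grafting coloured operations -/

section Graft

variable {J I : Type w} {S : PolynomialMonad J} {T : PolynomialMonad I}
variable {Φ : CartesianMorphism S T} {i : I}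

/-- The `J`-coloured operation `c` is the composite of the operation `b` of `T` with the
`J`-coloured operations `k e`, its colours being those of the `k e`. Stating this as a property of
`c`, rather than working with one fixed composite, makes it possible to replace `c` freely by an
equal coloured operation. -/
structure IsGraft (b : T.B) (k : ∀ e : T.Fiber b, Classifier Φ (T.s e.1)) (c : Classifier Φ i) :
    Prop where
  b_eq : T.subst b (fun e => (k e).b) (fun e => (k e).t_b) = c.b
  col_eq : ∀ (e : T.Fiber b) (x : T.Fiber (k e).b),
    c.col ⟨(T.substE b (fun e => (k e).b) (fun e => (k e).t_b) e x).1,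
      (T.substE b (fun e => (k e).b) (fun e => (k e).t_b) e x).2.trans b_eq⟩ = (k e).col x

namespace IsGraft

variable {b : T.B} {k : ∀ e : T.Fiber b, Classifier Φ (T.s e.1)} {c : Classifier Φ i}

/-- The inclusion of the inputs of `k e` into the inputs of the composite. -/
def emb (h : IsGraft b k c) (e : T.Fiber b) (x : T.Fiber (k e).b) : T.Fiber c.b :=
  ⟨_, (T.substE b (fun e => (k e).b) (fun e => (k e).t_b) e x).2.trans h.b_eq⟩

theorem col_emb (h : IsGraft b k c) (e : T.Fiber b) (x : T.Fiber (k e).b) :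
    c.col (h.emb e x) = (k e).col x := h.col_eq e x

theorem exists_emb (h : IsGraft b k c) (y : T.Fiber c.b) : ∃ e x, h.emb e x = y := by
  obtain ⟨e, x, hx⟩ := T.exists_substE (b := b) (f := fun e => (k e).b)
    (hf := fun e => (k e).t_b) ⟨y.1, y.2.trans h.b_eq.symm⟩
  have hx' := Subtype.ext_iff.1 hx
  exact ⟨e, x, Subtype.ext hx'⟩

theorem emb_inj (h : IsGraft b k c) {e e' : T.Fiber b} {x : T.Fiber (k e).b}
    {x' : T.Fiber (k e').b} (hx : h.emb e x = h.emb e' x') :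
    (⟨e, x⟩ : Σ e, T.Fiber (k e).b) = ⟨e', x'⟩ := by
  have hx' := Subtype.ext_iff.1 hx
  exact T.substE_inj (f := fun e => (k e).b) (hf := fun e => (k e).t_b) hx'

theorem emb_injective (h : IsGraft b k c) (e : T.Fiber b) : Function.Injective (h.emb e) :=
  fun x x' hx => by simpa using h.emb_inj hx

theorem isOrdering (h : IsGraft b k c) {l : List (T.Fiber b)} (hl : IsOrdering T l)
    {m : ∀ e, List (T.Fiber (k e).b)} (hm : ∀ e, IsOrdering T (m e)) :
    IsOrdering T (flat (fun e => image (h.emb e) (m e)) l) := by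
  refine ⟨nodup_flat_image _ (fun e e' x x' hx => h.emb_inj hx) hl.1 fun e => (hm e).1,
    fun y => ?_⟩
  obtain ⟨e, x, rfl⟩ := h.exists_emb y
  exact mem_flat_image (hl.2 e) ((hm e).2 x)

theorem ordering_perm (h : IsGraft b k c) {l : List (T.Fiber b)} (hl : IsOrdering T l) :
    (ordering T c.b).Perm (flat (fun e => image (h.emb e) (ordering T (k e).b)) l) :=
  (isOrdering_ordering T _).perm (h.isOrdering hl fun _ => isOrdering_ordering T _)

theorem unique {c c' : Classifier Φ i} (h : IsGraft b k c) (h' : IsGraft b k c') : c = c' := by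
  obtain ⟨cb, ct, ccol, cδ⟩ := c
  obtain ⟨cb', ct', ccol', cδ'⟩ := c'
  obtain rfl : cb = cb' := h.b_eq.symm.trans h'.b_eq
  obtain rfl : ccol = ccol' := funext fun y => by
    obtain ⟨e, x, rfl⟩ := h.exists_emb y
    exact (h.col_emb e x).trans (h'.col_emb e x).symm
  rfl

/-- The inputs of the composite are the pairs of an input `e` of `b` and an input of `k e`. -/
noncomputable def embEquiv (h : IsGraft b k c) : (Σ e, T.Fiber (k e).b) ≃ T.Fiber c.b :=
  Equiv.ofBijective (fun z => h.emb z.1 z.2) ⟨fun _ _ hz => h.emb_inj hz, fun y => by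
    obtain ⟨e, x, hx⟩ := h.exists_emb y
    exact ⟨⟨e, x⟩, hx⟩⟩

theorem embEquiv_symm_emb (h : IsGraft b k c) (e : T.Fiber b) (x : T.Fiber (k e).b) :
    h.embEquiv.symm (h.emb e x) = ⟨e, x⟩ := h.embEquiv.symm_apply_apply ⟨e, x⟩

section Map

variable {k' : ∀ e : T.Fiber b, Classifier Φ (T.s e.1)} {c' : Classifier Φ i}

/-- The operations of `S` in the morphism of composites induced by morphisms `k e ⟶ k' e`. -/
noncomputable def mapD (h' : IsGraft b k' c') (g : ∀ e, Classifier.Hom (k e) (k' e))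
    (y : T.Fiber c'.b) : S.B :=
  (g (h'.embEquiv.symm y).1).d (h'.embEquiv.symm y).2

variable (h : IsGraft b k c) (h' : IsGraft b k' c') (g : ∀ e, Classifier.Hom (k e) (k' e))

theorem mapD_emb (e : T.Fiber b) (x : T.Fiber (k' e).b) :
    h'.mapD g (h'.emb e x) = (g e).d x := by
  rw [mapD, embEquiv_symm_emb]

theorem t_mapD (y : T.Fiber c'.b) : S.t (h'.mapD g y) = c'.col y := by
  obtain ⟨e, x, rfl⟩ := h'.exists_emb y
  rw [mapD_emb, (g e).t_d, h'.col_emb]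

theorem t_onB_mapD (y : T.Fiber c'.b) : T.t (Φ.onB (h'.mapD g y)) = T.s y.1 := by
  rw [Φ.t_onB, t_mapD, c'.δ_col]

theorem t_onB_mapD' (y : T.Fiber (T.subst b (fun e => (k' e).b) fun e => (k' e).t_b)) :
    T.t (Φ.onB (h'.mapD g ⟨y.1, y.2.trans h'.b_eq⟩)) = T.s y.1 := t_onB_mapD h' g _

theorem subst_mapD (e : T.Fiber b) :
    T.subst (k' e).b (fun x => Φ.onB (h'.mapD g (h'.emb e x)))
      (fun x => (t_onB_mapD h' g _).trans
        (T.s_substE b (fun e => (k' e).b) (fun e => (k' e).t_b) e x)) = (k e).b :=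
  (T.subst_congr rfl _ (g e).t_onB_d fun x => congrArg Φ.onB (mapD_emb h' g e x)).trans (g e).b_eq

theorem mapD_b_eq (h : IsGraft b k c) :
    T.subst c'.b (fun y => Φ.onB (h'.mapD g y)) (t_onB_mapD h' g) = c.b := by
  rw [← h.b_eq]
  refine (T.subst_congr h'.b_eq.symm _ (t_onB_mapD' h' g) fun _ => rfl).trans ?_
  refine (T.subst_subst b _ _ (fun y => Φ.onB (h'.mapD g ⟨y.1, y.2.trans h'.b_eq⟩)) _).trans ?_
  exact T.subst_congr rfl _ _ (subst_mapD h' g)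

theorem mapD_substE (e : T.Fiber b) (x : T.Fiber (k' e).b)
    (z : S.Fiber (h'.mapD g (h'.emb e x))) :
    (T.substE c'.b (fun y => Φ.onB (h'.mapD g y)) (t_onB_mapD h' g) (h'.emb e x) (Φ.fib z)).1 =
      (h.emb e ((g e).emb x ⟨z.1, z.2.trans (mapD_emb h' g e x)⟩)).1 := by
  have e1 := T.subst_substE b _ (fun e => (k' e).t_b)
    (fun y => Φ.onB (h'.mapD g ⟨y.1, y.2.trans h'.b_eq⟩)) (t_onB_mapD' h' g) e x (Φ.fib z)
  refine (T.substE_congr h'.b_eq.symm _ (t_onB_mapD' h' g) (fun _ => rfl) rfl rfl).trans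
    (e1.trans ?_)
  refine T.substE_congr rfl _ _ (subst_mapD h' g) rfl ?_
  exact T.substE_congr rfl _ (g e).t_onB_d (fun x => congrArg Φ.onB (mapD_emb h' g e x)) rfl rfl

/-- The morphism of composites induced by morphisms `k e ⟶ k' e`. -/
noncomputable def map : Classifier.Hom c c' where
  d := h'.mapD g
  t_d := t_mapD h' g
  b_eq := mapD_b_eq h' g h
  col_eq y z := by
    obtain ⟨e, x, rfl⟩ := h'.exists_emb y
    refine Eq.trans ?_ ((g e).col_emb x ⟨z.1, z.2.trans (mapD_emb h' g e x)⟩)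
    rw [← h.col_emb]
    congr 1
    exact Subtype.ext (mapD_substE h h' g e x z)

theorem map_emb (e : T.Fiber b) (x : T.Fiber (k' e).b) (z : S.Fiber (h'.mapD g (h'.emb e x))) :
    (map h h' g).emb (h'.emb e x) z =
      h.emb e ((g e).emb x ⟨z.1, z.2.trans (mapD_emb h' g e x)⟩) :=
  Subtype.ext (mapD_substE h h' g e x z)

end Map

end IsGraft

/-- The composite of the operation `b` of `T` with the `J`-coloured operations `k e`. -/
noncomputable def graft (b : T.B) (hb : T.t b = i) (k : ∀ e : T.Fiber b, Classifier Φ (T.s e.1)) :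
    Classifier Φ i where
  b := T.subst b (fun e => (k e).b) (fun e => (k e).t_b)
  t_b := (T.t_subst _ _ _).trans hb
  col y := (k (T.exists_substE y).choose).col (T.exists_substE y).choose_spec.choose
  δ_col y := by
    rw [(k _).δ_col]
    exact (T.s_substE b _ (fun e => (k e).t_b) _ _).symm.trans
      (congrArg (fun y : T.Fiber _ => T.s y.1) (T.exists_substE y).choose_spec.choose_spec)

theorem isGraft_graft (b : T.B) (hb : T.t b = i)
    (k : ∀ e : T.Fiber b, Classifier Φ (T.s e.1)) : IsGraft b k (graft b hb k) where
  b_eq := rfl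
  col_eq e x := by
    have hy := (T.exists_substE (T.substE b (fun e => (k e).b)
      (fun e => (k e).t_b) e x)).choose_spec.choose_spec
    have h := T.substE_inj (congrArg Subtype.val hy)
    exact congrArg (fun z : Σ e, T.Fiber (k e).b => (k z.1).col z.2) h

end Graft

/-! ### Tensor products over composite operations -/

section Split

variable {J I : Type w} {S : PolynomialMonad J} {T : PolynomialMonad I}
variable {Φ : CartesianMorphism S T} {i : I}
variable {C : Type u} [Category.{v} C] [MonoidalCategory C] [SymmetricCategory C]

theorem tensorPerm_tensorOp {F G : Type*} {X : F → C} {Y : G → C} {L : G → List F}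
    {k : ∀ g, tensorOver X (L g) ⟶ Y g} {l l' : List F} {m : List G} (h : l.Perm l')
    (p : l'.Perm (flat L m)) :
    (tensorPerm X h).hom ≫ tensorOp L k p = tensorOp L k (h.trans p) := by
  rw [tensorOp, tensorPerm_trans_assoc]; rfl

theorem image_ordering_congr (U : PolynomialMonad I) {F : Type*} {d d' : U.B} (hd : d = d')
    {κ : U.Fiber d → F} {κ' : U.Fiber d' → F} (hκ : ∀ z, κ z = κ' ⟨z.1, z.2.trans hd⟩) :
    image κ (ordering U d) = image κ' (ordering U d') := by
  subst hd
  obtain rfl : κ = κ' := funext hκ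
  rfl

/-- The value at `c` of the functor represented by an `S`-algebra, in reducible form. -/
@[reducible] noncomputable def tildeObj (A : Algebra S C) (c : Classifier Φ i) : C :=
  tensorOver (fun e => A.obj (c.col e)) (ordering T c.b)

namespace IsGraft

variable {b : T.B} {k : ∀ e : T.Fiber b, Classifier Φ (T.s e.1)} {c : Classifier Φ i}
variable (A : Algebra S C)

/-- The identification of a block of factors of the tensor product over a composite operation. -/
noncomputable def block (h : IsGraft b k c) (e : T.Fiber b) :
    tensorOver (fun y => A.obj (c.col y)) (image (h.emb e) (ordering T (k e).b)) ⟶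
      tildeObj A (k e) :=
  tensorPull (h.emb e) (fun x => eqToHom (congrArg A.obj (h.col_emb e x))) (ordering T (k e).b)

/-- The tensor product over a composite operation is the tensor product of the tensor products
over its constituents. -/
noncomputable def split (h : IsGraft b k c) {l : List (T.Fiber b)} (hl : IsOrdering T l) :
    tildeObj A c ⟶ tensorOver (fun e => tildeObj A (k e)) l :=
  tensorOp (fun e => image (h.emb e) (ordering T (k e).b)) (h.block A) (h.ordering_perm hl)

instance (h : IsGraft b k c) {l : List (T.Fiber b)} (hl : IsOrdering T l) :
    IsIso (h.split A hl) := by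
  have : ∀ e, IsIso (h.block A e) := fun e => isIso_tensorPull _ _ _
  exact isIso_tensorOp _ _ _

theorem split_perm (h : IsGraft b k c) {l l' : List (T.Fiber b)} (hl : IsOrdering T l)
    (hl' : IsOrdering T l') :
    h.split A hl ≫ (tensorPerm _ (hl.perm hl')).hom = h.split A hl' :=
  tensorOp_perm (isOrdering_ordering T c.b).1 hl.1 _ _ _

/-- The isomorphism `split` is natural in the coloured operations `k e`; this makes the action on
the colimits well defined. -/
theorem tildeMap_split {k' : ∀ e : T.Fiber b, Classifier Φ (T.s e.1)} {c' : Classifier Φ i}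
    (h : IsGraft b k c) (h' : IsGraft b k' c') (g : ∀ e, Classifier.Hom (k e) (k' e))
    {l : List (T.Fiber b)} (hl : IsOrdering T l) :
    tildeMap A (map h h' g) ≫ h'.split A hl =
      h.split A hl ≫ tensorMap (fun e => tildeMap A (g e)) l := by
  have hn : ∀ e, (image (h.emb e) (ordering T (k e).b)).Nodup := fun e =>
    nodup_image (h.emb_injective e) (isOrdering_ordering T _).1
  let M := map h h' g
  -- the two ways of listing the block of factors that belongs to `e`
  have q1 : ∀ e, (flat (fun y => image (M.emb y) (ordering S (M.d y)))
      (image (h'.emb e) (ordering T (k' e).b))).Perm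
        (flat (fun x => image (M.emb (h'.emb e x)) (ordering S (M.d (h'.emb e x))))
          (ordering T (k' e).b)) := fun e => by
    rw [flat_eq, flat_eq, image_eq]; simp [List.flatMap_map]
  have q2 : ∀ e x, (image (M.emb (h'.emb e x)) (ordering S (M.d (h'.emb e x)))).Perm
      (image (h.emb e) (image ((g e).emb x) (ordering S ((g e).d x)))) := fun e x => by
    have q0 : (image (fun z => h.emb e ((g e).emb x z)) (ordering S ((g e).d x))).Perm
        (image (h.emb e) (image ((g e).emb x) (ordering S ((g e).d x)))) := by
      simp [image_eq]; exact List.Perm.refl _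
    exact (List.Perm.of_eq (image_ordering_congr S (κ := M.emb (h'.emb e x))
      (κ' := fun z => h.emb e ((g e).emb x z)) (mapD_emb h' g e x)
      fun z => map_emb h h' g e x z)).trans q0
  have q3 : ∀ e, (image (h.emb e) (ordering T (k e).b)).Perm
      (flat (fun x => image (h.emb e) (image ((g e).emb x) (ordering S ((g e).d x))))
        (ordering T (k' e).b)) := fun e => by
    refine (image_perm (h.emb e) (g e).ordering_perm).trans ?_
    simp [image_eq, flat_eq, List.map_flatMap]
  have q4 : ∀ e, (flat (fun y => image (M.emb y) (ordering S (M.d y)))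
      (image (h'.emb e) (ordering T (k' e).b))).Perm
        (image (h.emb e) (ordering T (k e).b)) := fun e =>
    ((q1 e).trans (flat_perm (q2 e) (List.Perm.refl _))).trans (q3 e).symm
  have q5 : (ordering T c.b).Perm (flat (fun e => flat (fun y => image (M.emb y)
      (ordering S (M.d y))) (image (h'.emb e) (ordering T (k' e).b))) l) :=
    (h.ordering_perm hl).trans (flat_perm (fun e => (q4 e).symm) (List.Perm.refl _))
  rw [tildeMap, split, split, tensorOp_map,
    tensorOp_comp _ _ (isOrdering_ordering T c.b).1 (isOrdering_ordering T c'.b).1 q5]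
  refine tensorOp_congr q4 (fun e => (q4 e).nodup_iff.2 (hn e)) (fun e => ?_) _ _
  rw [block, block, tensorFlat_pull _ _ _ _ _ (q1 e), tildeMap,
    tensorPull_tensorOp (h.emb_injective e) _ (isOrdering_ordering T _).1 _ (q3 e),
    tensorPerm_tensorOp]
  refine tensorOp_congr (q2 e) (fun x => ?_) (fun x => ?_) (q1 e) _
  · exact nodup_image (M.emb_injective _) (isOrdering_ordering S _).1
  · have q6 : (image (h.emb e) (image ((g e).emb x) (ordering S ((g e).d x)))).Perm
        (image (fun z => h.emb e ((g e).emb x z)) (ordering S ((g e).d x))) := by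
      simp [image_eq]; exact List.Perm.refl _
    rw [tensorPull_actOn A (nodup_image ((g e).emb_injective x) (isOrdering_ordering S _).1)
      (h.emb_injective e) _ q6, A.perm_actOn, A.actOn_comp_eqToHom]
    exact A.actOn_congr (mapD_emb h' g e x) fun z => map_emb h h' g e x z

end IsGraft

theorem tensorPull_congr {F G : Type*} {X : F → C} {Y : G → C} {f f' : G → F}
    (hf : ∀ g, f g = f' g) (hX : ∀ g, X (f g) = Y g) (hX' : ∀ g, X (f' g) = Y g) {l : List G}
    (p : (image f l).Perm (image f' l)) :
    tensorPull f (fun g => eqToHom (hX g)) l =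
      (tensorPerm X p).hom ≫ tensorPull f' (fun g => eqToHom (hX' g)) l := by
  obtain rfl : f = f' := funext hf
  rw [tensorPerm_refl, Category.id_comp]

theorem tensorPull_eq_id {F : Type*} {X : F → C} {f : F → F} (hf : ∀ x, f x = x)
    (hX : ∀ x, X (f x) = X x) {l : List F} (p : l.Perm (image f l)) :
    (tensorPerm X p).hom ≫ tensorPull f (fun x => eqToHom (hX x)) l = 𝟙 _ := by
  obtain rfl : f = fun x => x := funext hf
  induction l with
  | nil => rw [tensorPerm_refl]; exact Category.id_comp _
  | cons x l ih =>
    have p' : l.Perm (image (fun x => x) l) := by rw [image_eq, List.map_id']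
    rw [tensorPerm_cons X x p']
    simp only [tensorPull, eqToHom_refl] at ih ⊢
    rw [whiskerLeft_comp_tensorHom, ih]
    simp

/-- A coloured operation over `i`, seen over an equal colour. Only a proof changes, so that the
tensor product over its inputs is definitionally the same. -/
@[reducible] def Classifier.cast {i i' : I} (c : Classifier Φ i) (h : i = i') : Classifier Φ i' where
  b := c.b
  t_b := c.t_b.trans h
  col := c.col
  δ_col := c.δ_col

namespace IsGraft

theorem one_family_eq (k : ∀ e : T.Fiber (T.one i), Classifier Φ (T.s e.1)) :
    (∀ e, (k e).b = (k (T.oneE i)).b) ∧ T.t (k (T.oneE i)).b = i :=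
  ⟨fun e => by rw [T.eq_oneE e], (k _).t_b.trans (T.s_oneE i)⟩

theorem coe_substE_one (k : ∀ e : T.Fiber (T.one i), Classifier Φ (T.s e.1))
    (x : T.Fiber (k (T.oneE i)).b) :
    (T.substE (T.one i) (fun e => (k e).b) (fun e => (k e).t_b) (T.oneE i) x).1 = x.1 := by
  obtain ⟨h1, h2⟩ := one_family_eq k
  have h3 : T.one i = T.one (T.t (k (T.oneE i)).b) := by rw [h2]
  have h4 : (T.oneE i).1 = (T.oneE (T.t (k (T.oneE i)).b)).1 := by rw [h2]
  exact (T.substE_congr h3 _ _ h1 h4 rfl).trans (T.one_substE (k (T.oneE i)).b x)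

/-- Grafting a coloured operation onto a unit operation returns this coloured operation. -/
theorem one (k : ∀ e : T.Fiber (T.one i), Classifier Φ (T.s e.1)) :
    IsGraft (T.one i) k ((k (T.oneE i)).cast (T.s_oneE i)) where
  b_eq := by
    obtain ⟨h1, h2⟩ := one_family_eq k
    have h3 : T.one i = T.one (T.t (k (T.oneE i)).b) := by rw [h2]
    exact (T.subst_congr h3 _ _ h1).trans (T.one_subst (k (T.oneE i)).b)
  col_eq e x := by
    obtain rfl := T.eq_oneE e
    exact congrArg (k (T.oneE i)).col (Subtype.ext (coe_substE_one k x))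

theorem one_emb (k : ∀ e : T.Fiber (T.one i), Classifier Φ (T.s e.1))
    (x : T.Fiber (k (T.oneE i)).b) : (one k).emb (T.oneE i) x = x :=
  Subtype.ext (coe_substE_one k x)

theorem split_one (A : Algebra S C) (k : ∀ e : T.Fiber (T.one i), Classifier Φ (T.s e.1)) :
    (one k).split A (isOrdering_one T i) ≫ (ρ_ _).hom = 𝟙 _ := by
  let c := k (T.oneE i)
  have p : (ordering T c.b).Perm (image ((one k).emb (T.oneE i)) (ordering T c.b)) := by
    rw [show (one k).emb (T.oneE i) = fun x => x from funext (one_emb k), image_eq, List.map_id']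
  have e := tensorPull_eq_id (X := fun y => A.obj (c.col y)) (one_emb k)
    (fun x => congrArg A.obj ((one k).col_emb _ x)) p
  exact (tensorOp_singleton ((one k).ordering_perm (isOrdering_one T i)) p).trans e

section Assoc

variable {b : T.B} {f : T.Fiber b → T.B} {hf : ∀ e, T.t (f e) = T.s e.1}
variable (k : ∀ y : T.Fiber (T.subst b f hf), Classifier Φ (T.s y.1))

/-- The family `k`, restricted to the inputs of the composite `b(f)` that belong to `e`. -/
@[reducible] def restr (e : T.Fiber b) (x : T.Fiber (f e)) : Classifier Φ (T.s x.1) :=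
  (k (T.substE b f hf e x)).cast (T.s_substE b f hf e x)

/-- The composites of the `f e` with the members of the family `k` that belong to `e`. -/
@[reducible] noncomputable def inner (e : T.Fiber b) : Classifier Φ (T.s e.1) :=
  graft (f e) (hf e) (restr k e)

variable {k} {c : Classifier Φ i}

theorem coe_substE_inner (e : T.Fiber b) (x : T.Fiber (f e))
    (z : T.Fiber (k (T.substE b f hf e x)).b) :
    (T.substE b (fun e => (inner k e).b) (fun e => (inner k e).t_b) e
      ((isGraft_graft (f e) (hf e) (restr k e)).emb x z)).1 =
    (T.substE (T.subst b f hf) (fun y => (k y).b) (fun y => (k y).t_b)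
      (T.substE b f hf e x) z).1 :=
  (T.subst_substE b f hf (fun y => (k y).b) (fun y => (k y).t_b) e x z).symm

/-- Grafting is associative. -/
theorem assoc (h : IsGraft (T.subst b f hf) k c) : IsGraft b (inner k) c where
  b_eq := (T.subst_subst b f hf (fun y => (k y).b) (fun y => (k y).t_b)).symm.trans h.b_eq
  col_eq e y := by
    obtain ⟨x, z, rfl⟩ := (isGraft_graft (f e) (hf e) (restr k e)).exists_emb y
    rw [(isGraft_graft (f e) (hf e) (restr k e)).col_emb]
    refine Eq.trans ?_ (h.col_emb (T.substE b f hf e x) z)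
    exact congrArg c.col (Subtype.ext (coe_substE_inner e x z))

theorem assoc_emb (h : IsGraft (T.subst b f hf) k c) (e : T.Fiber b) (x : T.Fiber (f e))
    (z : T.Fiber (k (T.substE b f hf e x)).b) :
    h.assoc.emb e ((isGraft_graft (f e) (hf e) (restr k e)).emb x z) =
      h.emb (T.substE b f hf e x) z :=
  Subtype.ext (coe_substE_inner e x z)

/-- Splitting a composite of `b(f)` over the inputs of `b(f)` and regrouping these inputs by the
inputs of `b` is splitting it over the inputs of `b`. -/
theorem split_assoc (A : Algebra S C) (h : IsGraft (T.subst b f hf) k c) {l : List (T.Fiber b)}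
    (hl : IsOrdering T l) {m : ∀ e, List (T.Fiber (f e))} (hm : ∀ e, IsOrdering T (m e)) :
    h.split A (hl.subst hm) ≫ tensorFlat (X := fun y => tildeObj A (k y))
      (Y := fun e => tildeObj A (inner k e)) (fun e => image (T.substE b f hf e) (m e))
      (fun e => tensorPull (Y := fun x => tildeObj A (restr k e x)) (T.substE b f hf e)
        (fun x => 𝟙 (tildeObj A (restr k e x))) (m e) ≫
        inv ((isGraft_graft (f e) (hf e) (restr k e)).split A (hm e))) l =
    h.assoc.split A hl := by
  let hg e := isGraft_graft (f e) (hf e) (restr k e)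
  have q1 : ∀ e, (flat (fun y => image (h.emb y) (ordering T (k y).b))
      (image (T.substE b f hf e) (m e))).Perm
        (flat (fun x => image (h.emb (T.substE b f hf e x)) (ordering T (restr k e x).b))
          (m e)) := fun e => by
    rw [flat_eq, flat_eq, image_eq]; simp [List.flatMap_map]
  have q0 : ∀ e x, (image (h.assoc.emb e) (image ((hg e).emb x) (ordering T (restr k e x).b))).Perm
      (image (fun z => h.assoc.emb e ((hg e).emb x z)) (ordering T (restr k e x).b)) :=
    fun e x => by simp [image_eq]; exact List.Perm.refl _
  have q0' : ∀ e x, (image (h.emb (T.substE b f hf e x)) (ordering T (restr k e x).b)).Perm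
      (image (fun z => h.assoc.emb e ((hg e).emb x z)) (ordering T (restr k e x).b)) :=
    fun e x => by
      rw [show (fun z => h.assoc.emb e ((hg e).emb x z)) = h.emb (T.substE b f hf e x) from
        funext (h.assoc_emb e x)]
  have q2 := fun e x => (q0' e x).trans (q0 e x).symm
  have q3 : ∀ e, (image (h.assoc.emb e) (ordering T (inner k e).b)).Perm
      (flat (fun x => image (h.assoc.emb e) (image ((hg e).emb x) (ordering T (restr k e x).b)))
        (m e)) := fun e => by
    refine (image_perm (h.assoc.emb e) ((hg e).ordering_perm (hm e))).trans ?_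
    simp [image_eq, flat_eq, List.map_flatMap]
  have q4 := fun e => ((q1 e).trans (flat_perm (q2 e) (List.Perm.refl _))).trans (q3 e).symm
  have hn : ∀ e, (image (h.assoc.emb e) (ordering T (inner k e).b)).Nodup := fun e =>
    nodup_image (h.assoc.emb_injective e) (isOrdering_ordering T _).1
  rw [split, split, tensorFlat_eq_op, tensorOp_comp _ _ (isOrdering_ordering T c.b).1 (hl.subst hm).1
    ((h.assoc.ordering_perm hl).trans
      (flat_perm (fun e => (q4 e).symm) (List.Perm.refl _)))]
  refine tensorOp_congr q4 (fun e => (q4 e).nodup_iff.2 (hn e)) (fun e => ?_) _ _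
  rw [← Category.assoc, IsIso.comp_inv_eq, Category.assoc, block, split,
    tensorFlat_pull _ _ _ _ _ (q1 e),
    tensorPull_tensorOp (h.assoc.emb_injective e) _ (isOrdering_ordering T _).1 _ (q3 e),
    tensorPerm_tensorOp]
  refine tensorOp_congr (q2 e) (fun x => ?_) (fun x => ?_) (q1 e) _
  · exact nodup_image (h.emb_injective _) (isOrdering_ordering T _).1
  · rw [block, block, tensorPull_pull _ _ _ _ _ (q0 e x), tensorPerm_trans_assoc, Category.comp_id]
    simp only [eqToHom_trans]
    exact tensorPull_congr (fun z => (h.assoc_emb e x z).symm) _ _ _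

end Assoc

end IsGraft
end Split

/-! ### The free algebra -/

section Free

variable {J I : Type w} {S : PolynomialMonad J} {T : PolynomialMonad I}
variable {C : Type u} [Category.{v} C] [MonoidalCategory C] [SymmetricCategory C]
variable [HasColimitsOfSize.{w, w} C]

/-- The colimit over the classifier of the functor represented by an `S`-algebra. -/
noncomputable def freeObj (A : Algebra S C) (Φ : CartesianMorphism S T) (i : I) : C :=
  colimit (tilde A Φ i)

variable {Φ : CartesianMorphism S T} {i : I} (A : Algebra S C)

/-- The component of the colimit cocone at a coloured operation. -/
noncomputable def freeι (c : Classifier Φ i) : tildeObj A c ⟶ freeObj A Φ i :=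
  colimit.ι (tilde A Φ i) c

theorem tildeMap_freeι {c' c : Classifier Φ i} (f : Classifier.Hom c' c) :
    tildeMap A f ≫ freeι A c = freeι A c' :=
  colimit.w (tilde A Φ i) (show c' ⟶ c from f)

theorem freeι_cast (c : Classifier Φ i) {i' : I} (h : i = i') :
    freeι A (c.cast h) = freeι A c ≫ eqToHom (congrArg (freeObj A Φ) h) := by
  subst h
  simp

theorem free_hom_ext {Z : C} {f g : freeObj A Φ i ⟶ Z}
    (h : ∀ c : Classifier Φ i, freeι A c ≫ f = freeι A c ≫ g) : f = g :=
  colimit.hom_ext h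

/-- The action of `b` on the components at coloured operations `k e`: it lands in the component at
the composite of `b` with the `k e`. -/
noncomputable def freeActι {b : T.B} {l : List (T.Fiber b)} (hl : IsOrdering T l)
    (k : ∀ e : T.Fiber b, Classifier Φ (T.s e.1)) :
    tensorOver (fun e => tildeObj A (k e)) l ⟶ freeObj A Φ (T.t b) :=
  inv ((isGraft_graft b rfl k).split A hl) ≫ freeι A (graft b rfl k)

theorem split_freeActι {b : T.B} {l : List (T.Fiber b)} (hl : IsOrdering T l)
    (k : ∀ e : T.Fiber b, Classifier Φ (T.s e.1)) :
    (isGraft_graft b rfl k).split A hl ≫ freeActι A hl k = freeι A (graft b rfl k) := by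
  rw [freeActι, IsIso.hom_inv_id_assoc]

theorem tensorMap_freeActι {b : T.B} {k k' : ∀ e : T.Fiber b, Classifier Φ (T.s e.1)}
    (g : ∀ e, Classifier.Hom (k e) (k' e)) {l : List (T.Fiber b)} (hl : IsOrdering T l) :
    tensorMap (fun e => tildeMap A (g e)) l ≫ freeActι A hl k' = freeActι A hl k := by
  have e := (isGraft_graft b rfl k).tildeMap_split A (isGraft_graft b rfl k') g hl
  rw [← cancel_epi ((isGraft_graft b rfl k).split A hl), ← reassoc_of% e, split_freeActι,
    split_freeActι, tildeMap_freeι]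

/-- The cocone whose descent is the action of `b` on the colimits. -/
noncomputable def freeActCocone (b : T.B) (l : List (T.Fiber b)) (hl : IsOrdering T l) :
    Cocone (tensorDiagram (fun e : T.Fiber b => tilde A Φ (T.s e.1)) l) where
  pt := freeObj A Φ (T.t b)
  ι :=
    { app := fun k => freeActι A hl k
      naturality := fun _ _ g => (tensorMap_freeActι A g hl).trans (Category.comp_id _).symm }

variable [∀ A : C, PreservesColimitsOfSize.{w, w} (tensorLeft A)]
variable [∀ A : C, PreservesColimitsOfSize.{w, w} (tensorRight A)]

/-- An ordered tensor product of the objects `freeObj` is a colimit of tensor products over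
coloured operations. -/
noncomputable def isColimitTensorFree {b : T.B} {l : List (T.Fiber b)} (hl : IsOrdering T l) :
    IsColimit (tensorCocone (fun e : T.Fiber b => colimit.cocone (tilde A Φ (T.s e.1))) l) :=
  (nonempty_isColimit_tensorCocone (fun _ => colimit.isColimit _) hl.1 hl.2).some

/-- The action of `b` on the colimits, given by grafting. -/
noncomputable def freeAct (Φ : CartesianMorphism S T) (b : T.B) (l : List (T.Fiber b))
    (hl : IsOrdering T l) :
    tensorOver (fun e => freeObj A Φ (T.s e.1)) l ⟶ freeObj A Φ (T.t b) :=
  (isColimitTensorFree A hl).desc (freeActCocone A b l hl)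

theorem tensor_free_hom_ext {b : T.B} {l : List (T.Fiber b)} (hl : IsOrdering T l) {Z : C}
    {f g : tensorOver (fun e => freeObj A Φ (T.s e.1)) l ⟶ Z}
    (h : ∀ k : ∀ e : T.Fiber b, Classifier Φ (T.s e.1),
      tensorMap (fun e => freeι A (k e)) l ≫ f = tensorMap (fun e => freeι A (k e)) l ≫ g) :
    f = g :=
  (isColimitTensorFree A hl).hom_ext h

theorem tensorMap_freeι_freeAct {b : T.B} {l : List (T.Fiber b)} (hl : IsOrdering T l)
    (k : ∀ e : T.Fiber b, Classifier Φ (T.s e.1)) :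
    tensorMap (fun e => freeι A (k e)) l ≫ freeAct A Φ b l hl = freeActι A hl k :=
  (isColimitTensorFree A hl).fac (freeActCocone A b l hl) k

/-- The action is computed by any composite `c` of `b` with the `k e`, over any colour equal to the
target of `b`. The unit and associativity laws then follow from those of grafting, without rewriting
along equalities of operations. -/
theorem split_freeAct {b : T.B} {l : List (T.Fiber b)} (hl : IsOrdering T l)
    {k : ∀ e : T.Fiber b, Classifier Φ (T.s e.1)} {c : Classifier Φ i} (h : IsGraft b k c)
    (hi : T.t b = i) :
    h.split A hl ≫ tensorMap (fun e => freeι A (k e)) l ≫ freeAct A Φ b l hl ≫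
      eqToHom (congrArg (freeObj A Φ) hi) = freeι A c := by
  subst hi
  obtain rfl := h.unique (isGraft_graft b rfl k)
  rw [reassoc_of% tensorMap_freeι_freeAct, eqToHom_refl, Category.comp_id,
    split_freeActι]

theorem freeAct_equivariant (b : T.B) (l l' : List (T.Fiber b)) (hl : IsOrdering T l)
    (hl' : IsOrdering T l') :
    (tensorPerm _ (hl.perm hl')).hom ≫ freeAct A Φ b l' hl' = freeAct A Φ b l hl := by
  refine tensor_free_hom_ext A hl fun k => ?_
  rw [← reassoc_of% tensorMap_perm (fun e => freeι A (k e)) hl.1 (hl.perm hl'),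
    tensorMap_freeι_freeAct, tensorMap_freeι_freeAct,
    ← cancel_epi ((isGraft_graft b rfl k).split A hl),
    reassoc_of% (isGraft_graft b rfl k).split_perm A hl hl', split_freeActι, split_freeActι]

theorem freeAct_unit (i : I) :
    freeAct A Φ (T.one i) [T.oneE i] (isOrdering_one T i) =
      (ρ_ (freeObj A Φ (T.s (T.oneE i).1))).hom ≫ eqToHom (by rw [T.s_oneE, T.t_one]) := by
  refine tensor_free_hom_ext A (isOrdering_one T i) fun k => ?_
  have e := split_freeAct A (isOrdering_one T i) (IsGraft.one k) (T.t_one i)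
  have e2 := IsGraft.split_one A k
  rw [← cancel_epi ((IsGraft.one k).split A (isOrdering_one T i)),
    ← cancel_mono (eqToHom (congrArg (freeObj A Φ) (T.t_one i)))]
  simp only [Category.assoc]
  rw [e, freeι_cast]
  have e3 : tensorMap (fun e => freeι A (k e)) [T.oneE i] ≫ (ρ_ _).hom =
      (ρ_ _).hom ≫ freeι A (k (T.oneE i)) := by
    simp only [tensorMap]
    rw [tensorHom_id, rightUnitor_naturality]
  rw [reassoc_of% e3, reassoc_of% e2, eqToHom_trans]

theorem freeAct_assoc (b : T.B) (f : T.Fiber b → T.B) (hf : ∀ e, T.t (f e) = T.s e.1)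
    (l : List (T.Fiber b)) (hl : IsOrdering T l) (m : ∀ e, List (T.Fiber (f e)))
    (hm : ∀ e, IsOrdering T (m e)) :
    tensorFlat (X := fun y => freeObj A Φ (T.s y.1)) (Y := fun e => freeObj A Φ (T.s e.1))
        (fun e => image (T.substE b f hf e) (m e))
        (fun e => tensorPull (T.substE b f hf e)
          (fun x => eqToHom (congrArg (freeObj A Φ) (T.s_substE b f hf e x))) (m e) ≫
            freeAct A Φ (f e) (m e) (hm e) ≫ eqToHom (congrArg (freeObj A Φ) (hf e))) l ≫
        freeAct A Φ b l hl =
      freeAct A Φ (T.subst b f hf) (flat (fun e => image (T.substE b f hf e) (m e)) l)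
          (hl.subst hm) ≫
        eqToHom (congrArg (freeObj A Φ) (T.t_subst b f hf)) := by
  refine tensor_free_hom_ext A (hl.subst hm) fun k => ?_
  let h := isGraft_graft (T.subst b f hf) (T.t_subst b f hf) k
  have e1 := split_freeAct A (hl.subst hm) h (T.t_subst b f hf)
  have e2 := split_freeAct A hl h.assoc rfl
  rw [← cancel_epi (h.split A (hl.subst hm)), e1, ← e2, ← h.split_assoc A hl hm, eqToHom_refl,
    Category.comp_id, Category.assoc]
  refine congrArg (_ ≫ ·) ?_
  rw [← Category.assoc, tensorMap_flat, ← Category.assoc, tensorFlat_map]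
  congr 3
  funext e
  have hg := isGraft_graft (f e) (hf e) (IsGraft.restr k e)
  have e3 := split_freeAct A (hm e) hg (hf e)
  have e4 := tensorPull_map (X := fun y => tildeObj A (k y)) (T.substE b f hf e)
    (fun x => 𝟙 (tildeObj A (IsGraft.restr k e x)))
    (fun x => freeι A (IsGraft.restr k e x)) (m e)
  rw [Category.assoc, ← (IsIso.eq_inv_comp (hg.split A (hm e))).2 e3, reassoc_of% e4,
    reassoc_of% tensorMap_pull]
  simp only [freeι_cast]

/-- The `T`-algebra formed by the colimits over the classifier. -/
@[reducible] noncomputable def free (Φ : CartesianMorphism S T) : Algebra T C where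
  obj := freeObj A Φ
  act := freeAct A Φ
  equivariant := freeAct_equivariant A
  unit := freeAct_unit A
  assoc := freeAct_assoc A

end Free

/-! ### Maps induced by morphisms to a restriction -/

section Extension

variable {J I : Type w} {S : PolynomialMonad J} {T : PolynomialMonad I}
variable {C : Type u} [Category.{v} C] [MonoidalCategory C] [SymmetricCategory C]
variable {Φ : CartesianMorphism S T} {i : I}

theorem Algebra.actOn_id (Y : Algebra T C) {b : T.B} {Z : C} (hZ : Y.obj (T.t b) = Z)
    {l : List (T.Fiber b)} (hl : IsOrdering T l) (p : l.Perm (image id (ordering T b))) :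
    Y.actOn (X := fun e => Y.obj (T.s e.1)) b id (fun _ => rfl) hZ l p =
      Y.act b l hl ≫ eqToHom hZ := by
  have q : l.Perm (image id l) := by rw [image_eq, List.map_id]
  have e := tensorPull_eq_id (X := fun e => Y.obj (T.s e.1)) (f := id) (fun _ => rfl)
    (fun _ => rfl) q
  rw [Y.actOn_eq b Function.injective_id _ hZ p hl q, reassoc_of% e]

/-- The map on the tensor product over a coloured operation `c` induced by a morphism from an
`S`-algebra `X` to the restriction of a `T`-algebra `Y`: apply the morphism to each factor, and let
the operation act. -/
noncomputable def evalAt {X : Algebra S C} {Y : Algebra T C} (f : X ⟶ (restriction Φ).obj Y)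
    (c : Classifier Φ i) : tildeObj X c ⟶ Y.obj i :=
  tensorMap (fun e => Algebra.Hom.app f (c.col e) ≫ eqToHom (congrArg Y.obj (c.δ_col e)))
      (ordering T c.b) ≫
    Y.actOn (X := fun e => Y.obj (T.s e.1)) c.b id (fun _ => rfl) (congrArg Y.obj c.t_b)
      (ordering T c.b) (by rw [image_eq, List.map_id])

theorem evalAt_comp {X : Algebra S C} {Y Y' : Algebra T C} (f : X ⟶ (restriction Φ).obj Y)
    (g : Y ⟶ Y') (c : Classifier Φ i) :
    evalAt (f ≫ (restriction Φ).map g) c = evalAt f c ≫ Algebra.Hom.app g i := by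
  have e := Algebra.actOn_natural g (X := fun e : T.Fiber c.b => Y.obj (T.s e.1))
    (X' := fun e => Y'.obj (T.s e.1)) (κ := id) (hX := fun _ => rfl) (hX' := fun _ => rfl)
    (hZ := congrArg Y.obj c.t_b) (hZ' := congrArg Y'.obj c.t_b)
    (hl := by rw [image_eq, List.map_id])
    (isOrdering_ordering T c.b).1 (fun e => Algebra.Hom.app g (T.s e.1))
    (fun e => by simp) (Algebra.Hom.app g i) (Algebra.Hom.app_eqToHom g c.t_b _ _).symm
  rw [evalAt, evalAt, Category.assoc, e, ← Category.assoc, tensorMap_comp]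
  congr 2
  funext x
  refine (Category.assoc _ _ _).trans ((congrArg (Algebra.Hom.app f (c.col x) ≫ ·)
    (Algebra.Hom.app_eqToHom g (c.δ_col x) (congrArg Y'.obj (c.δ_col x))
      (congrArg Y.obj (c.δ_col x)))).trans (Category.assoc _ _ _).symm)

namespace IsGraft

variable {b : T.B} {k : ∀ e : T.Fiber b, Classifier Φ (T.s e.1)} {c : Classifier Φ i}

/-- The actions on `Y` are compatible with grafting, by associativity: evaluating at a composite is
evaluating at each `k e` and then letting `b` act. -/
theorem split_evalAt {X : Algebra S C} {Y : Algebra T C} (f : X ⟶ (restriction Φ).obj Y)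
    (h : IsGraft b k c) (hi : T.t b = i) {l : List (T.Fiber b)} (hl : IsOrdering T l) :
    h.split X hl ≫ tensorMap (fun e => evalAt f (k e)) l ≫ Y.act b l hl ≫
      eqToHom (congrArg Y.obj hi) = evalAt f c := by
  have p0 : l.Perm (image id (ordering T b)) := by
    rw [image_eq, List.map_id]; exact hl.perm (isOrdering_ordering T b)
  have p1 : ∀ e, (ordering T (k e).b).Perm (image id (ordering T (k e).b)) := fun e => by
    rw [image_eq, List.map_id]
  let F (e : T.Fiber c.b) : X.obj (c.col e) ⟶ Y.obj (T.s e.1) :=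
    Algebra.Hom.app f (c.col e) ≫ eqToHom (congrArg Y.obj (c.δ_col e))
  let κ' : T.Fiber (T.subst b (fun e => (k e).b) (fun e => (k e).t_b)) → T.Fiber c.b :=
    fun y => ⟨y.1, y.2.trans h.b_eq⟩
  have hκ' : Function.Injective κ' := fun y y' hy => by
    have hy := congrArg Subtype.val hy
    exact Subtype.ext hy
  have p2 : (ordering T c.b).Perm
      (image κ' (ordering T (T.subst b (fun e => (k e).b) (fun e => (k e).t_b)))) :=
    (isOrdering_ordering T _).perm ((isOrdering_ordering T _).of_bijective
      ⟨hκ', fun y => ⟨⟨y.1, y.2.trans h.b_eq.symm⟩, rfl⟩⟩)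
  have hs : ∀ e (x : T.Fiber (k e).b), Y.obj (T.s (h.emb e x).1) = Y.obj (T.s x.1) := fun e x =>
    congrArg Y.obj (T.s_substE b _ (fun e => (k e).t_b) e x)
  let kk (e : T.Fiber b) : tensorOver (fun y : T.Fiber c.b => Y.obj (T.s y.1))
      (image (h.emb e) (ordering T (k e).b)) ⟶ Y.obj (T.s e.1) :=
    Y.actOn (k e).b (h.emb e) (hs e) (congrArg Y.obj (k e).t_b) _ (List.Perm.refl _)
  have key := Y.actOn_subst (X := fun y : T.Fiber c.b => Y.obj (T.s y.1))
    (Y := fun e : T.Fiber b => Y.obj (T.s e.1)) (Z := Y.obj i) (b := b)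
    (hf := fun e => (k e).t_b) (fun e => image (h.emb e) (ordering T (k e).b)) kk
    (h.ordering_perm hl) (isOrdering_ordering T c.b).1 hl.1 (κ := id) (hY := fun _ => rfl)
    (hZ := congrArg Y.obj hi) (hm' := p0) (κ' := κ') hκ' (hX := fun _ => rfl)
    (hZ' := congrArg Y.obj ((T.t_subst _ _ _).trans hi)) (hl' := p2)
    (fun e => List.Perm.refl _) (fun e => Category.comp_id _)
  have e1 : Y.actOn (X := fun y : T.Fiber c.b => Y.obj (T.s y.1)) c.b id (fun _ => rfl)
      (congrArg Y.obj c.t_b) (ordering T c.b) (by rw [image_eq, List.map_id]) =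
      tensorOp _ kk (h.ordering_perm hl) ≫ Y.act b l hl ≫ eqToHom (congrArg Y.obj hi) := by
    rw [← Y.actOn_id _ hl p0, key]
    exact (Y.actOn_congr h.b_eq fun _ => rfl).symm
  rw [evalAt, e1, split, reassoc_of% tensorOp_map (Y := fun e => tildeObj X (k e)), tensorOp,
    tensorOp, Category.assoc, Category.assoc,
    ← reassoc_of% tensorMap_perm F (isOrdering_ordering T c.b).1 (h.ordering_perm hl),
    reassoc_of% tensorMap_flat]
  congr 3
  funext e
  have e2 := tensorPull_actOn Y (X := fun y : T.Fiber c.b => Y.obj (T.s y.1))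
    (Y := fun x : T.Fiber (k e).b => Y.obj (T.s x.1)) (κ := id) (hY := fun _ => rfl)
    (hZ := congrArg Y.obj (k e).t_b) (isOrdering_ordering T (k e).b).1 (hl := p1 e)
    (h.emb_injective e) (hs e) (List.Perm.refl _)
  rw [evalAt, block, reassoc_of% tensorPull_map, show kk e = _ from e2.symm,
    reassoc_of% tensorMap_pull]
  congr 2
  funext x
  rw [← Category.assoc, ← Algebra.Hom.app_eqToHom f (h.col_emb e x)
    (congrArg Y.obj (congrArg Φ.δ (h.col_emb e x)))]
  simp only [F, Category.assoc]
  refine congrArg (_ ≫ ·) ?_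
  exact (eqToHom_trans _ _).trans (eqToHom_trans _ _).symm

end IsGraft

/-- The coloured operation formed by the unit operation with a given colour. -/
@[reducible] def Classifier.single (j : J) (h : Φ.δ j = i) : Classifier Φ i where
  b := T.one i
  t_b := T.t_one i
  col _ := j
  δ_col e := by rw [T.eq_oneE e, T.s_oneE, h]

theorem oneE_perm_ordering (T : PolynomialMonad I) (i : I) :
    [T.oneE i].Perm (ordering T (T.one i)) :=
  (isOrdering_one T i).perm (isOrdering_ordering T _)

/-- The identification of `A_j` with the tensor product over the unit operation. -/
noncomputable def toSingle (A : Algebra S C) (j : J) (h : Φ.δ j = i) :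
    A.obj j ⟶ tildeObj A (Classifier.single j h) :=
  (ρ_ (A.obj j)).inv ≫ (tensorPerm (fun _ => A.obj j) (oneE_perm_ordering T i)).hom

namespace IsGraft

/-- A coloured operation is the composite of its underlying operation with unit operations. -/
theorem singles (c : Classifier Φ i) :
    IsGraft c.b (fun e => Classifier.single (c.col e) (c.δ_col e)) c where
  b_eq := T.subst_one c.b
  col_eq e x := by
    obtain rfl := T.eq_oneE x
    exact congrArg c.col (Subtype.ext (T.subst_oneE c.b e))

theorem singles_emb (c : Classifier Φ i) (e : T.Fiber c.b) :
    (singles c).emb e (T.oneE (T.s e.1)) = e := Subtype.ext (T.subst_oneE c.b e)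

theorem split_singles (A : Algebra S C) (c : Classifier Φ i) :
    (singles c).split A (isOrdering_ordering T c.b) =
      tensorMap (fun e => toSingle A (c.col e) (c.δ_col e)) (ordering T c.b) := by
  have p : (ordering T c.b).Perm (flat (fun x => [x]) (ordering T c.b)) := by
    rw [flat_single, image_eq]; simp
  have p1 : ∀ e, (image ((singles c).emb e) (ordering T (T.one (T.s e.1)))).Perm
      [(singles c).emb e (T.oneE (T.s e.1))] := fun e =>
    image_perm _ (oneE_perm_ordering T _).symm
  have p2 : ∀ e, (image ((singles c).emb e) (ordering T (T.one (T.s e.1)))).Perm [e] := fun e => by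
    have := p1 e
    rwa [singles_emb] at this
  rw [tensorMap_eq_op _ _ p, split]
  refine tensorOp_congr p2 (fun e => (p2 e).nodup_iff.2 (List.nodup_singleton e)) (fun e => ?_) _ _
  have e1 := tensorPull_perm (X := fun y => A.obj (c.col y)) ((singles c).emb_injective e)
    (fun x => eqToHom (congrArg A.obj ((singles c).col_emb e x))) (isOrdering_one T _).1
    (oneE_perm_ordering T _) (p1 e).symm
  have e2 : ∀ (y : T.Fiber c.b) (hy : y = e) (hX : A.obj (c.col y) = A.obj (c.col e))
      (q : (image ((singles c).emb e) (ordering T (T.one (T.s e.1)))).Perm [y]),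
      (tensorPerm (fun y => A.obj (c.col y)) q).hom ≫ (eqToHom hX ⊗ₘ 𝟙 (𝟙_ C)) =
        (tensorPerm (fun y => A.obj (c.col y)) (p2 e)).hom := by
    rintro y rfl hX q
    simp
  rw [toSingle, Iso.hom_inv_id_assoc, ← e2 _ (singles_emb c e) (congrArg A.obj
    ((singles c).col_emb e _)) (p1 e), Category.assoc]
  refine Eq.trans ?_ (congrArg (_ ≫ ·) e1)
  rw [tensorPerm_trans_assoc, tensorPerm_refl, Category.id_comp]
  rfl

end IsGraft

end Extension

/-! ### The universal property of the free algebra -/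

section Universal

variable {J I : Type w} {S : PolynomialMonad J} {T : PolynomialMonad I}
variable {C : Type u} [Category.{v} C] [MonoidalCategory C] [SymmetricCategory C]
variable {Φ : CartesianMorphism S T} {i : I}

namespace Classifier

/-- The image of an operation `d` of `S`, coloured by the sources of `d`. -/
@[reducible] noncomputable def corolla (Φ : CartesianMorphism S T) (d : S.B) :
    Classifier Φ (Φ.δ (S.t d)) where
  b := Φ.onB d
  t_b := Φ.t_onB d
  col e := S.s ((Φ.fibEquiv d).symm e).1
  δ_col e := Φ.δ_s_symm e

theorem one_δ_t (d : S.B) :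
    T.one (Φ.δ (S.t d)) = T.one (T.t (Φ.onB d)) := congrArg T.one (Φ.t_onB d).symm

theorem substE_single (d : S.B) (x : T.Fiber (Φ.onB d))
    (hf : ∀ e : T.Fiber (T.one (Φ.δ (S.t d))), T.t (Φ.onB d) = T.s e.1)
    (e : T.Fiber (T.one (Φ.δ (S.t d)))) :
    (T.substE (T.one (Φ.δ (S.t d))) (fun _ => Φ.onB d) hf e x).1 = x.1 := by
  obtain rfl := T.eq_oneE e
  have h : (T.oneE (Φ.δ (S.t d))).1 = (T.oneE (T.t (Φ.onB d))).1 := by rw [Φ.t_onB]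
  exact (T.substE_congr (one_δ_t d) _ _ (fun _ => rfl) h rfl).trans (T.one_substE (Φ.onB d) x)

/-- The operation `d` of `S` as a morphism of the classifier. -/
@[reducible] noncomputable def corollaHom (Φ : CartesianMorphism S T) (d : S.B) :
    Hom (corolla Φ d) (single (S.t d) rfl) where
  d _ := d
  t_d _ := rfl
  b_eq := (T.subst_congr (one_δ_t d) _ _ fun _ => rfl).trans (T.one_subst (Φ.onB d))
  col_eq e x := by
    refine (congrArg (corolla Φ d).col (Subtype.ext (substE_single d (Φ.fib x) _ e))).trans ?_
    exact congrArg (fun x : S.Fiber d => S.s x.1) (Φ.fibEquiv_symm_fib x)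

theorem corollaHom_emb (d : S.B) (e : T.Fiber (T.one (Φ.δ (S.t d)))) (x : S.Fiber d) :
    (corollaHom Φ d).emb e x = Φ.fib x :=
  Subtype.ext (substE_single d (Φ.fib x) _ e)

end Classifier

/-- The functor represented by `A` sends the morphism given by `d` to the action of `d` on `A`. -/
theorem tildeMap_corollaHom (A : Algebra S C) (d : S.B) (l : List (S.Fiber d))
    (hl : IsOrdering S l) :
    (tensorPerm (fun e => A.obj (S.s e.1)) (Φ.ordering_perm d hl)).hom ≫
      tensorPull (Y := fun y => A.obj ((Classifier.corolla Φ d).col y)) (Φ.fibEquiv d).symm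
        (fun _ => 𝟙 _) (ordering T (Φ.onB d)) ≫ tildeMap A (Classifier.corollaHom Φ d) =
      A.act d l hl ≫ toSingle A (S.t d) rfl := by
  let M := Classifier.corollaHom Φ d
  let e := T.oneE (Φ.δ (S.t d))
  have p1 : (ordering T (Φ.onB d)).Perm (image (M.emb e) (ordering S d)) := by
    have h := (isOrdering_ordering S d).of_bijective (Φ.fibEquiv d).bijective
    rw [show M.emb e = Φ.fibEquiv d from funext (Classifier.corollaHom_emb d e)]
    exact (isOrdering_ordering T _).perm h
  have p2 : (ordering T (Φ.onB d)).Perm (flat (fun e => image (M.emb e) (ordering S (M.d e))) [e]) :=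
    p1.trans (by simp only [flat]; rw [append_nil])
  have e1 : tildeMap A M ≫ (tensorPerm (fun _ => A.obj (S.t d)) (oneE_perm_ordering T _).symm).hom ≫
      (ρ_ _).hom = (tensorPerm _ p1).hom ≫ A.actOn d (M.emb e)
        (fun x => congrArg A.obj (M.col_emb e x)) rfl _ (List.Perm.refl _) := by
    have e2 := tensorOp_perm (Y := fun _ => A.obj (S.t d)) (isOrdering_ordering T (Φ.onB d)).1
      (isOrdering_ordering T (T.one (Φ.δ (S.t d)))).1 M.ordering_perm
      (oneE_perm_ordering T _).symm p2
      (k := fun e => A.actOn (X := fun y => A.obj ((Classifier.corolla Φ d).col y))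
        (M.d e) (M.emb e) (fun x => congrArg A.obj (M.col_emb e x))
        (congrArg A.obj (M.t_d e)) _ (List.Perm.refl _))
    refine (Category.assoc _ _ _).symm.trans ?_
    exact (congrArg (· ≫ (ρ_ (A.obj (S.t d))).hom) e2).trans (tensorOp_singleton p2 p1)
  rw [← cancel_mono (tensorPerm (fun _ => A.obj (S.t d)) (oneE_perm_ordering T _).symm).hom,
    ← cancel_mono (ρ_ _).hom]
  simp only [Category.assoc]
  rw [e1, A.perm_actOn, toSingle, Category.assoc, tensorPerm_trans_assoc, tensorPerm_refl,
    Category.id_comp, Iso.inv_hom_id, Category.comp_id]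
  have hX : ∀ y, A.obj (S.s ((Φ.fibEquiv d).symm y).1) = A.obj ((Classifier.corolla Φ d).col y) :=
    fun _ => rfl
  have hκ : ∀ x, (Φ.fibEquiv d).symm (M.emb e x) = x := fun x => by
    rw [Classifier.corollaHom_emb, Φ.fibEquiv_symm_fib]
  have p3 : (image (Φ.fibEquiv d).symm (ordering T (Φ.onB d))).Perm
      (image (fun x => (Φ.fibEquiv d).symm (M.emb e x)) (ordering S d)) := by
    refine (image_perm _ p1).trans ?_
    simp [image_eq]; exact List.Perm.refl _
  have e3 := tensorPull_actOn A (X := fun x : S.Fiber d => A.obj (S.s x.1))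
    (Y := fun y => A.obj ((Classifier.corolla Φ d).col y)) (Z := A.obj (S.t d)) (κ := M.emb e)
    (hY := fun x => congrArg A.obj (M.col_emb e x)) (hZ := rfl) (b := d)
    (isOrdering_ordering T (Φ.onB d)).1 (hl := p1) (Φ.fibEquiv d).symm.injective hX p3
  have p4 : l.Perm (image id (ordering S d)) := by
    rw [image_eq, List.map_id]; exact hl.perm (isOrdering_ordering S d)
  refine (congrArg (_ ≫ ·) e3).trans ?_
  rw [A.perm_actOn]
  refine (A.actOn_congr (κ' := id) (hX' := fun _ => rfl) (hZ' := rfl) (hl' := p4) rfl hκ).trans ?_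
  rw [A.actOn_id rfl hl, eqToHom_refl, Category.comp_id]

theorem toSingle_evalAt {A : Algebra S C} {Y : Algebra T C} (f : A ⟶ (restriction Φ).obj Y)
    (j : J) : toSingle A j rfl ≫ evalAt f (Classifier.single j rfl) = Algebra.Hom.app f j := by
  let F (e : T.Fiber (T.one (Φ.δ j))) : A.obj j ⟶ Y.obj (T.s e.1) :=
    Algebra.Hom.app f j ≫ eqToHom (congrArg Y.obj ((Classifier.single (Φ := Φ) j rfl).δ_col e))
  have e1 := tensorMap_perm F (isOrdering_one T (Φ.δ j)).1 (oneE_perm_ordering T (Φ.δ j))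
  have e2 := Y.actOn_one (X := fun e => Y.obj (T.s e.1)) (Z := Y.obj (Φ.δ j)) (Φ.δ j) (κ := id)
    (fun _ => rfl) (congrArg Y.obj (T.t_one _)) (l := [T.oneE (Φ.δ j)])
    (by rw [image_eq, List.map_id]; exact oneE_perm_ordering T _) (List.Perm.refl _)
  rw [toSingle, evalAt, Category.assoc, reassoc_of% e1, Y.perm_actOn]
  rw [tensorPerm_refl, Category.id_comp] at e2
  refine (congrArg (fun x => (ρ_ (A.obj j)).inv ≫ tensorMap F [T.oneE (Φ.δ j)] ≫ x) e2).trans ?_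
  have e3 : tensorMap F [T.oneE (Φ.δ j)] ≫ (ρ_ _).hom = (ρ_ (A.obj j)).hom ≫ F _ := by
    simp only [tensorMap]
    rw [tensorHom_id, rightUnitor_naturality]
  have e4 : Y.obj (T.s (T.oneE (Φ.δ j)).1) = Y.obj (Φ.δ j) := congrArg Y.obj (T.s_oneE _)
  have e5 : (ρ_ (A.obj j)).inv ≫ tensorMap F [T.oneE (Φ.δ j)] ≫ (ρ_ _).hom ≫ eqToHom e4 =
      F _ ≫ eqToHom e4 := by
    rw [reassoc_of% e3, Iso.inv_hom_id_assoc]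
  refine e5.trans ((Category.assoc _ _ _).trans ?_)
  exact (congrArg (_ ≫ ·) (eqToHom_trans _ _)).trans (Category.comp_id _)

variable [HasColimitsOfSize.{w, w} C]

/-- The component of the universal morphism from an algebra to the free algebra. -/
noncomputable def freeUnitApp (A : Algebra S C) (Φ : CartesianMorphism S T) (j : J) :
    A.obj j ⟶ freeObj A Φ (Φ.δ j) :=
  toSingle A j rfl ≫ freeι A (Classifier.single j rfl)

theorem freeUnitApp_eqToHom (A : Algebra S C) (j : J) (h : Φ.δ j = i) :
    freeUnitApp A Φ j ≫ eqToHom (congrArg (freeObj A Φ) h) =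
      toSingle A j h ≫ freeι A (Classifier.single j h) := by
  subst h
  simp [freeUnitApp]

/-- The components of the morphism of `T`-algebras induced by a morphism `f`. -/
noncomputable def freeDescApp {A : Algebra S C} {Y : Algebra T C} (f : A ⟶ (restriction Φ).obj Y)
    (i : I) : freeObj A Φ i ⟶ Y.obj i :=
  colimit.desc (tilde A Φ i) (colimitCocone f i)

theorem freeι_freeDescApp {A : Algebra S C} {Y : Algebra T C} (f : A ⟶ (restriction Φ).obj Y)
    (c : Classifier Φ i) : freeι A c ≫ freeDescApp f i = evalAt f c :=
  colimit.ι_desc _ _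

variable [∀ A : C, PreservesColimitsOfSize.{w, w} (tensorLeft A)]
variable [∀ A : C, PreservesColimitsOfSize.{w, w} (tensorRight A)]

/-- A coloured operation `c` is the composite of its underlying operation with unit operations, so
the colimit cocone at `c` is the action of that operation on components of the unit. -/
theorem tensorMap_freeUnitApp (A : Algebra S C) (c : Classifier Φ i) :
    tensorMap (fun e => freeUnitApp A Φ (c.col e) ≫ eqToHom (congrArg (freeObj A Φ) (c.δ_col e)))
      (ordering T c.b) ≫ freeAct A Φ c.b (ordering T c.b) (isOrdering_ordering T c.b) ≫
        eqToHom (congrArg (freeObj A Φ) c.t_b) = freeι A c := by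
  have e := split_freeAct A (isOrdering_ordering T c.b) (IsGraft.singles c) c.t_b
  rw [IsGraft.split_singles, reassoc_of% tensorMap_comp] at e
  have h : ∀ x, freeUnitApp A Φ (c.col x) ≫ eqToHom (congrArg (freeObj A Φ) (c.δ_col x)) = _ :=
    fun x => freeUnitApp_eqToHom A _ (c.δ_col x)
  simp only [h]
  exact e

/-- The universal morphism commutes with the action of `d`: both sides are components of the colimit
cocone, and these are identified by the morphism of the classifier given by `d`. -/
theorem act_freeUnitApp (A : Algebra S C) (d : S.B) (l : List (S.Fiber d))
    (hl : IsOrdering S l) :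
    A.act d l hl ≫ freeUnitApp A Φ (S.t d) =
      tensorMap (fun e => freeUnitApp A Φ (S.s e.1)) l ≫ restrictAct Φ (free A Φ) d l hl := by
  have e1 := tensorMap_freeUnitApp A (Classifier.corolla Φ d)
  rw [← tildeMap_freeι A (Classifier.corollaHom Φ d)] at e1
  have e2 := tildeMap_corollaHom (Φ := Φ) A d l hl
  have e3 := tensorPull_map (X := fun e => A.obj (S.s e.1))
    (Y := fun y => A.obj ((Classifier.corolla Φ d).col y))
    (Φ.fibEquiv d).symm (fun _ => 𝟙 _)
    (fun e => freeUnitApp A Φ ((Classifier.corolla Φ d).col e) ≫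
      eqToHom (congrArg (freeObj A Φ) ((Classifier.corolla Φ d).δ_col e)))
    (ordering T (Φ.onB d))
  rw [freeUnitApp, ← reassoc_of% e2, ← e1, reassoc_of% e3, restrictAct, Algebra.actOn,
    ← reassoc_of% tensorMap_perm (fun e => freeUnitApp A Φ (S.s e.1)) hl.1 (Φ.ordering_perm d hl),
    reassoc_of% tensorMap_pull]

/-- The universal morphism from an `S`-algebra to the restriction of its free `T`-algebra. -/
noncomputable def freeUnit (A : Algebra S C) (Φ : CartesianMorphism S T) :
    A ⟶ (restriction Φ).obj (free A Φ) where
  app := freeUnitApp A Φ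
  comm := act_freeUnitApp A

theorem evalAt_freeUnit (A : Algebra S C) (c : Classifier Φ i) :
    evalAt (freeUnit A Φ) c = freeι A c := by
  rw [← tensorMap_freeUnitApp, evalAt]
  exact congrArg (_ ≫ ·) ((free A Φ).actOn_id _ (isOrdering_ordering T c.b) _)

/-- The morphism of `T`-algebras induced by a morphism to the restriction of a `T`-algebra. -/
noncomputable def freeDesc {A : Algebra S C} {Y : Algebra T C} (f : A ⟶ (restriction Φ).obj Y) :
    free A Φ ⟶ Y where
  app := freeDescApp f
  comm b l hl := by
    refine tensor_free_hom_ext A hl fun k => ?_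
    have h := isGraft_graft b rfl k
    have e1 := split_freeAct A hl h rfl
    have e2 := h.split_evalAt f rfl hl
    rw [eqToHom_refl, Category.comp_id] at e1 e2
    rw [← cancel_epi (h.split A hl), reassoc_of% tensorMap_comp, reassoc_of% e1,
      freeι_freeDescApp]
    simp only [freeι_freeDescApp]
    exact e2.symm

theorem freeUnit_freeDesc {A : Algebra S C} {Y : Algebra T C} (f : A ⟶ (restriction Φ).obj Y) :
    freeUnit A Φ ≫ (restriction Φ).map (freeDesc f) = f := by
  refine Algebra.Hom.ext (funext fun j => ?_)
  have e : freeUnitApp A Φ j ≫ freeDescApp f (Φ.δ j) = Algebra.Hom.app f j := by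
    rw [freeUnitApp, Category.assoc, freeι_freeDescApp, toSingle_evalAt]
  exact e

theorem free_algebra_hom_ext {A : Algebra S C} {Y : Algebra T C} {g g' : free A Φ ⟶ Y}
    (h : freeUnit A Φ ≫ (restriction Φ).map g = freeUnit A Φ ≫ (restriction Φ).map g') :
    g = g' := by
  refine Algebra.Hom.ext (funext fun i => free_hom_ext A fun c => ?_)
  have e := evalAt_comp (freeUnit A Φ) g c
  rw [h, evalAt_comp, evalAt_freeUnit] at e
  exact e.symm

theorem isRightAdjoint_restriction (Φ : CartesianMorphism S T) :
    (restriction (C := C) Φ).IsRightAdjoint := by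
  have h (A : Algebra S C) : HasInitial (StructuredArrow A (restriction (C := C) Φ)) := by
    refine IsInitial.hasInitial (X := StructuredArrow.mk (freeUnit A Φ))
      (IsInitial.ofUniqueHom (fun Y => StructuredArrow.homMk (freeDesc Y.hom)
        (freeUnit_freeDesc Y.hom)) fun Y m => ?_)
    ext1
    refine free_algebra_hom_ext ?_
    exact (StructuredArrow.w m).trans (freeUnit_freeDesc Y.hom).symm
  exact isRightAdjointOfStructuredArrowInitials _

theorem nonempty_isColimit_freeUnit (A : Algebra S C) (i : I) :
    Nonempty (IsColimit (colimitCocone (freeUnit A Φ) i)) :=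
  ⟨(colimit.isColimit (tilde A Φ i)).ofIsoColimit
    (Cocone.ext (Iso.refl _) fun c => (Category.comp_id _).trans (evalAt_freeUnit A c).symm)⟩

/-- Every left adjoint of the restriction functor is computed by the colimits over the classifier,
because its unit is isomorphic to `freeUnit`. -/
theorem nonempty_isColimit_unit {γ : Algebra S C ⥤ Algebra T C} (adj : γ ⊣ restriction Φ)
    (A : Algebra S C) (i : I) : Nonempty (IsColimit (colimitCocone (adj.unit.app A) i)) := by
  obtain ⟨h⟩ := nonempty_isColimit_freeUnit (Φ := Φ) A i
  let f : free A Φ ⟶ γ.obj A := freeDesc (adj.unit.app A)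
  let g : γ.obj A ⟶ free A Φ := (adj.homEquiv _ _).symm (freeUnit A Φ)
  have hf : freeUnit A Φ ≫ (restriction Φ).map f = adj.unit.app A := freeUnit_freeDesc _
  have hg : adj.unit.app A ≫ (restriction Φ).map g = freeUnit A Φ := by
    exact (adj.homEquiv_unit _ _ _).symm.trans (Equiv.apply_symm_apply _ _)
  have hfg : f ≫ g = 𝟙 _ := free_algebra_hom_ext (by
    rw [Functor.map_comp, reassoc_of% hf, hg]; exact (Category.comp_id _).symm)
  have hgf : g ≫ f = 𝟙 _ := (adj.homEquiv _ _).injective (by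
    rw [adj.homEquiv_unit, adj.homEquiv_unit, Functor.map_comp, reassoc_of% hg, hf]
    exact (Category.comp_id _).symm)
  refine ⟨h.ofIsoColimit (Cocone.ext
    ⟨Algebra.Hom.app f i, Algebra.Hom.app g i, congrArg (fun x => Algebra.Hom.app x i) hfg,
      congrArg (fun x => Algebra.Hom.app x i) hgf⟩ fun c => ?_)⟩
  exact (evalAt_comp (freeUnit A Φ) f c).symm.trans (congrArg (evalAt · c) hf)

end Universal

/-! ### Left Kan extension along the functor that forgets the colouring -/

section Kan

variable {J I : Type w} {S : PolynomialMonad J} {T : PolynomialMonad I}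
variable {C : Type u} [Category.{v} C] [MonoidalCategory C] [SymmetricCategory C]

/-- Every object of the classifier of the identity has exactly one morphism to `1_i`, given by its
underlying operation. -/
theorem nonempty_isTerminal_one (T : PolynomialMonad I) (i : I) :
    Nonempty (IsTerminal (Classifier.one T i)) := by
  have hd : ∀ {c : Classifier (CartesianMorphism.id T) i}
      (f : Classifier.Hom c (Classifier.one T i)) e, f.d e = c.b := fun {c} f e => by
    obtain rfl := T.eq_oneE e
    have ht : T.t (f.d (T.oneE i)) = i := (f.t_d _).trans (T.s_oneE i)
    refine Eq.trans ?_ f.b_eq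
    refine ((T.subst_congr (congrArg T.one ht.symm) _ _ fun e => ?_).trans
      (T.one_subst (f.d (T.oneE i)))).symm
    obtain rfl := T.eq_oneE e
    rfl
  have ht : ∀ (c : Classifier (CartesianMorphism.id T) i) (e : T.Fiber (T.one i)),
      T.t c.b = T.s e.1 := fun c e => by rw [T.eq_oneE e, T.s_oneE, c.t_b]
  let m (c : Classifier (CartesianMorphism.id T) i) : Classifier.Hom c (Classifier.one T i) :=
    { d := fun _ => c.b
      t_d := ht c
      b_eq := (T.subst_congr (congrArg T.one c.t_b.symm) (ht c) _ fun _ => rfl).trans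
        (T.one_subst c.b)
      col_eq := fun e x => (c.δ_col _).trans (T.s_substE (T.one i) (fun _ => c.b) (ht c) e x) }
  exact ⟨IsTerminal.ofUniqueHom m fun c f => Classifier.Hom.ext (funext (hd f))⟩

/-- The value of a left Kan extension at `1_i` is the colimit, since `1_i` is terminal. -/
theorem isIso_kanComparison [HasColimitsOfSize.{w, w} C] {Φ : CartesianMorphism S T}
    {X : Algebra S C} {Y : Algebra T C} {f : X ⟶ (restriction Φ).obj Y} {i : I}
    (h : IsColimit (colimitCocone f i)) : IsIso (kanComparison f i) := by
  let L := Classifier.forget Φ i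
  let G := L.lan.obj (tilde X Φ i)
  let α : tilde X Φ i ⟶ L ⋙ G := L.lanUnit.app (tilde X Φ i)
  have h' := G.isColimitCoconeOfIsLeftKanExtension α h
  obtain ⟨ht⟩ := nonempty_isTerminal_one T i
  have e : kanComparison f i =
      (G.coconeOfIsLeftKanExtension α (colimitCocone f i)).ι.app (Classifier.one T i) := by
    have e' : G.descOfIsLeftKanExtension α _ (tildeTrans f i) ≫ (actionCocone Y i).ι =
        (G.coconeOfIsLeftKanExtension α (colimitCocone f i)).ι := by
      have e1 := G.descOfIsLeftKanExtension_fac α _ (tildeTrans f i)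
      have e2 := G.descOfIsLeftKanExtension_fac α
        ((Functor.const _).obj (colimitCocone f i).pt) (colimitCocone f i).ι
      refine G.hom_ext_of_isLeftKanExtension α _ _ (Eq.trans ?_ e2.symm)
      exact (Category.assoc _ _ _).symm.trans
        (congrArg (· ≫ Functor.whiskerLeft L (actionCocone Y i).ι) e1)
    exact NatTrans.congr_app e' _
  rw [e]
  exact h'.isIso_ι_app_of_isTerminal _ ht

end Kan

end PolyMonads

theorem theorem6p1 {C : Type u} [Category.{v} C] [MonoidalCategory C] [SymmetricCategory C]
    [HasColimitsOfSize.{w, w} C]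
    [∀ A : C, PreservesColimitsOfSize.{w, w} (tensorLeft A)]
    [∀ A : C, PreservesColimitsOfSize.{w, w} (tensorRight A)]
    {J I : Type w} (S : PolyMonads.PolynomialMonad J) (T : PolyMonads.PolynomialMonad I)
    (Φ : PolyMonads.CartesianMorphism S T) :
    (PolyMonads.restriction (C := C) Φ).IsRightAdjoint ∧
      ∀ (γ : PolyMonads.Algebra S C ⥤ PolyMonads.Algebra T C)
        (adj : γ ⊣ PolyMonads.restriction Φ) (X : PolyMonads.Algebra S C) (i : I),
        IsIso (PolyMonads.kanComparison (adj.unit.app X) i) ∧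
          Nonempty (IsColimit (PolyMonads.colimitCocone (adj.unit.app X) i)) := by
  refine ⟨PolyMonads.isRightAdjoint_restriction Φ, fun γ adj X i => ?_⟩
  obtain ⟨h⟩ := PolyMonads.nonempty_isColimit_unit adj X i
  exact ⟨PolyMonads.isIso_kanComparison h, ⟨h⟩⟩
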